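/- \textbf{Game.} Let $\bar\epsilon\in(0,1)$. A state $\omega\in[-1,1]$ is drawn from a distribution $G$. One of two speakers is the expert, who observes $\omega$; the other is the quack, who observes nothing. The speakers know who is who; the judge assigns probability $1/2$ to each speaker being the expert. Simultaneously each speaker $i$ sends a message $m_i\in[-1,1]$. The judge observes $(m_1,m_2)$ and a signal $s=\omega+\epsilon$, where $\epsilon$ is uniform on $[-\bar\epsilon,\bar\epsilon]$ and independent of the rest, and selects one speaker according to a measurable rule giving the probability of selecting speaker $1$ as a function of $(m_1,m_2,s)$. A speaker gets $1$ if selected and $0$ otherwise; the judge gets $1$ if she selects the expert and $0$ otherwise. A (perfect Bayesian) equilibrium consists of a transition kernel $F_E(\cdot\mid\omega)$ for the expert, a distribution $F_Q$ for the quack, and a selection rule such that: in every state $\omega$, and whichever of the two speakers is the expert, $F_E(\cdot\mid\omega)$ maximizes the expert's probability of being selected; $F_Q$ maximizes the quack's probability of being selected, whichever speaker is the quack; and, for some belief that is a version of the conditional probability that speaker $1$ is the expert given $(m_1,m_2,s)$, the judge, after every $(m_1,m_2,s)$, selects only a speaker who is most likely to be the expert under that belief. \textbf{Proposition.} Suppose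 that $G$ is symmetric around $0$ and strictly unimodal on $[-1,1]$, that is, $G$ has a density on $[-1,1]$ that is symmetric around $0$ and strictly decreasing on $[0,1]$. Write $G(x)$ also for its distribution function. Then there is a threshold $\bar m\in(0,1]$ such that the following hold. (1) There is an equilibrium in which the expert reports the state truthfully ($F_E(\cdot\mid\omega)=\delta_\omega$ for every $\omega$) and the quack's message is distributed according to the prior conditioned on $[-\bar m,\bar m]$, i.e. its distribution function is $$F_Q(m)=\begin{cases}0,& m\le-\bar m,\\ \dfrac{G(m)-G(-\bar m)}{G(\bar m)-G(-\bar m)},& m\in[-\bar m,\bar m],\\ 1,& m\ge\bar m.\end{cases}$$ (2) For $a\in(0,1]$ let $\Pi(a)$ be the payoff that the quack secures against a truthful expert by drawing his message from the prior conditioned on $[-a,a]$: the infimum, over all selection rules, of his probability of being selected (each speaker being the quack with probability $1/2$). Then $\bar m$ is the unique maximizer of $\Pi$ on $(0,1]$, and for all $a\in(0,1]$ $$\Pi(a)=\frac{1}{4\,(2G(a)-1)\,\bar\epsilon}\int_{-a-\bar\epsilon}^{a+\bar\epsilon}\Bigl(G(\min\{s+\bar\epsilon,a\})-G(\max\{s-\bar\epsilon,-a\})\Bigr)^2\,ds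 .$$ -/

import Mathlib

open MeasureTheory ProbabilityTheory

namespace ExpertQuack

/-- The state space `[-1,1]`. -/
abbrev State : Type := Set.Icc (-1 : ℝ) 1

/-- The message space `[-1,1]`. -/
abbrev Message : Type := Set.Icc (-1 : ℝ) 1

/-- The distribution function of a law on `[-1,1]`. -/
noncomputable def distFun (μ : Measure State) (x : ℝ) : ℝ :=
  μ.real {ω | (ω : ℝ) ≤ x}

/-- `G` has a density on `[-1,1]` that is symmetric around `0` and strictly decreasing
on `[0,1]`. In particular the density is positive on `(-1,1)`. -/
def SymmetricStrictlyUnimodal (G : Measure State) : Prop :=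
  ∃ g : ℝ → ℝ,
    (∀ x ∈ Set.Icc (-1 : ℝ) 1, 0 ≤ g x) ∧
    (∀ x ∈ Set.Icc (-1 : ℝ) 1, g (-x) = g x) ∧
    StrictAntiOn g (Set.Icc 0 1) ∧
    G = (Measure.comap Subtype.val (volume : Measure ℝ)).withDensity
      (fun ω : State => ENNReal.ofReal (g ω))

/-- The uniform law on `[-ε, ε]`, the law of the noise in the judge's signal. -/
noncomputable def noise (ε : ℝ) : Measure ℝ :=
  ProbabilityTheory.cond volume (Set.Icc (-ε) ε)

/-- A measurable selection rule of the judge: `prob m₁ m₂ s` is the probability that speaker `1`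
is selected when speaker `1` sends `m₁`, speaker `2` sends `m₂` and the signal is `s`; speaker `2`
is selected with the remaining probability. -/
structure SelectionRule where
  prob : Message → Message → ℝ → ℝ
  measurable_prob : Measurable (fun x : Message × Message × ℝ => prob x.1 x.2.1 x.2.2)
  prob_mem : ∀ m₁ m₂ s, prob m₁ m₂ s ∈ Set.Icc (0 : ℝ) 1

/-- The probability that speaker `i` is selected, when he sends `m`, his opponent sends `m'` and
the signal is `s`. The index `0` stands for speaker `1`, the index `1` for speaker `2`. -/
noncomputable def SelectionRule.sel (φ : SelectionRule) (i : Fin 2) (m m' : Message) (s : ℝ) : ℝ :=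
  if i = 0 then φ.prob m m' s else 1 - φ.prob m' m s

/-- The probability that speaker `i` is selected if he is the expert, the state is `ω`, he draws his
message from `ν`, and the quack draws his message from `FQ`. -/
noncomputable def expertPayoff (ε : ℝ) (FQ : Measure Message) (φ : SelectionRule)
    (i : Fin 2) (ω : State) (ν : Measure Message) : ℝ :=
  ∫ x : Message × Message × ℝ, φ.sel i x.1 x.2.1 ((ω : ℝ) + x.2.2) ∂(ν.prod (FQ.prod (noise ε)))

/-- The probability that speaker `i` is selected if he is the quack and draws his message from `ν`,
the state has law `G`, and the expert uses the messaging strategy `FE`. -/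
noncomputable def quackPayoff (G : Measure State) (ε : ℝ) (FE : Kernel State Message)
    (φ : SelectionRule) (i : Fin 2) (ν : Measure Message) : ℝ :=
  ∫ x : Message × (State × Message) × ℝ,
    φ.sel i x.1 x.2.1.2 ((x.2.1.1 : ℝ) + x.2.2) ∂(ν.prod ((G.compProd FE).prod (noise ε)))

/-- The law of `((state, expert's message), quack's message, noise)`. -/
noncomputable def playLaw (G : Measure State) (ε : ℝ) (FE : Kernel State Message)
    (FQ : Measure Message) : Measure ((State × Message) × Message × ℝ) :=
  (G.compProd FE).prod (FQ.prod (noise ε))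

/-- The law of what the judge observes, `(m₁, m₂, s)`, when speaker `i` is the expert. -/
noncomputable def observationLaw (G : Measure State) (ε : ℝ) (FE : Kernel State Message)
    (FQ : Measure Message) (i : Fin 2) : Measure (Message × Message × ℝ) :=
  (playLaw G ε FE FQ).map (fun x =>
    if i = 0 then (x.1.2, x.2.1, (x.1.1 : ℝ) + x.2.2)
    else (x.2.1, x.1.2, (x.1.1 : ℝ) + x.2.2))

/-- `β (m₁, m₂, s)` is a version of the conditional probability that speaker `1` is the expert,
given what the judge observes, when each speaker is the expert with prior probability `1/2`
(the factor `1/2` cancels on both sides of Bayes' rule). -/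
def BayesConsistent (G : Measure State) (ε : ℝ) (FE : Kernel State Message)
    (FQ : Measure Message) (β : Message × Message × ℝ → ℝ) : Prop :=
  Measurable β ∧ (∀ y, β y ∈ Set.Icc (0 : ℝ) 1) ∧
    observationLaw G ε FE FQ 0 =
      (observationLaw G ε FE FQ 0 + observationLaw G ε FE FQ 1).withDensity
        (fun y => ENNReal.ofReal (β y))

/-- Perfect Bayesian equilibrium. In every state the expert's mixed message maximizes his
probability of being selected; the quack's mixed message does so too, whatever the speakers' labels;
and for some Bayes-consistent beliefs the judge, after every observation, selects only a speaker
that is most likely to be the expert. -/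
structure IsPBE (G : Measure State) (ε : ℝ) (FE : Kernel State Message)
    (FQ : Measure Message) (φ : SelectionRule) : Prop where
  expert_strategy : IsMarkovKernel FE
  quack_strategy : IsProbabilityMeasure FQ
  expert_optimal : ∀ (i : Fin 2) (ω : State) (ν : Measure Message), IsProbabilityMeasure ν →
    expertPayoff ε FQ φ i ω ν ≤ expertPayoff ε FQ φ i ω (FE ω)
  quack_optimal : ∀ (i : Fin 2) (ν : Measure Message), IsProbabilityMeasure ν →
    quackPayoff G ε FE φ i ν ≤ quackPayoff G ε FE φ i FQ
  judge_optimal : ∃ β : Message × Message × ℝ → ℝ, BayesConsistent G ε FE FQ β ∧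
    ∀ m₁ m₂ s,
      (1 / 2 < β (m₁, m₂, s) → φ.prob m₁ m₂ s = 1) ∧
      (β (m₁, m₂, s) < 1 / 2 → φ.prob m₁ m₂ s = 0)

/-- The truthful messaging strategy: in state `ω` the message is `ω` with certainty. -/
noncomputable def truthful : Kernel State Message :=
  Kernel.deterministic (fun ω => ω) measurable_id

/-- The prior conditioned on `[-a, a]`. -/
noncomputable def truncatedPrior (G : Measure State) (a : ℝ) : Measure Message :=
  ProbabilityTheory.cond G {ω | (ω : ℝ) ∈ Set.Icc (-a) a}

/-- The payoff that the quack secures with the messaging strategy `ν` against a truthful expert: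
the infimum over all selection rules of his probability of being selected, each speaker being
the quack with probability `1/2`. -/
noncomputable def securedPayoff (G : Measure State) (ε : ℝ) (ν : Measure Message) : ℝ :=
  ⨅ φ : SelectionRule,
    (quackPayoff G ε truthful φ 0 ν + quackPayoff G ε truthful φ 1 ν) / 2

end ExpertQuack

namespace ExpertQuack

/-! Write `μ = symMeasure h` for the prior on the line and `k = kern ε`. By symmetry everything
folds onto `(0, 1]`. The chance that two messages both fit the signal is measured by the overlap of
two windows of radius `ε`, and folding turns this overlap into `k`. Put `W x = lowerMass μ k x x`,
and let `A x = average μ k x` be the `μ`-mean of `W` over `(0, x]`.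

Secured payoff. Suppose that the quack draws from the prior on `[-a, a]` and the expert is truthful.
The two possible densities of the observation then agree whenever both messages lie in `[-a, a]` and
fit the signal, and their minimum vanishes elsewhere. The judge's most damaging rule leaves the
quack half the integral of this minimum (`securedPayoff_eq_minDensity`). Integrating the messages
out first gives the closed form; integrating the signal out first gives `A a / (2 * ε)`
(`securedPayoff_eq_average`). So the threshold `b` has to maximize `A`. The function `W` increases
and then decreases: on `[0, ε]` it is a decreasing affine function times a concave increasing mass
(`lowerMass_kern_min_lt`), and on `[ε, 1]` a reflection argument applies (`strictAntiOn_lowerMass`).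
Hence `A` has exactly one maximizer `b`, with `A ≤ W` on `(0, b]` and `W ≤ A b` beyond it
(`exists_threshold`).

Equilibrium. When both messages are in `[-b, b]` and fit the signal, the judge's posterior is `1/2`,
so she may randomize at will. She rejects a message that does not fit in favour of one that does;
between two fitting messages, the larger modulus `y` concedes the share `τ y`, with `τ = 0` beyond
`b`. Up to the factor `1 / (2 * ε)`, a quack of modulus `x` earns `(1 - τ x) * W x` plus the
integral of `k x y * τ y` over `y > x`. `exists_balancing` finds shares that make this equal to `A
b` on `(0, b]`: a monotone iteration yields a fixed point at which the payoff equals its own running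
mean, and such a function is constant (`eq_of_mul_measure_eq_setIntegral`). Beyond `b` the quack
earns `W x ≤ A b`. The expert's gain from a message is at most a term independent of that message
plus what a quack would earn from it, with equality under truth; for states in `[-b, b]` the quack's
indifference therefore makes truth optimal, and for other states truth wins for sure
(`expertValue_le`). -/

/-- The mass with which the points of `(0, x]` are matched with `y` by the kernel `k`. -/
noncomputable def lowerMass (μ : Measure ℝ) (k : ℝ → ℝ → ℝ) (x y : ℝ) : ℝ :=
  ∫ z in Set.Ioc 0 x, k z y ∂μ

/-! ### Measurability and Fubini for bounded kernels on `(0, a]`. -/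

theorem integrable_of_bounded {α : Type*} [MeasurableSpace α] {μ : Measure α} [IsFiniteMeasure μ]
    {F : α → ℝ} (hF : Measurable F) {C : ℝ} (hC : ∀ x, |F x| ≤ C) : Integrable F μ :=
  Integrable.of_bound hF.aestronglyMeasurable C (Filter.Eventually.of_forall hC)

theorem measurable_setIntegral_Ioc {μ : Measure ℝ} [SFinite μ] {F : ℝ → ℝ → ℝ}
    (hF : Measurable (Function.uncurry F)) {b c : ℝ → ℝ} (hb : Measurable b) (hc : Measurable c) :
    Measurable (fun x => ∫ y in Set.Ioc (b x) (c x), F x y ∂μ) := by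
  have h : Measurable (fun p : ℝ × ℝ =>
      Set.indicator {q : ℝ × ℝ | b q.1 < q.2 ∧ q.2 ≤ c q.1} (Function.uncurry F) p) := by
    refine hF.indicator ?_
    exact (measurableSet_lt (hb.comp measurable_fst) measurable_snd).inter
      (measurableSet_le measurable_snd (hc.comp measurable_fst))
  have h2 := (h.stronglyMeasurable.integral_prod_right' (ν := μ)).measurable
  convert h2 using 2 with x
  rw [← integral_indicator measurableSet_Ioc]
  rfl

theorem setIntegral_Ioc_split {μ : Measure ℝ} {F : ℝ → ℝ} (hF : Integrable F μ) {x a : ℝ} (hx : 0 ≤ x)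
    (hxa : x ≤ a) :
    ∫ y in Set.Ioc 0 a, F y ∂μ = ∫ y in Set.Ioc 0 x, F y ∂μ + ∫ y in Set.Ioc x a, F y ∂μ := by
  rw [← Set.Ioc_union_Ioc_eq_Ioc hx hxa]
  exact setIntegral_union (Set.Ioc_disjoint_Ioc_of_le le_rfl) measurableSet_Ioc
    hF.integrableOn hF.integrableOn

section Core

variable {μ : Measure ℝ} [IsFiniteMeasure μ] {k : ℝ → ℝ → ℝ} {C : ℝ}

theorem abs_setIntegral_le {s : Set ℝ} {F : ℝ → ℝ} {C : ℝ} (hF : ∀ x, |F x| ≤ C) :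
    |∫ x in s, F x ∂μ| ≤ C * μ.real Set.univ := by
  have h := norm_integral_le_of_norm_le_const (μ := μ.restrict s) (f := F) (C := C)
    (Filter.Eventually.of_forall hF)
  have hC : 0 ≤ C := (abs_nonneg _).trans (hF 0)
  refine h.trans ?_
  gcongr
  rw [measureReal_restrict_apply MeasurableSet.univ]
  exact measureReal_mono (by simp)

theorem measurable_lowerMass (hk : Measurable (Function.uncurry k)) :
    Measurable (Function.uncurry (lowerMass μ k)) := by
  have h : Measurable (fun p : (ℝ × ℝ) × ℝ =>
      Set.indicator {q : (ℝ × ℝ) × ℝ | 0 < q.2 ∧ q.2 ≤ q.1.1} (fun q => k q.2 q.1.2) p) := by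
    refine Measurable.indicator ?_ ?_
    · exact hk.comp (measurable_snd.prodMk (measurable_snd.comp measurable_fst))
    · exact (measurableSet_lt measurable_const measurable_snd).inter
        (measurableSet_le measurable_snd (measurable_fst.comp measurable_fst))
  have h2 := (h.stronglyMeasurable.integral_prod_right' (ν := μ)).measurable
  convert h2 using 2 with p
  simp only [lowerMass, Function.uncurry]
  rw [← integral_indicator measurableSet_Ioc]
  rfl

/-- Fubini on the region `0 < z ≤ x`, `z < y ≤ a`, cut at `y = x`: below the cut `z` runs up to `y`,
above it up to `x`. Without atoms, the endpoint `z = y` does not matter. -/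
theorem triangle_swap [NullSingletonClass μ] (hk : Measurable (Function.uncurry k))
    (hkC : ∀ x y, |k x y| ≤ C) {θ : ℝ → ℝ} (hθ : Measurable θ)
    {B : ℝ} (hθB : ∀ y, |θ y| ≤ B) {x a : ℝ} (hx : 0 ≤ x) (hxa : x ≤ a) :
    ∫ z in Set.Ioc 0 x, ∫ y in Set.Ioc z a, k z y * θ y ∂μ ∂μ =
      ∫ y in Set.Ioc 0 x, θ y * lowerMass μ k y y ∂μ +
        ∫ y in Set.Ioc x a, θ y * lowerMass μ k x y ∂μ := by
  have hC : 0 ≤ C := (abs_nonneg _).trans (hkC 0 0)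
  have hB : 0 ≤ B := (abs_nonneg _).trans (hθB 0)
  let F : ℝ → ℝ → ℝ := fun z y => if z < y then k z y * θ y else 0
  have hFm : Measurable (Function.uncurry F) := by
    refine Measurable.ite (measurableSet_lt measurable_fst measurable_snd) ?_ measurable_const
    exact hk.mul (hθ.comp measurable_snd)
  have hFb : ∀ p, |Function.uncurry F p| ≤ C * B := by
    rintro ⟨z, y⟩
    simp only [Function.uncurry, F]
    split_ifs
    · rw [abs_mul]; exact mul_le_mul (hkC _ _) (hθB _) (abs_nonneg _) hC
    · simp; positivity
  have h1 : ∫ z in Set.Ioc 0 x, ∫ y in Set.Ioc z a, k z y * θ y ∂μ ∂μ =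
      ∫ z in Set.Ioc 0 x, ∫ y in Set.Ioc 0 a, F z y ∂μ ∂μ := by
    refine setIntegral_congr_fun measurableSet_Ioc fun z hz => ?_
    rw [← integral_indicator measurableSet_Ioc, ← integral_indicator measurableSet_Ioc]
    congr 1 with y
    simp only [Set.indicator, Set.mem_Ioc, F]
    have := hz.1
    split_ifs <;> first | rfl | (exfalso; grind)
  rw [h1, integral_integral_swap (integrable_of_bounded hFm hFb)]
  have hI : Integrable (fun y => ∫ z in Set.Ioc 0 x, F z y ∂μ) μ := by
    refine integrable_of_bounded
      (measurable_setIntegral_Ioc (F := fun y z => F z y) (hFm.comp measurable_swap)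
        measurable_const measurable_const) (C := C * B * μ.real Set.univ) fun y => ?_
    exact abs_setIntegral_le fun z => hFb (z, y)
  rw [setIntegral_Ioc_split hI hx hxa]
  congr 1
  · refine setIntegral_congr_fun measurableSet_Ioc fun y hy => ?_
    simp only [lowerMass]
    rw [← integral_const_mul, ← integral_indicator measurableSet_Ioc,
      ← integral_indicator measurableSet_Ioc]
    have hne : ∀ᵐ z ∂μ, z ≠ y := by
      simp [ae_iff]
    refine integral_congr_ae (hne.mono fun z hz => ?_)
    simp only [Set.indicator, Set.mem_Ioc, F]
    have h3 := hy.2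
    split_ifs <;> first | exact mul_comm _ _ | rfl | (exfalso; grind)
  · refine setIntegral_congr_fun measurableSet_Ioc fun y hy => ?_
    simp only [lowerMass]
    rw [← integral_const_mul]
    refine setIntegral_congr_fun measurableSet_Ioc fun z hz => ?_
    have : z < y := hz.2.trans_lt hy.1
    simp only [F, this, if_true]
    ring

end Core
-- A function equal to its running mean is constant. No continuity is needed: the largest deviation
-- from `V x` on `[x, a]` is bounded by a fixed fraction less than one of itself, because the part
-- `(0, x]` of the mean contributes no deviation.
theorem eq_of_mul_measure_eq_setIntegral {μ : Measure ℝ} [IsFiniteMeasure μ] {V : ℝ → ℝ}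
    (hV : Measurable V) {B : ℝ} (hVB : ∀ x, |V x| ≤ B) {a : ℝ}
    (hpos : ∀ x ∈ Set.Ioc 0 a, 0 < μ.real (Set.Ioc 0 x))
    (h : ∀ x ∈ Set.Ioc 0 a, μ.real (Set.Ioc 0 x) * V x = ∫ z in Set.Ioc 0 x, V z ∂μ)
    {x : ℝ} (hx : x ∈ Set.Ioc 0 a) : V x = V a := by
  have hint : Integrable V μ := integrable_of_bounded hV hVB
  have hint' : Integrable (fun z => V z - V x) μ := hint.sub (integrable_const _)
  set S : Set ℝ := (fun t => |V t - V x|) '' Set.Icc x a with hS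
  have hne : S.Nonempty := ⟨_, x, ⟨le_rfl, hx.2⟩, rfl⟩
  have hbdd : BddAbove S := by
    refine ⟨B + B, ?_⟩
    rintro _ ⟨t, -, rfl⟩
    exact (abs_sub _ _).trans (add_le_add (hVB _) (hVB _))
  set m := sSup S
  have hle : ∀ t ∈ Set.Icc x a, |V t - V x| ≤ m := fun t ht => le_csSup hbdd ⟨t, ht, rfl⟩
  have hm0 : 0 ≤ m := (abs_nonneg _).trans (hle x ⟨le_rfl, hx.2⟩)
  set n : ℝ → ℝ := fun t => μ.real (Set.Ioc 0 t) with hn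
  have hna : 0 < n a := hpos a ⟨hx.1.trans_le hx.2, le_rfl⟩
  have hnx : 0 < n x := hpos x hx
  -- Subtracting the two mean identities leaves only the integral over `(x, t]`, whose share of the
  -- mass is `1 - n x / n t`; replacing `n t` by `n a` makes the bound uniform in `t`.
  have key : ∀ t ∈ Set.Icc x a, |V t - V x| ≤ (1 - n x / n a) * m := by
    intro t ht
    have ht0 : t ∈ Set.Ioc 0 a := ⟨hx.1.trans_le ht.1, ht.2⟩
    have hnt : 0 < n t := hpos t ht0
    have hnta : n t ≤ n a := measureReal_mono (Set.Ioc_subset_Ioc_right ht.2)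
    have e1 : n t = n x + μ.real (Set.Ioc x t) := by
      simp only [hn]
      rw [← Set.Ioc_union_Ioc_eq_Ioc hx.1.le ht.1]
      exact measureReal_union (Set.Ioc_disjoint_Ioc_of_le le_rfl) measurableSet_Ioc
    have e2 : n t * (V t - V x) = ∫ z in Set.Ioc x t, (V z - V x) ∂μ := by
      rw [integral_sub hint.integrableOn (integrable_const _).integrableOn, setIntegral_const,
        mul_sub]
      have h1 := h t ht0
      have h2 := h x hx
      rw [setIntegral_Ioc_split hint hx.1.le ht.1, ← h2] at h1
      simp only [smul_eq_mul]
      change n t * V t = n x * V x + _ at h1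
      rw [h1, e1]; ring
    have e3 : |n t * (V t - V x)| ≤ m * μ.real (Set.Ioc x t) := by
      rw [e2]
      exact norm_setIntegral_le_of_norm_le_const (f := fun z => V z - V x) (measure_lt_top _ _)
        fun z (hz : z ∈ Set.Ioc x t) => hle z ⟨hz.1.le, hz.2.trans ht.2⟩
    rw [abs_mul, abs_of_pos hnt] at e3
    have e4 : |V t - V x| ≤ (1 - n x / n t) * m := by
      have : (1 - n x / n t) * m = m * μ.real (Set.Ioc x t) / n t := by
        rw [show μ.real (Set.Ioc x t) = n t - n x by rw [e1]; ring]
        field_simp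
      rw [this, le_div_iff₀ hnt]; linarith
    refine e4.trans (mul_le_mul_of_nonneg_right ?_ hm0)
    have : n x / n a ≤ n x / n t := div_le_div_of_nonneg_left hnx.le hnt hnta
    linarith
  have hm : m ≤ (1 - n x / n a) * m := by
    refine csSup_le hne ?_
    rintro _ ⟨t, ht, rfl⟩
    exact key t ht
  have hq : 0 < n x / n a := by positivity
  have hm1 : m = 0 := by nlinarith
  have := hle a ⟨hx.2, le_rfl⟩
  rw [hm1] at this
  have := abs_nonpos_iff.1 this
  linarith

/-! ### Construction of the shares by monotone iteration. -/

section Balancing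

variable {μ : Measure ℝ} [IsFiniteMeasure μ] {k : ℝ → ℝ → ℝ} {C a : ℝ}

variable (μ k) in
/-- The part of the kernel `k x y` in excess of its average over the points of `(0, x]`. -/
noncomputable def excess (x y : ℝ) : ℝ := k x y - lowerMass μ k x y / μ.real (Set.Ioc 0 x)

variable (μ k) in
/-- The average of `lowerMass μ k z z` over `z ∈ (0, x]`. -/
noncomputable def average (x : ℝ) : ℝ :=
  (∫ z in Set.Ioc 0 x, lowerMass μ k z z ∂μ) / μ.real (Set.Ioc 0 x)

variable (μ k a) in
/-- The monotone map whose fixed point is the share that the larger of two points concedes. -/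
noncomputable def concedeMap (θ : ℝ → ℝ) (x : ℝ) : ℝ :=
  if x ∈ Set.Ioc 0 a then
    (lowerMass μ k x x - average μ k x + ∫ y in Set.Ioc x a, excess μ k x y * θ y ∂μ) /
      lowerMass μ k x x
  else 0

variable (μ k a) in
/-- The iterates of the map `concedeMap`, started at zero. -/
noncomputable def concedeSeq : ℕ → ℝ → ℝ
  | 0 => fun _ => 0
  | m + 1 => concedeMap μ k a (concedeSeq m)

theorem abs_lowerMass_le (hkC : ∀ x y, |k x y| ≤ C) (x y : ℝ) :
    |lowerMass μ k x y| ≤ C * μ.real Set.univ :=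
  abs_setIntegral_le fun z => hkC z y

theorem measurable_measureReal_Ioc : Measurable (fun x => μ.real (Set.Ioc 0 x)) := by
  have h := measurable_setIntegral_Ioc (μ := μ) (F := fun _ _ => (1 : ℝ)) measurable_const
    (measurable_const (a := (0 : ℝ))) measurable_id
  simpa using h

theorem measurable_excess (hk : Measurable (Function.uncurry k)) :
    Measurable (Function.uncurry (excess μ k)) :=
  hk.sub ((measurable_lowerMass hk).div (measurable_measureReal_Ioc.comp measurable_fst))

theorem measurable_diag (hk : Measurable (Function.uncurry k)) :
    Measurable (fun x => lowerMass μ k x x) :=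
  (measurable_lowerMass hk).comp (measurable_id.prodMk measurable_id)

theorem measurable_average (hk : Measurable (Function.uncurry k)) :
    Measurable (average μ k) := by
  refine Measurable.div ?_ measurable_measureReal_Ioc
  exact measurable_setIntegral_Ioc (F := fun _ z => lowerMass μ k z z)
    ((measurable_diag hk).comp measurable_snd) measurable_const measurable_id

theorem measurable_concedeMap (hk : Measurable (Function.uncurry k)) {θ : ℝ → ℝ}
    (hθ : Measurable θ) : Measurable (concedeMap μ k a θ) := by
  refine Measurable.ite measurableSet_Ioc ?_ measurable_const
  refine Measurable.div ?_ (measurable_diag hk)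
  refine ((measurable_diag hk).sub (measurable_average hk)).add ?_
  exact measurable_setIntegral_Ioc (F := fun x y => excess μ k x y * θ y)
    ((measurable_excess hk).mul (hθ.comp measurable_snd))
    measurable_id measurable_const

theorem measurable_concedeSeq (hk : Measurable (Function.uncurry k)) (m : ℕ) :
    Measurable (concedeSeq μ k a m) := by
  induction m with
  | zero => exact measurable_const
  | succ m ih => exact measurable_concedeMap hk ih

theorem abs_excess_le (hkC : ∀ x y, |k x y| ≤ C) (x y : ℝ) :
    |excess μ k x y| ≤ C + C * μ.real Set.univ / μ.real (Set.Ioc 0 x) := by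
  refine (abs_sub _ _).trans (add_le_add (hkC _ _) ?_)
  rw [abs_div, abs_of_nonneg (measureReal_nonneg (μ := μ) (s := Set.Ioc 0 x))]
  exact div_le_div_of_nonneg_right (abs_lowerMass_le hkC _ _) measureReal_nonneg

theorem integrable_excess_mul (hk : Measurable (Function.uncurry k)) (hkC : ∀ x y, |k x y| ≤ C)
    {θ : ℝ → ℝ} (hθ : Measurable θ) {B : ℝ} (hB : ∀ x, |θ x| ≤ B) (x : ℝ) :
    Integrable (fun y => excess μ k x y * θ y) μ := by
  refine integrable_of_bounded
    (((measurable_excess hk).comp (measurable_const.prodMk measurable_id)).mul hθ)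
    (C := (C + C * μ.real Set.univ / μ.real (Set.Ioc 0 x)) * B) fun y => ?_
  rw [abs_mul]
  exact mul_le_mul (abs_excess_le hkC x y) (hB y) (abs_nonneg _)
    ((abs_nonneg _).trans (abs_excess_le hkC x y))

/-- Moving the first point up towards `y` only increases the kernel, so `k x y` is at least the
average of `k z y` over `z ≤ x`. This positivity makes `concedeMap` monotone. -/
theorem excess_nonneg (hk : Measurable (Function.uncurry k)) (hkC : ∀ x y, |k x y| ≤ C)
    (hmono : ∀ z x y, 0 < z → z ≤ x → x ≤ y → k z y ≤ k x y) {x y : ℝ}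
    (hpos : 0 < μ.real (Set.Ioc 0 x)) (hxy : x ≤ y) : 0 ≤ excess μ k x y := by
  rw [excess, sub_nonneg, div_le_iff₀ hpos, lowerMass]
  have h : ∫ z in Set.Ioc 0 x, k z y ∂μ ≤ ∫ z in Set.Ioc 0 x, k x y ∂μ := by
    refine setIntegral_mono_on ?_ (integrable_const _).integrableOn measurableSet_Ioc
      fun z hz => hmono z x y hz.1 hz.2 hxy
    exact (integrable_of_bounded (hk.comp (measurable_id.prodMk measurable_const))
      fun z => hkC z y).integrableOn
  refine h.trans_eq ?_
  rw [setIntegral_const, smul_eq_mul, mul_comm]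

theorem concedeMap_mono (hk : Measurable (Function.uncurry k)) (hkC : ∀ x y, |k x y| ≤ C)
    (hmono : ∀ z x y, 0 < z → z ≤ x → x ≤ y → k z y ≤ k x y)
    (hpos : ∀ x ∈ Set.Ioc 0 a, 0 < μ.real (Set.Ioc 0 x))
    (hW : ∀ x ∈ Set.Ioc 0 a, 0 < lowerMass μ k x x)
    {θ η : ℝ → ℝ} (hθ : Measurable θ) (hη : Measurable η) {B : ℝ} (hB : ∀ x, |θ x| ≤ B)
    (hB' : ∀ x, |η x| ≤ B) (hle : ∀ x, θ x ≤ η x) (x : ℝ) :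
    concedeMap μ k a θ x ≤ concedeMap μ k a η x := by
  unfold concedeMap
  split_ifs with hx
  · refine div_le_div_of_nonneg_right (add_le_add_right ?_ _) (hW x hx).le
    refine setIntegral_mono_on (integrable_excess_mul hk hkC hθ hB x).integrableOn
      (integrable_excess_mul hk hkC hη hB' x).integrableOn measurableSet_Ioc fun y hy => ?_
    exact mul_le_mul_of_nonneg_left (hle y) (excess_nonneg hk hkC hmono (hpos x hx) hy.1.le)
  · exact le_rfl

theorem integrable_kernel_mul (hk : Measurable (Function.uncurry k)) (hkC : ∀ x y, |k x y| ≤ C)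
    {θ : ℝ → ℝ} (hθ : Measurable θ) {B : ℝ} (hB : ∀ x, |θ x| ≤ B) (x : ℝ) :
    Integrable (fun y => k x y * θ y) μ := by
  refine integrable_of_bounded ((hk.comp (measurable_const.prodMk measurable_id)).mul hθ)
    (C := C * B) fun y => ?_
  rw [abs_mul]
  exact mul_le_mul (hkC x y) (hB y) (abs_nonneg _) ((abs_nonneg _).trans (hkC x y))

theorem integrable_lowerMass_mul (hk : Measurable (Function.uncurry k))
    (hkC : ∀ x y, |k x y| ≤ C)
    {θ : ℝ → ℝ} (hθ : Measurable θ) {B : ℝ} (hB : ∀ x, |θ x| ≤ B) (x : ℝ) :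
    Integrable (fun y => lowerMass μ k x y * θ y) μ := by
  refine integrable_of_bounded
    (((measurable_lowerMass hk).comp (measurable_const.prodMk measurable_id)).mul hθ)
    (C := C * μ.real Set.univ * B) fun y => ?_
  rw [abs_mul]
  exact mul_le_mul (abs_lowerMass_le hkC x y) (hB y) (abs_nonneg _)
    ((abs_nonneg _).trans (abs_lowerMass_le hkC x y))

theorem setIntegral_excess_mul (hk : Measurable (Function.uncurry k)) (hkC : ∀ x y, |k x y| ≤ C)
    {θ : ℝ → ℝ} (hθ : Measurable θ) {B : ℝ} (hB : ∀ x, |θ x| ≤ B) (x : ℝ) :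
    ∫ y in Set.Ioc x a, excess μ k x y * θ y ∂μ =
      ∫ y in Set.Ioc x a, k x y * θ y ∂μ -
        (∫ y in Set.Ioc x a, lowerMass μ k x y * θ y ∂μ) / μ.real (Set.Ioc 0 x) := by
  rw [← integral_div, ← integral_sub (integrable_kernel_mul hk hkC hθ hB x).integrableOn
    ((integrable_lowerMass_mul hk hkC hθ hB x).div_const _).integrableOn]
  congr 1 with y
  simp only [excess]; ring

/-- The constant `1/2` is a supersolution. The claim rearranges to saying that the total mass
matched with `x` inside `(0, a]` is at most its mean over the points of `(0, x]`, which follows from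
`hM`. -/
theorem concedeMap_half_le [NullSingletonClass μ] (hk : Measurable (Function.uncurry k))
    (hkC : ∀ x y, |k x y| ≤ C) (hsymm : ∀ x y, k x y = k y x)
    (hpos : ∀ x ∈ Set.Ioc 0 a, 0 < μ.real (Set.Ioc 0 x))
    (hW : ∀ x ∈ Set.Ioc 0 a, 0 < lowerMass μ k x x)
    (hM : AntitoneOn (fun x => ∫ y in Set.Ioc 0 a, k x y ∂μ) (Set.Ioc 0 a)) (x : ℝ) :
    concedeMap μ k a (fun _ => 1 / 2) x ≤ 1 / 2 := by
  unfold concedeMap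
  split_ifs with hx
  swap
  · norm_num
  have hn := hpos x hx
  have h1 : ∀ y : ℝ, |(fun _ : ℝ => (1 : ℝ)) y| ≤ 1 := by simp
  have hki : ∀ x, Integrable (fun y => k x y) μ := fun x => by
    simpa using integrable_kernel_mul hk hkC measurable_const h1 x
  rw [div_le_iff₀ (hW x hx), integral_mul_const]
  have e := setIntegral_excess_mul (a := a) hk hkC (μ := μ) measurable_const h1 x
  simp only [mul_one] at e
  have sw := triangle_swap hk hkC (μ := μ) measurable_const h1 hx.1.le hx.2
  simp only [mul_one, one_mul] at sw
  have hsplit : ∀ z, 0 < z → z ≤ a → ∫ y in Set.Ioc 0 a, k z y ∂μ =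
      lowerMass μ k z z + ∫ y in Set.Ioc z a, k z y ∂μ := fun z hz hza => by
    rw [setIntegral_Ioc_split (hki z) hz.le hza, lowerMass]
    simp only [hsymm z]
  have hMm : Measurable (fun x => ∫ y in Set.Ioc 0 a, k x y ∂μ) :=
    measurable_setIntegral_Ioc hk measurable_const measurable_const
  have hMi : Integrable (fun x => ∫ y in Set.Ioc 0 a, k x y ∂μ) μ :=
    integrable_of_bounded hMm fun x => abs_setIntegral_le fun y => hkC x y
  have hWi : Integrable (fun x => lowerMass μ k x x) μ :=
    integrable_of_bounded (measurable_diag hk) fun x => abs_lowerMass_le hkC x x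
  have hUi : Integrable (fun z => ∫ y in Set.Ioc z a, k z y ∂μ) μ :=
    integrable_of_bounded (measurable_setIntegral_Ioc hk measurable_id measurable_const)
      fun x => abs_setIntegral_le fun y => hkC x y
  have hav : μ.real (Set.Ioc 0 x) * ∫ y in Set.Ioc 0 a, k x y ∂μ ≤
      ∫ z in Set.Ioc 0 x, ∫ y in Set.Ioc 0 a, k z y ∂μ ∂μ := by
    have : ∫ z in Set.Ioc 0 x, (∫ y in Set.Ioc 0 a, k x y ∂μ) ∂μ ≤
      ∫ z in Set.Ioc 0 x, ∫ y in Set.Ioc 0 a, k z y ∂μ ∂μ :=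
      setIntegral_mono_on (integrable_const _).integrableOn hMi.integrableOn measurableSet_Ioc
        fun z hz => hM ⟨hz.1, hz.2.trans hx.2⟩ hx hz.2
    rwa [setIntegral_const, smul_eq_mul] at this
  have hav2 : ∫ z in Set.Ioc 0 x, ∫ y in Set.Ioc 0 a, k z y ∂μ ∂μ =
      ∫ z in Set.Ioc 0 x, lowerMass μ k z z ∂μ +
        ∫ z in Set.Ioc 0 x, ∫ y in Set.Ioc z a, k z y ∂μ ∂μ := by
    rw [← integral_add hWi.integrableOn hUi.integrableOn]
    exact setIntegral_congr_fun measurableSet_Ioc fun z hz => hsplit z hz.1 (hz.2.trans hx.2)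
  rw [hav2, sw, hsplit x hx.1 hx.2] at hav
  rw [e, average]
  set n := μ.real (Set.Ioc 0 x)
  set F := ∫ z in Set.Ioc 0 x, lowerMass μ k z z ∂μ
  set T := ∫ y in Set.Ioc x a, lowerMass μ k x y ∂μ
  set U := ∫ y in Set.Ioc x a, k x y ∂μ
  set w := lowerMass μ k x x
  have : w + U ≤ (F + (F + T)) / n := by rw [le_div_iff₀ hn]; linarith
  have e5 : (F + (F + T)) / n = 2 * (F / n) + T / n := by ring
  linarith

/-- The iterates from zero increase, since `hK` makes the first step nonnegative, and stay below the
supersolution `1/2`. Their limit is a fixed point. The fixed-point equation is designed so that,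
after `triangle_swap`, the left side of the balance equation equals its own running mean. -/
theorem exists_balancing [NullSingletonClass μ] (hk : Measurable (Function.uncurry k))
    (hkC : ∀ x y, |k x y| ≤ C) (hsymm : ∀ x y, k x y = k y x)
    (hmono : ∀ z x y, 0 < z → z ≤ x → x ≤ y → k z y ≤ k x y)
    (hpos : ∀ x ∈ Set.Ioc 0 a, 0 < μ.real (Set.Ioc 0 x))
    (hW : ∀ x ∈ Set.Ioc 0 a, 0 < lowerMass μ k x x)
    (hK : ∀ x ∈ Set.Ioc 0 a, average μ k x ≤ lowerMass μ k x x)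
    (hM : AntitoneOn (fun x => ∫ y in Set.Ioc 0 a, k x y ∂μ) (Set.Ioc 0 a)) :
    ∃ θ : ℝ → ℝ, Measurable θ ∧ (∀ x, θ x ∈ Set.Icc (0 : ℝ) (1 / 2)) ∧
      ∀ x ∈ Set.Ioc 0 a, (1 - θ x) * lowerMass μ k x x + ∫ y in Set.Ioc x a, k x y * θ y ∂μ =
        average μ k a := by
  set u := concedeSeq μ k a with hu
  have hum : ∀ m, Measurable (u m) := measurable_concedeSeq hk
  have hhalf : ∀ x : ℝ, |(fun _ : ℝ => (1 / 2 : ℝ)) x| ≤ 1 / 2 := by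
    intro x; norm_num [abs_of_nonneg]
  have habs : ∀ {m}, (∀ x, u m x ∈ Set.Icc (0 : ℝ) (1 / 2)) → ∀ x, |u m x| ≤ 1 / 2 :=
    fun {m} h x => by rw [abs_of_nonneg (h x).1]; exact (h x).2
  have hstep0 : ∀ x, 0 ≤ concedeMap μ k a (fun _ => 0) x := by
    intro x
    unfold concedeMap
    split_ifs with hx
    · refine div_nonneg ?_ (hW x hx).le
      simpa using hK x hx
    · exact le_rfl
  have hu01 : ∀ m x, u m x ∈ Set.Icc (0 : ℝ) (1 / 2) := by
    intro m
    induction m with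
    | zero => intro x; simp [hu, concedeSeq]
    | succ m ih =>
      intro x
      constructor
      · refine (hstep0 x).trans (concedeMap_mono hk hkC hmono hpos hW measurable_const (hum m)
          (B := 1 / 2) (by simp) (habs ih) (fun y => (ih y).1) x)
      · exact (concedeMap_mono hk hkC hmono hpos hW (hum m) measurable_const
          (habs ih) hhalf (fun y => (ih y).2) x).trans
          (concedeMap_half_le hk hkC hsymm hpos hW hM x)
  have hmon : ∀ m x, u m x ≤ u (m + 1) x := by
    intro m
    induction m with
    | zero => intro x; exact (hu01 1 x).1
    | succ m ih =>
      exact concedeMap_mono hk hkC hmono hpos hW (hum m) (hum (m + 1)) (habs (hu01 m))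
        (habs (hu01 (m + 1))) ih
  set θ : ℝ → ℝ := fun x => ⨆ m, u m x with hθ
  have hlim : ∀ x, Filter.Tendsto (fun m => u m x) Filter.atTop (nhds (θ x)) := fun x =>
    tendsto_atTop_ciSup (monotone_nat_of_le_succ fun m => hmon m x)
      ⟨1 / 2, by rintro _ ⟨m, rfl⟩; exact (hu01 m x).2⟩
  have hθm : Measurable θ := measurable_of_tendsto_metrizable hum (tendsto_pi_nhds.2 hlim)
  have hθ01 : ∀ x, θ x ∈ Set.Icc (0 : ℝ) (1 / 2) := fun x =>
    isClosed_Icc.mem_of_tendsto (hlim x) (Filter.Eventually.of_forall fun m => hu01 m x)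
  have hθB : ∀ x, |θ x| ≤ 1 / 2 := fun x => by
    rw [abs_of_nonneg (hθ01 x).1]; exact (hθ01 x).2
  -- Dominated convergence passes `concedeMap` to the limit; for fixed `x` the excess kernel is
  -- bounded.
  have hfix : ∀ x, θ x = concedeMap μ k a θ x := by
    intro x
    refine tendsto_nhds_unique ((hlim x).comp (Filter.tendsto_add_atTop_nat 1)) ?_
    change Filter.Tendsto (fun m => concedeMap μ k a (u m) x) _ _
    unfold concedeMap
    split_ifs with hx
    · refine Filter.Tendsto.div_const (Filter.Tendsto.const_add _ ?_) _
      refine tendsto_integral_of_dominated_convergence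
        (fun _ => (C + C * μ.real Set.univ / μ.real (Set.Ioc 0 x)) * (1 / 2))
        (fun m => (integrable_excess_mul hk hkC (hum m)
          (habs (hu01 m)) x).aestronglyMeasurable.restrict)
        (integrable_const _).integrableOn (fun m => Filter.Eventually.of_forall fun y => ?_)
        (Filter.Eventually.of_forall fun y => (hlim y).const_mul _)
      rw [Real.norm_eq_abs, abs_mul]
      exact mul_le_mul (abs_excess_le hkC x y) (habs (hu01 m) y) (abs_nonneg _)
        ((abs_nonneg _).trans (abs_excess_le hkC x y))
    · exact tendsto_const_nhds
  refine ⟨θ, hθm, hθ01, ?_⟩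
  set V : ℝ → ℝ := fun x =>
    (1 - θ x) * lowerMass μ k x x + ∫ y in Set.Ioc x a, k x y * θ y ∂μ with hV
  have hUm : Measurable (fun x => ∫ y in Set.Ioc x a, k x y * θ y ∂μ) :=
    measurable_setIntegral_Ioc (F := fun x y => k x y * θ y) (hk.mul (hθm.comp measurable_snd))
      measurable_id measurable_const
  have hC : 0 ≤ C := (abs_nonneg _).trans (hkC 0 0)
  have hUB : ∀ x, |∫ y in Set.Ioc x a, k x y * θ y ∂μ| ≤ C * (1 / 2) * μ.real Set.univ :=
    fun x => abs_setIntegral_le fun y => by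
      rw [abs_mul]; exact mul_le_mul (hkC x y) (hθB y) (abs_nonneg _) hC
  have hWm : Measurable (fun x => (1 - θ x) * lowerMass μ k x x) :=
    (measurable_const.sub hθm).mul (measurable_diag hk)
  have hWB : ∀ x, |(1 - θ x) * lowerMass μ k x x| ≤ 1 * (C * μ.real Set.univ) := fun x => by
    rw [abs_mul]
    refine mul_le_mul ?_ (abs_lowerMass_le hkC x x) (abs_nonneg _) zero_le_one
    rw [abs_le]; constructor <;> linarith [(hθ01 x).1, (hθ01 x).2]
  -- The fixed-point equation, solved for the payoff `V x`.
  have hVn : ∀ x ∈ Set.Ioc 0 a, V x = average μ k x +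
      (∫ y in Set.Ioc x a, lowerMass μ k x y * θ y ∂μ) / μ.real (Set.Ioc 0 x) := by
    intro x hx
    have h := hfix x
    rw [concedeMap, if_pos hx, eq_div_iff (hW x hx).ne',
      setIntegral_excess_mul hk hkC hθm hθB] at h
    simp only [hV]
    linarith
  -- In the integral of `V` over `(0, x]`, the conceded terms `θ z * lowerMass μ k z z` cancel
  -- against the lower half of the swapped triangle. What remains is `n x` times the expression in
  -- `hVn`.
  have hVeq : ∀ x ∈ Set.Ioc 0 a,
      μ.real (Set.Ioc 0 x) * V x = ∫ z in Set.Ioc 0 x, V z ∂μ := by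
    intro x hx
    have hn := hpos x hx
    have sw := triangle_swap hk hkC (μ := μ) hθm hθB hx.1.le hx.2
    have hWi : Integrable (fun x => lowerMass μ k x x) μ :=
      integrable_of_bounded (measurable_diag hk) fun x => abs_lowerMass_le hkC x x
    have hθWi : Integrable (fun x => θ x * lowerMass μ k x x) μ := by
      have : Integrable (fun x => lowerMass μ k x x - (1 - θ x) * lowerMass μ k x x) μ :=
        hWi.sub (integrable_of_bounded hWm hWB)
      refine this.congr (Filter.Eventually.of_forall fun y => ?_)
      simp only; ring
    simp only [hV]
    rw [integral_add (integrable_of_bounded hWm hWB).integrableOn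
      (integrable_of_bounded hUm hUB).integrableOn, sw]
    have e1 : ∫ z in Set.Ioc 0 x, (1 - θ z) * lowerMass μ k z z ∂μ =
        ∫ z in Set.Ioc 0 x, lowerMass μ k z z ∂μ -
          ∫ z in Set.Ioc 0 x, θ z * lowerMass μ k z z ∂μ := by
      rw [← integral_sub hWi.integrableOn hθWi.integrableOn]
      congr 1 with z; ring
    have e2 := hVn x hx
    simp only [hV, average] at e2
    rw [e2, e1]
    simp only [mul_comm (θ _)]
    field_simp
    ring
  intro x hx
  have hxa : a ∈ Set.Ioc 0 a := ⟨hx.1.trans_le hx.2, le_rfl⟩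
  have hc := eq_of_mul_measure_eq_setIntegral (hWm.add hUm)
    (fun x => (abs_add_le _ _).trans (add_le_add (hWB x) (hUB x))) hpos hVeq hx
  change V x = V a at hc
  change V x = _
  -- At `a` nothing lies above, so the tail integral vanishes and the constant is the average.
  rw [hc, hVn a hxa]
  simp

end Balancing

/-! ### The maximizer of the running mean of a unimodal function. -/

section Threshold

variable {μ : Measure ℝ} [IsFiniteMeasure μ] [NullSingletonClass μ] {W : ℝ → ℝ}

theorem setIntegral_Ioc_lt (hW : Continuous W) {x y c : ℝ} (hpos : 0 < μ.real (Set.Ioc x y))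
    (h : ∀ t ∈ Set.Ioo x y, W t < c) : ∫ t in Set.Ioc x y, W t ∂μ < c * μ.real (Set.Ioc x y) := by
  have hi : IntegrableOn (fun t => c - W t) (Set.Ioo x y) μ :=
    (((continuous_const.sub hW).integrableOn_Icc (μ := μ) (a := x) (b := y))).mono_set
      Set.Ioo_subset_Icc_self
  have hWi : IntegrableOn W (Set.Ioc x y) μ :=
    (hW.integrableOn_Icc (μ := μ) (a := x) (b := y)).mono_set Set.Ioc_subset_Icc_self
  have hp : 0 < ∫ t in Set.Ioo x y, (c - W t) ∂μ := by
    rw [setIntegral_pos_iff_support_of_nonneg_ae _ hi]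
    · have hsub : Set.Ioo x y ⊆ Function.support (fun t => c - W t) ∩ Set.Ioo x y := fun t ht =>
        ⟨(sub_pos.2 (h t ht)).ne', ht⟩
      refine lt_of_lt_of_le ?_ (measure_mono hsub)
      rw [measure_congr Ioo_ae_eq_Ioc]
      exact (ENNReal.toReal_pos_iff.1 hpos).1
    · exact (ae_restrict_iff' measurableSet_Ioo).2
        (Filter.Eventually.of_forall fun t ht => (sub_pos.2 (h t ht)).le)
  rw [← integral_Ioc_eq_integral_Ioo, integral_sub (integrable_const _) hWi, setIntegral_const,
    smul_eq_mul] at hp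
  linarith

theorem lt_setIntegral_Ioc (hW : Continuous W) {x y c : ℝ} (hpos : 0 < μ.real (Set.Ioc x y))
    (h : ∀ t ∈ Set.Ioo x y, c < W t) : c * μ.real (Set.Ioc x y) < ∫ t in Set.Ioc x y, W t ∂μ := by
  have := setIntegral_Ioc_lt hW.neg hpos (c := -c) fun t ht => neg_lt_neg (h t ht)
  simp only [Pi.neg_apply, integral_neg] at this
  linarith

/-- The running mean rises exactly while `W` exceeds it. Up to the peak this holds because `W` is
increasing; after the peak the comparison quantity `K` strictly decreases, so it changes sign at
most once. The maximizer is that zero of `K`, or `1` if there is no sign change. -/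
theorem exists_threshold (hW : Continuous W) {p : ℝ} (hp : p ∈ Set.Ioc (0 : ℝ) 1)
    (hmono : StrictMonoOn W (Set.Icc 0 p)) (hanti : StrictAntiOn W (Set.Icc p 1))
    (hpos : ∀ x y, 0 ≤ x → x < y → y ≤ 1 → 0 < μ.real (Set.Ioc x y)) :
    ∃ b ∈ Set.Ioc (0 : ℝ) 1,
      (∀ x ∈ Set.Ioc 0 b, (∫ z in Set.Ioc 0 x, W z ∂μ) / μ.real (Set.Ioc 0 x) ≤ W x) ∧
      (∀ x ∈ Set.Ioc b 1, W x ≤ (∫ z in Set.Ioc 0 b, W z ∂μ) / μ.real (Set.Ioc 0 b)) ∧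
      ∀ x ∈ Set.Ioc (0 : ℝ) 1, x ≠ b →
        (∫ z in Set.Ioc 0 x, W z ∂μ) / μ.real (Set.Ioc 0 x) <
          (∫ z in Set.Ioc 0 b, W z ∂μ) / μ.real (Set.Ioc 0 b) := by
  set n : ℝ → ℝ := fun x => μ.real (Set.Ioc 0 x) with hn
  set f : ℝ → ℝ := fun x => ∫ z in Set.Ioc 0 x, W z ∂μ with hf
  change ∃ b ∈ Set.Ioc (0 : ℝ) 1, (∀ x ∈ Set.Ioc 0 b, f x / n x ≤ W x) ∧
    (∀ x ∈ Set.Ioc b 1, W x ≤ f b / n b) ∧ ∀ x ∈ Set.Ioc (0 : ℝ) 1, x ≠ b → f x / n x < f b / n b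
  have hnpos : ∀ x, 0 < x → x ≤ 1 → 0 < n x := fun x h0 h1 => hpos 0 x le_rfl h0 h1
  have hWi : ∀ x y, IntegrableOn W (Set.Ioc x y) μ := fun x y =>
    (hW.integrableOn_Icc (μ := μ) (a := x) (b := y)).mono_set Set.Ioc_subset_Icc_self
  have hnadd : ∀ x y, 0 ≤ x → x ≤ y → n y = n x + μ.real (Set.Ioc x y) := fun x y hx hxy => by
    simp only [hn]
    rw [← Set.Ioc_union_Ioc_eq_Ioc hx hxy]
    exact measureReal_union (Set.Ioc_disjoint_Ioc_of_le le_rfl) measurableSet_Ioc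
  have hfadd : ∀ x y, 0 ≤ x → x ≤ y → f y = f x + ∫ z in Set.Ioc x y, W z ∂μ :=
    fun x y hx hxy => by
      simp only [hf]
      rw [← Set.Ioc_union_Ioc_eq_Ioc hx hxy]
      exact setIntegral_union (Set.Ioc_disjoint_Ioc_of_le le_rfl) measurableSet_Ioc
        (hWi _ _) (hWi _ _)
  -- `K x` is `n x` times the gap between `W x` and its running mean.
  set K : ℝ → ℝ := fun x => n x * W x - f x with hK
  have hKpos : ∀ x, 0 < x → x ≤ p → 0 < K x := fun x h0 hx => by
    have h1 := hnpos x h0 (hx.trans hp.2)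
    have := setIntegral_Ioc_lt hW h1 (c := W x)
      fun t ht => hmono ⟨ht.1.le, ht.2.le.trans hx⟩ ⟨h0.le, hx⟩ ht.2
    simp only [hK, hf]; change _ < W x * n x at this; linarith
  have hKanti : ∀ x y, p ≤ x → x < y → y ≤ 1 → K y < K x := fun x y hx hxy hy => by
    have hx0 : 0 < x := hp.1.trans_le hx
    have hd := hpos x y hx0.le hxy hy
    have h1 := lt_setIntegral_Ioc hW hd (c := W y)
      fun t ht => hanti ⟨hx.trans ht.1.le, ht.2.le.trans hy⟩ ⟨hx.trans hxy.le, hy⟩ ht.2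
    have h2 := hanti ⟨hx, hxy.le.trans hy⟩ ⟨hx.trans hxy.le, hy⟩ hxy
    have h3 := hnpos x hx0 (hxy.le.trans hy)
    simp only [hK]
    rw [hnadd x y hx0.le hxy.le, hfadd x y hx0.le hxy.le]
    nlinarith
  obtain ⟨b, hpb, hb1, hKb, hKb0⟩ : ∃ b, p ≤ b ∧ b ≤ 1 ∧ 0 ≤ K b ∧ (b < 1 → K b = 0) := by
    by_cases h1 : 0 ≤ K 1
    · exact ⟨1, hp.2, le_rfl, h1, fun h => absurd h (lt_irrefl _)⟩
    have hcn : ContinuousOn n (Set.Icc p 1) := by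
      have h := intervalIntegral.continuous_primitive (μ := μ) (f := fun _ => (1 : ℝ))
        (fun a b => intervalIntegrable_const) 0
      refine h.continuousOn.congr fun x hx => ?_
      change _ = ∫ _ in (0 : ℝ)..x, (1 : ℝ) ∂μ
      rw [intervalIntegral.integral_of_le (hp.1.le.trans hx.1)]
      simp [hn]
    have hcf : ContinuousOn f (Set.Icc p 1) := by
      have h := intervalIntegral.continuous_primitive (μ := μ) (f := W)
        (fun a b => hW.intervalIntegrable a b) 0
      refine h.continuousOn.congr fun x hx => ?_
      change _ = ∫ z in (0 : ℝ)..x, W z ∂μ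
      rw [intervalIntegral.integral_of_le (hp.1.le.trans hx.1)]
    obtain ⟨b, hb, hb0⟩ := intermediate_value_Icc' hp.2
      ((hcn.mul hW.continuousOn).sub hcf : ContinuousOn K (Set.Icc p 1))
      (⟨(not_le.1 h1).le, (hKpos p hp.1 le_rfl).le⟩ : (0 : ℝ) ∈ Set.Icc (K 1) (K p))
    exact ⟨b, hb.1, hb.2, hb0.ge, fun _ => hb0⟩
  have hb0 : 0 < b := hp.1.trans_le hpb
  have hKx : ∀ x ∈ Set.Ioc 0 b, 0 ≤ K x := fun x hx => by
    rcases le_or_gt x p with h | h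
    · exact (hKpos x hx.1 h).le
    · rcases hx.2.eq_or_lt with h' | h'
      · rwa [h']
      · exact hKb.trans (hKanti x b h.le h' hb1).le
  refine ⟨b, ⟨hb0, hb1⟩, fun x hx => ?_, fun x hx => ?_, fun x hx hxb => ?_⟩
  · rw [div_le_iff₀ (hnpos x hx.1 (hx.2.trans hb1))]
    have := hKx x hx
    simp only [hK] at this; linarith
  · have hlt : b < 1 := hx.1.trans_le hx.2
    have h1 := hKb0 hlt
    rw [le_div_iff₀ (hnpos b hb0 hb1)]
    have h2 := hanti ⟨hpb, hb1⟩ ⟨hpb.trans hx.1.le, hx.2⟩ hx.1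
    have h3 := hnpos b hb0 hb1
    simp only [hK] at h1
    nlinarith
  · have hnx := hnpos x hx.1 hx.2
    have hnb := hnpos b hb0 hb1
    rw [div_lt_div_iff₀ hnx hnb]
    rcases lt_or_gt_of_ne hxb with hlt | hlt
    · have hd := hpos x b hx.1.le hlt hb1
      have e1 := hnadd x b hx.1.le hlt.le
      have e2 := hfadd x b hx.1.le hlt.le
      -- Unimodality keeps `W` on `(x, b)` above the smaller of its two end values. If that is `W
      -- b`, then `W b` is at least the mean at `b`; if it is `W x`, then `W x` is at least the mean
      -- at `x`. Either way the piece `(x, b]` raises the mean.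
      rcases le_or_gt (W b) (W x) with hc | hc
      · have h1 := lt_setIntegral_Ioc hW hd (c := W b) fun t ht => by
          rcases le_or_gt t p with h | h
          · exact hc.trans_lt (hmono ⟨hx.1.le, ht.1.le.trans h⟩ ⟨hx.1.le.trans ht.1.le, h⟩ ht.1)
          · exact hanti ⟨h.le, ht.2.le.trans hb1⟩ ⟨hpb, hb1⟩ ht.2
        simp only [hK] at hKb
        have h3 := mul_lt_mul_of_pos_right h1 hnb
        have h4 := mul_nonneg hd.le hKb
        rw [show f x = f b - ∫ t in Set.Ioc x b, W t ∂μ by linarith,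
          show n x = n b - μ.real (Set.Ioc x b) by linarith]
        linarith
      · have h1 := lt_setIntegral_Ioc hW hd (c := W x) fun t ht => by
          rcases le_or_gt t p with h | h
          · exact hmono ⟨hx.1.le, ht.1.le.trans h⟩ ⟨hx.1.le.trans ht.1.le, h⟩ ht.1
          · exact hc.trans (hanti ⟨h.le, ht.2.le.trans hb1⟩ ⟨hpb, hb1⟩ ht.2)
        have h2 := hKx x ⟨hx.1, hlt.le⟩
        simp only [hK] at h2
        have h3 := mul_lt_mul_of_pos_right h1 hnx
        have h4 := mul_nonneg hd.le h2
        rw [e1, e2]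
        linarith
    · have hd := hpos b x hb0.le hlt hx.2
      have e1 := hnadd b x hb0.le hlt.le
      have e2 := hfadd b x hb0.le hlt.le
      have h1 := setIntegral_Ioc_lt hW hd (c := W b) fun t ht =>
        hanti ⟨hpb, hb1⟩ ⟨hpb.trans ht.1.le, ht.2.le.trans hx.2⟩ ht.1
      have h2 := hKb0 (hlt.trans_le hx.2)
      simp only [hK] at h2
      have h3 : f b = n b * W b := by linarith
      have h4 := mul_lt_mul_of_pos_right h1 hnb
      rw [e1, e2, h3]
      linarith

end Threshold

/-- A strictly quasiconcave continuous function on `[0, e]` that is decreasing on `[e, 1]` first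
increases and then decreases. -/
theorem exists_peak {W : ℝ → ℝ} (hW : Continuous W) {e : ℝ} (he : e ∈ Set.Ioo (0 : ℝ) 1)
    (h0 : W 0 < W e)
    (hq : ∀ x y z, 0 ≤ x → x < y → y < z → z ≤ e → min (W x) (W z) < W y)
    (hanti : StrictAntiOn W (Set.Icc e 1)) :
    ∃ p ∈ Set.Ioc (0 : ℝ) 1, StrictMonoOn W (Set.Icc 0 p) ∧ StrictAntiOn W (Set.Icc p 1) := by
  obtain ⟨p, hp, hmax⟩ := isCompact_Icc.exists_isMaxOn (Set.nonempty_Icc.2 he.1.le)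
    (hW.continuousOn (s := Set.Icc 0 e))
  have hle : ∀ x, 0 ≤ x → x ≤ e → W x ≤ W p := fun x h1 h2 => hmax ⟨h1, h2⟩
  -- A second maximizer is impossible: the midpoint would exceed the maximum.
  have hlt : ∀ x, 0 ≤ x → x ≤ e → x ≠ p → W x < W p := fun x h1 h2 hne => by
    rcases lt_or_gt_of_ne hne with h | h
    · have := hq x ((x + p) / 2) p h1 (by linarith) (by linarith) hp.2
      have h3 := hle ((x + p) / 2) (by linarith [hp.1]) (by linarith [hp.2])
      rcases min_lt_iff.1 this with h4 | h4 <;> linarith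
    · have := hq p ((x + p) / 2) x hp.1 (by linarith) (by linarith) h2
      have h3 := hle ((x + p) / 2) (by linarith [hp.1]) (by linarith [hp.2])
      rcases min_lt_iff.1 this with h4 | h4 <;> linarith
  have hp0 : 0 < p := by
    rcases hp.1.eq_or_lt with h | h
    · rw [← h] at hle
      linarith [hle e he.1.le le_rfl]
    · exact h
  refine ⟨p, ⟨hp0, hp.2.trans he.2.le⟩, fun x hx y hy hxy => ?_, ?_⟩
  · rcases hy.2.eq_or_lt with h | h
    · rw [h]; exact hlt x hx.1 (hx.2.trans hp.2) (by linarith)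
    · rcases min_lt_iff.1 (hq x y p hx.1 hxy h hp.2) with h4 | h4
      · exact h4
      · linarith [hle y hy.1 (hy.2.trans hp.2)]
  · have h1 : StrictAntiOn W (Set.Icc p e) := fun x hx y hy hxy => by
      rcases hx.1.eq_or_lt with h | h
      · rw [← h]; exact hlt y (hp.1.trans hy.1) hy.2 (by linarith)
      · rcases min_lt_iff.1 (hq p x y hp.1 h hxy hy.2) with h4 | h4
        · linarith [hle x (hp.1.trans hx.1) hx.2]
        · exact h4
    have h2 := h1.union hanti (c := e) ⟨⟨hp.2, le_rfl⟩, fun x hx => hx.2⟩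
      ⟨⟨le_rfl, he.2.le⟩, fun x hx => hx.1⟩
    rwa [Set.Icc_union_Icc_eq_Icc hp.2 he.2.le] at h2

/-! ### The overlap kernel and convolution by reflection. -/

/-- The length of the intersection of two intervals of radius `ε` whose centres are at
distance `|r|`. -/
noncomputable def tent (ε r : ℝ) : ℝ := max (2 * ε - |r|) 0

/-- The function `tent` symmetrized in one of the two points. -/
noncomputable def kern (ε x y : ℝ) : ℝ := tent ε (x - y) + tent ε (x + y)

theorem tent_nonneg (ε r : ℝ) : 0 ≤ tent ε r := le_max_right _ _

theorem tent_le {ε : ℝ} (hε : 0 ≤ ε) (r : ℝ) : tent ε r ≤ 2 * ε :=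
  max_le (by linarith [abs_nonneg r]) (by linarith)

theorem tent_neg (ε r : ℝ) : tent ε (-r) = tent ε r := by simp [tent]

theorem tent_anti (ε : ℝ) {r s : ℝ} (h : |r| ≤ |s|) : tent ε s ≤ tent ε r :=
  max_le_max (by linarith) le_rfl

@[fun_prop]
theorem continuous_tent (ε : ℝ) : Continuous (tent ε) := by unfold tent; fun_prop

theorem continuous_kern (ε : ℝ) : Continuous (Function.uncurry (kern ε)) := by
  unfold kern; simp only [Function.uncurry_def]; fun_prop

theorem measurable_kern (ε : ℝ) : Measurable (Function.uncurry (kern ε)) :=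
  (continuous_kern ε).measurable

theorem kern_nonneg (ε x y : ℝ) : 0 ≤ kern ε x y := add_nonneg (tent_nonneg _ _) (tent_nonneg _ _)

theorem abs_kern_le {ε : ℝ} (hε : 0 ≤ ε) (x y : ℝ) : |kern ε x y| ≤ 4 * ε := by
  rw [abs_of_nonneg (kern_nonneg _ _ _), kern]
  linarith [tent_le hε (x - y), tent_le hε (x + y)]

theorem kern_comm (ε x y : ℝ) : kern ε x y = kern ε y x := by
  rw [kern, kern, ← tent_neg, neg_sub, add_comm x y]

/-- Going from `z` up to `x` brings the point as much nearer to `y` as it takes it away from `-y`.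
Since `y` is the nearer of the two, its tent is unclipped wherever the other one still has something
to lose. -/
theorem kern_mono (ε z x y : ℝ) (hz : 0 < z) (hzx : z ≤ x) (hxy : x ≤ y) :
    kern ε z y ≤ kern ε x y := by
  unfold kern tent
  rw [abs_of_nonpos (by linarith : z - y ≤ 0), abs_of_nonpos (by linarith : x - y ≤ 0),
    abs_of_nonneg (by linarith : 0 ≤ z + y), abs_of_nonneg (by linarith : 0 ≤ x + y)]
  rcases max_cases (2 * ε - -(z - y)) 0 with h1 | h1 <;>
  rcases max_cases (2 * ε - (z + y)) 0 with h2 | h2 <;>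
  rcases max_cases (2 * ε - -(x - y)) 0 with h3 | h3 <;>
  rcases max_cases (2 * ε - (x + y)) 0 with h4 | h4 <;> linarith

theorem integrable_tent (ε : ℝ) : Integrable (tent ε) := by
  refine (continuous_tent ε).integrable_of_hasCompactSupport
    (HasCompactSupport.intro (isCompact_Icc (a := -(2 * ε)) (b := 2 * ε)) fun r hr => ?_)
  refine max_eq_right ?_
  by_contra! h
  exact hr (abs_le.1 (by linarith))

/-- Reflecting about the midpoint of `x` and `y` compares two convolutions. -/
theorem two_mul_convolution_sub {p v : ℝ → ℝ} (hp : Measurable p) {B : ℝ} (hB : ∀ u, |p u| ≤ B)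
    (heven : ∀ u, p (-u) = p u) (hv : Integrable v) (x y : ℝ) :
    Integrable (fun r => (p (x - r) - p (y - r)) * (v r - v (x + y - r))) ∧
    2 * ((∫ u, p u * v (x - u)) - ∫ u, p u * v (y - u)) =
      ∫ r, (p (x - r) - p (y - r)) * (v r - v (x + y - r)) := by
  have hi : ∀ (c : ℝ) {w : ℝ → ℝ}, Integrable w → Integrable (fun r => p (c - r) * w r) :=
    fun c w hw => hw.bdd_mul (c := B) ((hp.comp (measurable_const.sub measurable_id)).aestronglyMeasurable)
      (Filter.Eventually.of_forall fun r => hB _)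
  have hv' : Integrable (fun r => v (x + y - r)) := hv.comp_sub_left (x + y)
  have e1 : ∀ c, ∫ u, p u * v (c - u) = ∫ r, p (c - r) * v r := fun c => by
    rw [← integral_sub_left_eq_self (fun u => p u * v (c - u)) volume c]
    simp
  have e2 : ∫ r, p (x - r) * v (x + y - r) = ∫ r, p (y - r) * v r := by
    rw [← integral_sub_left_eq_self (fun u => p (x - u) * v (x + y - u)) volume (x + y)]
    congr 1 with r
    rw [← heven (y - r)]
    congr 2 <;> ring
  have e3 : ∫ r, p (y - r) * v (x + y - r) = ∫ r, p (x - r) * v r := by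
    rw [← integral_sub_left_eq_self (fun u => p (y - u) * v (x + y - u)) volume (x + y)]
    congr 1 with r
    rw [← heven (x - r)]
    congr 2 <;> ring
  have hi1 := (hi x hv).sub (hi y hv)
  have hi2 := (hi x hv').sub (hi y hv')
  have e4 : (fun r => (p (x - r) - p (y - r)) * (v r - v (x + y - r))) =
      fun r => (p (x - r) * v r - p (y - r) * v r) -
        (p (x - r) * v (x + y - r) - p (y - r) * v (x + y - r)) := by
    ext r; ring
  rw [e4]
  refine ⟨hi1.sub hi2, ?_⟩
  have e5 := integral_sub hi1 hi2
  simp only [Pi.sub_apply] at e5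
  rw [e5, integral_sub (hi x hv) (hi y hv), integral_sub (hi x hv') (hi y hv'), e2, e3, e1, e1]
  ring

/-- Both factors change sign at the midpoint of `x` and `y`, and in the same direction. -/
theorem sub_mul_sub_nonneg {p v : ℝ → ℝ} (hp : ∀ u w, |u| ≤ |w| → p w ≤ p u) {x y : ℝ}
    (hxy : x ≤ y) (hv : ∀ r, r ≤ x + y - r → v (x + y - r) ≤ v r) (r : ℝ) :
    0 ≤ (p (x - r) - p (y - r)) * (v r - v (x + y - r)) := by
  rcases le_total r (x + y - r) with h | h
  · refine mul_nonneg (sub_nonneg.2 (hp _ _ ?_)) (sub_nonneg.2 (hv r h))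
    rw [← sq_le_sq]; nlinarith
  · refine mul_nonneg_of_nonpos_of_nonpos (sub_nonpos.2 (hp _ _ ?_)) (sub_nonpos.2 ?_)
    · rw [← sq_le_sq]; nlinarith
    · have := hv (x + y - r) (by linarith)
      simpa using this

/-! ### Monotonicity of the matched masses for a symmetric decreasing density. -/

section Density

variable {h : ℝ → ℝ} {ε : ℝ}

/-- The measure with the symmetric density `h |x|`. -/
noncomputable def symMeasure (h : ℝ → ℝ) : Measure ℝ :=
  volume.withDensity (fun x => ENNReal.ofReal (h |x|))

instance (h : ℝ → ℝ) : NullSingletonClass (symMeasure h) := by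
  unfold symMeasure; infer_instance

theorem setIntegral_symMeasure (hh : Antitone h) (h0 : ∀ x, 0 ≤ h x) (F : ℝ → ℝ) {s : Set ℝ}
    (hs : MeasurableSet s) : ∫ x in s, F x ∂symMeasure h = ∫ x in s, h |x| * F x := by
  have hm : Measurable (fun x => ENNReal.ofReal (h |x|)) :=
    (hh.measurable.comp measurable_abs).ennreal_ofReal
  rw [symMeasure, setIntegral_withDensity_eq_setIntegral_toReal_smul hm (by simp) _ hs]
  simp [ENNReal.toReal_ofReal (h0 _)]

theorem abs_density_le (hh : Antitone h) (h0 : ∀ x, 0 ≤ h x) (u : ℝ) : |h (|u|)| ≤ h 0 := by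
  rw [abs_of_nonneg (h0 _)]; exact hh (abs_nonneg u)

/-- Undoing the fold turns the integral into a convolution of the truncated even density with
`tent`, which is the form needed for reflection. -/
theorem setIntegral_kern (hh : Antitone h) (h0 : ∀ x, 0 ≤ h x) (x : ℝ) {b : ℝ} (hb : 0 ≤ b) :
    ∫ y in Set.Ioc 0 b, kern ε x y ∂symMeasure h =
      ∫ u, Set.indicator (Set.Icc (-b) b) (fun u => h |u|) u * tent ε (x - u) := by
  set F : ℝ → ℝ := fun u => h |u| * tent ε (x - u) with hF
  have hFm : Measurable F := (hh.measurable.comp measurable_abs).mul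
    ((continuous_tent ε).measurable.comp (measurable_const.sub measurable_id))
  have hFi : ∀ c d, IntervalIntegrable F volume c d := fun c d => by
    exact (Integrable.bdd_mul ((integrable_tent ε).comp_sub_left x) (c := h 0)
      (hh.measurable.comp measurable_abs).aestronglyMeasurable
      (Filter.Eventually.of_forall fun u => abs_density_le hh h0 u)).intervalIntegrable
  have e1 : ∫ y in Set.Ioc 0 b, kern ε x y ∂symMeasure h = ∫ y in (0 : ℝ)..b, (F y + F (-y)) := by
    rw [setIntegral_symMeasure hh h0 _ measurableSet_Ioc, intervalIntegral.integral_of_le hb]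
    congr 1 with y
    simp only [hF, kern, abs_neg, sub_neg_eq_add]; ring
  have hFi' : IntervalIntegrable (fun y => F (-y)) volume 0 b := by
    have hc := IntervalIntegrable.comp_sub_left (hFi 0 (-b)) 0
    simpa using hc
  have e2 : ∫ y in (0 : ℝ)..b, F (-y) = ∫ y in (-b)..0, F y := by
    rw [intervalIntegral.integral_comp_neg]; simp
  rw [e1, intervalIntegral.integral_add (hFi _ _) hFi', e2, add_comm,
    intervalIntegral.integral_add_adjacent_intervals (hFi _ _) (hFi _ _),
    intervalIntegral.integral_of_le (by linarith), ← integral_Icc_eq_integral_Ioc,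
    ← integral_indicator measurableSet_Icc]
  congr 1 with u
  by_cases hu : u ∈ Set.Icc (-b) b <;> simp [hu, hF]

/-- The truncated density and the tent are both even and decreasing in the modulus, so the
reflection identity makes their convolution decrease away from zero. -/
theorem antitoneOn_setIntegral_kern (hh : Antitone h) (h0 : ∀ x, 0 ≤ h x) {b : ℝ} (hb : 0 ≤ b) :
    AntitoneOn (fun x => ∫ y in Set.Ioc 0 b, kern ε x y ∂symMeasure h) (Set.Ici 0) := by
  intro x hx y hy hxy
  simp only [Set.mem_Ici] at hx hy
  simp only
  rw [setIntegral_kern hh h0 _ hb, setIntegral_kern hh h0 _ hb]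
  set p := Set.indicator (Set.Icc (-b) b) (fun u => h |u|) with hp
  have hpe : ∀ u, p u = if |u| ≤ b then h |u| else 0 := fun u => by
    simp only [hp, Set.indicator, Set.mem_Icc, abs_le]
  have key := (two_mul_convolution_sub (p := p) (v := tent ε) (B := h 0)
    ((hh.measurable.comp measurable_abs).indicator measurableSet_Icc) (fun u => ?_)
    (fun u => by simp [hpe]) (integrable_tent ε) x y).2
  · have : 0 ≤ ∫ r, (p (x - r) - p (y - r)) * (tent ε r - tent ε (x + y - r)) := by
      refine integral_nonneg fun r => sub_mul_sub_nonneg (fun u w huw => ?_) hxy (fun r hr => ?_) r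
      · rw [hpe, hpe]
        split_ifs with h1 h2
        · exact hh huw
        · exact absurd (huw.trans h1) h2
        · exact h0 _
        · exact le_rfl
      · refine tent_anti ε ?_
        rw [← sq_le_sq]; nlinarith
    linarith
  · rw [hpe]
    split_ifs
    · exact abs_density_le hh h0 u
    · simpa using h0 0

/-- Once `ε ≤ x`, the window of radius `2 * ε` around `x` does not reach below `-x`. The lower
cutoff disappears, and a fixed one-sided tent is translated across the density. -/
theorem lowerMass_kern_eq (hh : Antitone h) (h0 : ∀ x, 0 ≤ h x) {x : ℝ} (hε : 0 ≤ ε)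
    (hx : ε ≤ x) : lowerMass (symMeasure h) (kern ε) x x =
      ∫ u, h |u| * Set.indicator (Set.Ici 0) (tent ε) (x - u) := by
  have hx0 : 0 ≤ x := hε.trans hx
  have e : lowerMass (symMeasure h) (kern ε) x x =
      ∫ y in Set.Ioc 0 x, kern ε x y ∂symMeasure h := by
    simp only [lowerMass, kern_comm ε _ x]
  rw [e, setIntegral_kern hh h0 _ hx0]
  congr 1 with u
  by_cases h1 : u ≤ x
  · rw [Set.indicator_of_mem (show x - u ∈ Set.Ici (0 : ℝ) from sub_nonneg.2 h1)]
    by_cases h2 : -x ≤ u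
    · rw [Set.indicator_of_mem (show u ∈ Set.Icc (-x) x from ⟨h2, h1⟩)]
    · have : tent ε (x - u) = 0 := by
        refine max_eq_right ?_
        rw [abs_of_nonneg (by linarith)]; linarith
      rw [this]; simp
  · rw [Set.indicator_of_notMem (show x - u ∉ Set.Ici (0 : ℝ) by simp; linarith),
      Set.indicator_of_notMem (show u ∉ Set.Icc (-x) x from fun hu => h1 hu.2)]
    simp

/-- Reflection again, now with the even density as `p` and the one-sided tent as `v`. The cutoff of
`v` at zero does no harm: the reflected point `x + y - r` of a negative `r` lies beyond `2 * ε`,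
where the tent is zero. -/
theorem strictAntiOn_lowerMass (hh : Antitone h) (h0 : ∀ x, 0 ≤ h x)
    (hs : StrictAntiOn h (Set.Icc 0 1)) (hε : 0 < ε) :
    StrictAntiOn (fun x => lowerMass (symMeasure h) (kern ε) x x) (Set.Icc ε 1) := by
  intro x hx y hy hxy
  simp only
  rw [lowerMass_kern_eq hh h0 hε.le hx.1, lowerMass_kern_eq hh h0 hε.le hy.1]
  set v := Set.indicator (Set.Ici (0 : ℝ)) (tent ε) with hv
  have hve : ∀ r, v r = if 0 ≤ r then tent ε r else 0 := fun r => by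
    simp only [hv, Set.indicator, Set.mem_Ici]
  have hvi : Integrable v := (integrable_tent ε).indicator measurableSet_Ici
  obtain ⟨hi, key⟩ := two_mul_convolution_sub (p := fun u => h |u|) (v := v)
    (hh.measurable.comp measurable_abs) (abs_density_le hh h0) (fun u => by simp) hvi x y
  have hx0 := hε.trans_le hx.1
  have hnn : ∀ r, 0 ≤ (h |x - r| - h |y - r|) * (v r - v (x + y - r)) := by
    refine sub_mul_sub_nonneg (p := fun u => h |u|) (fun u w huw => hh huw) hxy.le fun r hr => ?_
    rw [hve, hve]
    split_ifs with h1 h2 h2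
    · refine tent_anti ε ?_
      rw [abs_of_nonneg h1, abs_of_nonneg h2]; exact hr
    · refine (max_eq_right ?_).le
      rw [abs_of_nonneg h1]; linarith [hx.1, hy.1]
    · exact tent_nonneg _ _
    · exact le_rfl
  have hpos : 0 < ∫ r, (h |x - r| - h |y - r|) * (v r - v (x + y - r)) := by
    rw [integral_pos_iff_support_of_nonneg hnn hi]
    -- Strictness comes from an interval on which both factors are positive: for `r < x` the density
    -- is compared inside `[0, 1]`, and for `r < 2 * ε` the tent at `r` is unclipped.
    refine lt_of_lt_of_le ?_ (measure_mono
      (show Set.Ioo 0 (min x (2 * ε)) ⊆ _ from fun r hr => ?_))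
    · simp only [Real.volume_Ioo, ENNReal.ofReal_pos, sub_zero]
      exact lt_min hx0 (by linarith)
    · have hrx : r < x := hr.2.trans_le (min_le_left _ _)
      have hrε : r < 2 * ε := hr.2.trans_le (min_le_right _ _)
      have hr0 : 0 < r := hr.1
      refine (mul_pos (sub_pos.2 ?_) (sub_pos.2 ?_)).ne'
      · rw [abs_of_pos (by linarith), abs_of_pos (by linarith)]
        exact hs ⟨by linarith, by linarith [hx.2]⟩ ⟨by linarith, by linarith [hy.2]⟩ (by linarith)
      · rw [hve, hve, if_pos hr0.le, if_pos (by linarith), tent, tent, abs_of_pos hr0,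
          abs_of_pos (by linarith), max_eq_left (by linarith : 0 ≤ 2 * ε - r)]
        exact max_lt (by linarith) (by linarith)
  linarith

end Density

/-! ### The shape of `lowerMass` on the diagonal and the resulting threshold. -/

section Share

variable {h : ℝ → ℝ} {ε : ℝ}

theorem measureReal_symMeasure (hh : Antitone h) (h0 : ∀ x, 0 ≤ h x) {x y : ℝ} (hx : 0 ≤ x) :
    (symMeasure h).real (Set.Ioc x y) = ∫ u in Set.Ioc x y, h u := by
  have e := setIntegral_symMeasure hh h0 (fun _ => 1) (measurableSet_Ioc (a := x) (b := y))
  rw [setIntegral_const, smul_eq_mul, mul_one] at e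
  rw [e]
  refine setIntegral_congr_fun measurableSet_Ioc fun u hu => ?_
  simp only [abs_of_pos (hx.trans_lt hu.1), mul_one]

theorem density_pos (h0 : ∀ x, 0 ≤ h x) (hs : StrictAntiOn h (Set.Icc 0 1)) {x : ℝ} (hx : 0 ≤ x)
    (hx1 : x < 1) : 0 < h x :=
  (h0 1).trans_lt (hs ⟨hx, hx1.le⟩ ⟨zero_le_one, le_rfl⟩ hx1)

theorem integrableOn_density (hh : Antitone h) (x y : ℝ) : IntegrableOn h (Set.Ioc x y) :=
  (hh.antitoneOn _).integrableOn_isCompact isCompact_Icc |>.mono_set Set.Ioc_subset_Icc_self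

theorem measureReal_le (hh : Antitone h) (h0 : ∀ x, 0 ≤ h x) {x y : ℝ} (hx : 0 ≤ x)
    (hxy : x ≤ y) : (symMeasure h).real (Set.Ioc x y) ≤ h x * (y - x) := by
  rw [measureReal_symMeasure hh h0 hx]
  have : ∫ u in Set.Ioc x y, h u ≤ ∫ _ in Set.Ioc x y, h x :=
    setIntegral_mono_on (integrableOn_density hh _ _) (by simp)
      measurableSet_Ioc fun u hu => hh hu.1.le
  simpa [hxy, mul_comm] using this

theorem le_measureReal (hh : Antitone h) (h0 : ∀ x, 0 ≤ h x) {x y : ℝ} (hx : 0 ≤ x)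
    (hxy : x ≤ y) : h y * (y - x) ≤ (symMeasure h).real (Set.Ioc x y) := by
  rw [measureReal_symMeasure hh h0 hx]
  have : ∫ _ in Set.Ioc x y, h y ≤ ∫ u in Set.Ioc x y, h u :=
    setIntegral_mono_on (by simp) (integrableOn_density hh _ _)
      measurableSet_Ioc fun u hu => hh hu.2
  simpa [hxy, mul_comm] using this

/-- For `z ≤ x ≤ ε` neither tent is clipped, and their sum `4 * ε - 2 * x` does not depend on `z`.
-/
theorem lowerMass_kern_of_le {x : ℝ} (hxε : x ≤ ε) :
    lowerMass (symMeasure h) (kern ε) x x =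
      (4 * ε - 2 * x) * (symMeasure h).real (Set.Ioc 0 x) := by
  have : ∫ z in Set.Ioc 0 x, kern ε z x ∂symMeasure h =
      ∫ _ in Set.Ioc 0 x, (4 * ε - 2 * x) ∂symMeasure h := by
    refine setIntegral_congr_fun measurableSet_Ioc fun z hz => ?_
    have h1 := hz.1
    have h2 := hz.2
    simp only [kern, tent]
    rw [abs_of_nonpos (by linarith), abs_of_pos (by linarith), max_eq_left (by linarith),
      max_eq_left (by linarith)]
    ring
  rw [lowerMass, this, setIntegral_const, smul_eq_mul, mul_comm]

theorem intervalIntegral_eq_lowerMass {x : ℝ} (hx : 0 ≤ x) :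
    ∫ z in (0 : ℝ)..x, kern ε z x ∂symMeasure h = lowerMass (symMeasure h) (kern ε) x x :=
  intervalIntegral.integral_of_le hx

variable [IsFiniteMeasure (symMeasure h)]

theorem measureReal_Ioc_add {μ : Measure ℝ} [IsFiniteMeasure μ] {x y z : ℝ} (hxy : x ≤ y)
    (hyz : y ≤ z) : μ.real (Set.Ioc x z) = μ.real (Set.Ioc x y) + μ.real (Set.Ioc y z) := by
  rw [← Set.Ioc_union_Ioc_eq_Ioc hxy hyz]
  exact measureReal_union (Set.Ioc_disjoint_Ioc_of_le le_rfl) measurableSet_Ioc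

theorem measureReal_Ioc_pos (hh : Antitone h) (h0 : ∀ x, 0 ≤ h x)
    (hs : StrictAntiOn h (Set.Icc 0 1)) {x y : ℝ} (hx : 0 ≤ x) (hxy : x < y) (hy : y ≤ 1) :
    0 < (symMeasure h).real (Set.Ioc x y) := by
  have h1 := le_measureReal hh h0 hx (by linarith : x ≤ (x + y) / 2)
  have h2 := density_pos h0 hs (by linarith : 0 ≤ (x + y) / 2) (by linarith)
  have h3 : (symMeasure h).real (Set.Ioc x ((x + y) / 2)) ≤ (symMeasure h).real (Set.Ioc x y) :=
    measureReal_mono (Set.Ioc_subset_Ioc_right (by linarith))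
  have : 0 < h ((x + y) / 2) * ((x + y) / 2 - x) := mul_pos h2 (by linarith)
  linarith

/-- The mass `n` is concave, because the density decreases, and strictly increasing, while the
affine factor strictly decreases. A product of two such factors is strictly quasiconcave. -/
theorem lowerMass_kern_min_lt (hh : Antitone h) (h0 : ∀ x, 0 ≤ h x)
    (hs : StrictAntiOn h (Set.Icc 0 1)) {x y z : ℝ} (hx : 0 ≤ x) (hxy : x < y) (hyz : y < z)
    (hz : z ≤ ε) (hε : ε < 1) :
    min (lowerMass (symMeasure h) (kern ε) x x) (lowerMass (symMeasure h) (kern ε) z z) <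
      lowerMass (symMeasure h) (kern ε) y y := by
  rw [lowerMass_kern_of_le (by linarith : x ≤ ε), lowerMass_kern_of_le hz,
    lowerMass_kern_of_le (by linarith : y ≤ ε)]
  set n : ℝ → ℝ := fun x => (symMeasure h).real (Set.Ioc 0 x) with hn
  change min ((4 * ε - 2 * x) * n x) ((4 * ε - 2 * z) * n z) < (4 * ε - 2 * y) * n y
  have e1 : n y = n x + (symMeasure h).real (Set.Ioc x y) := measureReal_Ioc_add hx hxy.le
  have e2 : n z = n y + (symMeasure h).real (Set.Ioc y z) :=
    measureReal_Ioc_add (hx.trans hxy.le) hyz.le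
  have p1 := le_measureReal hh h0 hx hxy.le
  have p2 := measureReal_le hh h0 (hx.trans hxy.le) hyz.le
  have p3 := measureReal_Ioc_pos hh h0 hs hx hxy (by linarith)
  have p4 := measureReal_Ioc_pos hh h0 hs (hx.trans hxy.le) hyz (by linarith)
  set A := z - y
  set B := y - x
  have hA : 0 < A := sub_pos.2 hyz
  have hB : 0 < B := sub_pos.2 hxy
  have hconc : n x * A + n z * B ≤ n y * (A + B) := by
    have q1 := mul_le_mul_of_nonneg_right p1 hA.le
    have q2 := mul_le_mul_of_nonneg_right p2 hB.le
    rw [e2, show n x = n y - (symMeasure h).real (Set.Ioc x y) by linarith]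
    nlinarith
  set m := min ((4 * ε - 2 * x) * n x) ((4 * ε - 2 * z) * n z) with hm
  have m1 : m ≤ (4 * ε - 2 * x) * n x := min_le_left _ _
  have m2 : m ≤ (4 * ε - 2 * z) * n z := min_le_right _ _
  have hL : 0 < 4 * ε - 2 * y := by linarith
  have hAB : 0 < A + B := by linarith
  have hcross : 0 < (n z - n x) * (z - x) := mul_pos (by linarith) (by linarith)
  have hprod : (A + B) * ((4 * ε - 2 * y) * (A + B) * n y) ≥
      (A + B) * ((4 * ε - 2 * y) * (n x * A + n z * B)) := by
    refine mul_le_mul_of_nonneg_left ?_ hAB.le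
    nlinarith [mul_le_mul_of_nonneg_left hconc hL.le]
  -- With `y` the convex combination of `x` and `z` with weights proportional to `A` and `B`, the
  -- product of the interpolated factors exceeds the interpolated product by a cross term. Its
  -- positivity gives the strict inequality.
  have hid : (A + B) * ((4 * ε - 2 * y) * (n x * A + n z * B)) =
      (A + B) * (A * ((4 * ε - 2 * x) * n x) + B * ((4 * ε - 2 * z) * n z)) +
        2 * (A * B * ((n z - n x) * (z - x))) := by
    simp only [A, B]; ring
  have h5 : 0 < A * B * ((n z - n x) * (z - x)) := mul_pos (mul_pos hA hB) hcross
  have h6 : (A + B) * m ≤ A * ((4 * ε - 2 * x) * n x) + B * ((4 * ε - 2 * z) * n z) := by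
    nlinarith [mul_le_mul_of_nonneg_left m1 hA.le, mul_le_mul_of_nonneg_left m2 hB.le]
  have h7 := mul_le_mul_of_nonneg_left h6 hAB.le
  have h8 : ((A + B) * (A + B)) * m < ((A + B) * (A + B)) * ((4 * ε - 2 * y) * n y) := by
    linarith
  exact lt_of_mul_lt_mul_left h8 (by positivity)

theorem lowerMass_kern_pos (hh : Antitone h) (h0 : ∀ x, 0 ≤ h x)
    (hs : StrictAntiOn h (Set.Icc 0 1)) (hε : 0 < ε) {x : ℝ} (hx : 0 < x) (hx1 : x ≤ 1) :
    0 < lowerMass (symMeasure h) (kern ε) x x := by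
  -- Points of `(c, x]` are within `ε` of `x`, so the kernel is at least `ε` there; the maximum
  -- keeps the interval inside `(0, x]`.
  set c := max 0 (x - ε) with hc
  have hcx : c < x := max_lt hx (by linarith)
  have hc0 : 0 ≤ c := le_max_left _ _
  have hk : Integrable (fun z => kern ε z x) (symMeasure h) :=
    integrable_of_bounded ((measurable_kern ε).comp (measurable_id.prodMk measurable_const))
      fun z => abs_kern_le hε.le z x
  have h1 : ∫ _ in Set.Ioc c x, ε ∂symMeasure h ≤ ∫ z in Set.Ioc c x, kern ε z x ∂symMeasure h := by
    refine setIntegral_mono_on (integrable_const _).integrableOn hk.integrableOn measurableSet_Ioc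
      fun z hz => ?_
    have : ε ≤ tent ε (z - x) := by
      refine le_max_of_le_left ?_
      rw [abs_of_nonpos (by linarith [hz.2])]
      linarith [(le_max_right 0 (x - ε)).trans hz.1.le]
    exact this.trans (le_add_of_nonneg_right (tent_nonneg _ _))
  have h2 : ∫ z in Set.Ioc c x, kern ε z x ∂symMeasure h ≤
      ∫ z in Set.Ioc 0 x, kern ε z x ∂symMeasure h :=
    setIntegral_mono_set hk.integrableOn (Filter.Eventually.of_forall fun z => kern_nonneg _ _ _)
      (Set.Ioc_subset_Ioc_left hc0).eventuallyLE
  rw [setIntegral_const, smul_eq_mul] at h1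
  have h3 := mul_pos (measureReal_Ioc_pos hh h0 hs hc0 hcx hx1) hε
  exact h3.trans_le (h1.trans h2)

theorem continuous_lowerMass_kern :
    Continuous (fun x => ∫ z in (0 : ℝ)..x, kern ε z x ∂symMeasure h) := by
  have hc : Continuous (Function.uncurry fun x z => kern ε z x) :=
    (continuous_kern ε).comp continuous_swap
  exact (intervalIntegral.continuous_parametric_primitive_of_continuous (μ := symMeasure h)
    (a₀ := 0) hc).comp (continuous_id.prodMk continuous_id)

/-- The peak is located by quasiconcavity on `[0, ε]` and strict decrease on `[ε, 1]`. The threshold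
lemma then supplies exactly the hypothesis `hK` of `exists_balancing` below `b` and the no-deviation
bound above `b`. -/
theorem exists_share (hh : Antitone h) (h0 : ∀ x, 0 ≤ h x)
    (hs : StrictAntiOn h (Set.Icc 0 1)) (hε : ε ∈ Set.Ioo (0 : ℝ) 1) :
    ∃ b ∈ Set.Ioc (0 : ℝ) 1,
      (∀ x ∈ Set.Ioc (0 : ℝ) 1, x ≠ b →
        average (symMeasure h) (kern ε) x < average (symMeasure h) (kern ε) b) ∧
      (∀ x ∈ Set.Ioc b 1,
        lowerMass (symMeasure h) (kern ε) x x ≤ average (symMeasure h) (kern ε) b) ∧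
      ∃ θ : ℝ → ℝ, Measurable θ ∧ (∀ x, θ x ∈ Set.Icc (0 : ℝ) (1 / 2)) ∧
        ∀ x ∈ Set.Icc 0 b, (1 - θ x) * lowerMass (symMeasure h) (kern ε) x x +
          ∫ y in Set.Ioc x b, kern ε x y * θ y ∂symMeasure h =
            average (symMeasure h) (kern ε) b := by
  set W : ℝ → ℝ := fun x => ∫ z in (0 : ℝ)..x, kern ε z x ∂symMeasure h with hWdef
  have hWc : Continuous W := continuous_lowerMass_kern
  have hWe : ∀ x, 0 ≤ x → W x = lowerMass (symMeasure h) (kern ε) x x :=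
    fun x hx => intervalIntegral_eq_lowerMass hx
  have hW0 : W 0 = 0 := by simp [hWdef]
  have hpos : ∀ x y, 0 ≤ x → x < y → y ≤ 1 → 0 < (symMeasure h).real (Set.Ioc x y) :=
    fun x y hx hxy hy => measureReal_Ioc_pos hh h0 hs hx hxy hy
  obtain ⟨p, hp, hmono, hanti⟩ := exists_peak hWc hε
    (by rw [hW0, hWe _ hε.1.le]; exact lowerMass_kern_pos hh h0 hs hε.1 hε.1 hε.2.le)
    (fun x y z hx hxy hyz hz => by
      rw [hWe x hx, hWe y (by linarith), hWe z (by linarith)]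
      exact lowerMass_kern_min_lt hh h0 hs hx hxy hyz hz hε.2)
    ((strictAntiOn_lowerMass hh h0 hs hε.1).congr fun x hx => (hWe x (hε.1.le.trans hx.1)).symm)
  obtain ⟨b, hb, h1, h2, h3⟩ := exists_threshold hWc hp hmono hanti hpos
  have hav : ∀ x, (∫ z in Set.Ioc 0 x, W z ∂symMeasure h) / (symMeasure h).real (Set.Ioc 0 x) =
      average (symMeasure h) (kern ε) x := fun x => by
    rw [average]
    congr 1
    exact setIntegral_congr_fun measurableSet_Ioc fun z hz => hWe z hz.1.le
  simp only [hav] at h1 h2 h3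
  have hposb : ∀ x ∈ Set.Ioc 0 b, 0 < (symMeasure h).real (Set.Ioc 0 x) :=
    fun x hx => hpos 0 x le_rfl hx.1 (hx.2.trans hb.2)
  obtain ⟨θ, hθm, hθ, hbal⟩ := exists_balancing (μ := symMeasure h) (a := b) (measurable_kern ε)
    (fun x y => abs_kern_le hε.1.le x y) (kern_comm ε) (kern_mono ε) hposb
    (fun x hx => lowerMass_kern_pos hh h0 hs hε.1 hx.1 (hx.2.trans hb.2))
    (fun x hx => by rw [← hWe x hx.1.le]; exact h1 x hx)
    ((antitoneOn_setIntegral_kern hh h0 hb.1.le).mono fun x hx => hx.1.le)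
  refine ⟨b, hb, h3, fun x hx => ?_, θ, hθm, hθ, fun x hx => ?_⟩
  · rw [← hWe x (hb.1.le.trans hx.1.le)]; exact h2 x hx
  rcases hx.1.eq_or_lt with h | h
  swap
  · exact hbal x ⟨h, hx.2⟩
  subst h
  have hθB : ∀ x, |θ x| ≤ 1 := fun x => by
    rw [abs_of_nonneg (hθ x).1]; linarith [(hθ x).2]
  have hki : ∀ x, Integrable (fun y => kern ε x y * θ y) (symMeasure h) := fun x =>
    integrable_kernel_mul (measurable_kern ε) (fun x y => abs_kern_le hε.1.le x y) hθm hθB x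
  -- The balance at `x = 0` is obtained as a limit from the right: the gap between `U x` and the
  -- average is at most `W x`, which tends to zero.
  set U : ℝ → ℝ := fun x => ∫ y in Set.Ioc 0 b, kern ε x y * θ y ∂symMeasure h with hU
  have hUc : Continuous U := by
    refine continuous_of_dominated (bound := fun _ => 4 * ε * 1)
      (fun x => (hki x).aestronglyMeasurable.restrict)
      (fun x => Filter.Eventually.of_forall fun y => ?_) (integrable_const _)
      (Filter.Eventually.of_forall fun y => ?_)
    · rw [Real.norm_eq_abs, abs_mul]
      exact mul_le_mul (abs_kern_le hε.1.le x y) (hθB y) (abs_nonneg _) (by linarith [hε.1])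
    · exact ((continuous_kern ε).comp (continuous_id.prodMk continuous_const)).mul continuous_const
  have hbound : ∀ x ∈ Set.Ioc 0 b, |U x - average (symMeasure h) (kern ε) b| ≤ W x := by
    intro x hx
    have e1 := hbal x hx
    have e2 := setIntegral_Ioc_split (hki x) hx.1.le hx.2
    have e3 : ∫ y in Set.Ioc 0 x, kern ε x y * θ y ∂symMeasure h ≤ W x := by
      rw [hWe x hx.1.le, lowerMass]
      refine setIntegral_mono_on (hki x).integrableOn ?_ measurableSet_Ioc fun y _ => ?_
      · exact (integrable_of_bounded ((measurable_kern ε).comp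
          (measurable_id.prodMk measurable_const))
          fun z => abs_kern_le hε.1.le z x).integrableOn
      · rw [kern_comm ε y x]
        exact mul_le_of_le_one_right (kern_nonneg _ _ _) ((hθ y).2.trans (by norm_num))
    have e4 : 0 ≤ ∫ y in Set.Ioc 0 x, kern ε x y * θ y ∂symMeasure h :=
      integral_nonneg fun y => mul_nonneg (kern_nonneg _ _ _) (hθ y).1
    rw [← hWe x hx.1.le] at e1
    have e5 : 0 ≤ W x := by
      rw [hWe x hx.1.le]; exact integral_nonneg fun y => kern_nonneg _ _ _
    have e6 := mul_nonneg (hθ x).1 e5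
    have e7 := mul_nonneg (sub_nonneg.2 ((hθ x).2.trans (by norm_num : (1 / 2 : ℝ) ≤ 1))) e5
    rw [abs_le]
    constructor <;> simp only [hU] <;> linarith
  have hlim : U 0 = average (symMeasure h) (kern ε) b := by
    have t1 : Filter.Tendsto (fun x => |U x - average (symMeasure h) (kern ε) b|)
        (nhdsWithin 0 (Set.Ioi 0)) (nhds |U 0 - average (symMeasure h) (kern ε) b|) :=
      ((hUc.sub continuous_const).abs.tendsto 0).mono_left nhdsWithin_le_nhds
    have t2 : Filter.Tendsto W (nhdsWithin 0 (Set.Ioi 0)) (nhds 0) := by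
      have := (hWc.tendsto 0).mono_left (nhdsWithin_le_nhds (s := Set.Ioi 0))
      rwa [hW0] at this
    have h4 := le_of_tendsto_of_tendsto t1 t2
      (Filter.mem_of_superset (Ioc_mem_nhdsGT hb.1) fun x hx => hbound x hx)
    linarith [abs_nonpos_iff.1 h4]
  have h5 : lowerMass (symMeasure h) (kern ε) 0 0 = 0 := by simp [lowerMass]
  rw [h5, mul_zero, zero_add]
  exact hlim

end Share
-- Transfer of the prior to the line and folding at zero.
theorem map_coe_withDensity {F : ℝ → ENNReal} (hF : Measurable F)
    (h0 : ∀ x, x ∉ Set.Icc (-1 : ℝ) 1 → F x = 0) :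
    ((Measure.comap Subtype.val (volume : Measure ℝ)).withDensity (fun ω : State => F ω)).map
      Subtype.val = volume.withDensity F := by
  have hm : (Measure.comap (Subtype.val : State → ℝ) volume).map Subtype.val =
      volume.restrict (Set.Icc (-1 : ℝ) 1) := by
    rw [(MeasurableEmbedding.subtype_coe measurableSet_Icc).map_comap, Subtype.range_coe]
  have hind : (Set.Icc (-1 : ℝ) 1).indicator F = F := by
    ext x
    by_cases hx : x ∈ Set.Icc (-1 : ℝ) 1 <;> simp [hx, h0]
  rw [← hind, withDensity_indicator measurableSet_Icc, ← hm]
  ext s hs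
  rw [Measure.map_apply measurable_subtype_coe hs,
    withDensity_apply _ (measurable_subtype_coe hs), withDensity_apply _ hs,
    setLIntegral_map hs hF measurable_subtype_coe]
  refine setLIntegral_congr_fun (measurable_subtype_coe hs) fun ω _ => ?_
  simp only [Set.indicator_of_mem ω.2]

theorem SymmetricStrictlyUnimodal.exists_density {G : Measure State}
    (hG : SymmetricStrictlyUnimodal G) :
    ∃ h : ℝ → ℝ, Antitone h ∧ (∀ x, 0 ≤ h x) ∧ StrictAntiOn h (Set.Icc 0 1) ∧
      G.map Subtype.val = symMeasure h := by
  obtain ⟨g, hg0, hgs, hga, rfl⟩ := hG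
  -- The density is made antitone on the whole line: constant left of zero, where `|x|` never looks,
  -- and zero beyond `1`.
  set h : ℝ → ℝ := fun x => if x ≤ 0 then g 0 else if x ≤ 1 then g x else 0 with hh
  have hp : ∀ x ∈ Set.Icc (0 : ℝ) 1, h x = g x := fun x hx => by
    simp only [hh]
    split_ifs with h1 h2
    · rw [le_antisymm h1 hx.1]
    · rfl
    · exact absurd hx.2 h2
  have h00 : 0 ≤ g 0 := hg0 0 (by norm_num)
  have hanti : Antitone h := by
    intro x y hxy
    simp only [hh]
    split_ifs
    all_goals first
      | linarith
      | exact hga.antitoneOn ⟨by linarith, by linarith⟩ ⟨by linarith, by linarith⟩ (by linarith)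
      | exact hg0 x ⟨by linarith, by linarith⟩
  have hnn : ∀ x, 0 ≤ h x := fun x => by
    simp only [hh]
    split_ifs with h1 h2
    · exact h00
    · exact hg0 x ⟨by linarith, h2⟩
    · exact le_rfl
  refine ⟨h, hanti, hnn, fun x hx y hy hxy => ?_, ?_⟩
  · rw [hp x hx, hp y hy]; exact hga hx hy hxy
  have hF : Measurable (fun x : ℝ => ENNReal.ofReal (h |x|)) :=
    (hanti.measurable.comp measurable_abs).ennreal_ofReal
  rw [symMeasure, ← map_coe_withDensity hF]
  · congr 2
    ext ω
    have h1 : |(ω : ℝ)| ∈ Set.Icc (0 : ℝ) 1 := ⟨abs_nonneg _, abs_le.2 ω.2⟩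
    rw [hp _ h1]
    rcases abs_choice (ω : ℝ) with h2 | h2 <;> rw [h2]
    rw [hgs _ ω.2]
  · intro x hx
    have : 1 < |x| := by
      by_contra! hc
      exact hx (abs_le.1 hc)
    simp only [hh]
    rw [if_neg (by linarith), if_neg (by linarith)]
    simp

section Fold

variable {h : ℝ → ℝ} {ε : ℝ}

theorem integral_symMeasure (hh : Antitone h) (h0 : ∀ x, 0 ≤ h x) (F : ℝ → ℝ) :
    ∫ x, F x ∂symMeasure h = ∫ x, h |x| * F x := by
  simpa using setIntegral_symMeasure hh h0 F MeasurableSet.univ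

theorem integral_symMeasure_fold (hh : Antitone h) (h0 : ∀ x, 0 ≤ h x) {F : ℝ → ℝ}
    (hF : Integrable (fun x => h |x| * F x)) :
    ∫ x, F x ∂symMeasure h = ∫ y in Set.Ioi 0, (F y + F (-y)) ∂symMeasure h := by
  rw [integral_symMeasure hh h0, setIntegral_symMeasure hh h0 _ measurableSet_Ioi,
    ← intervalIntegral.integral_Iic_add_Ioi (b := 0) hF.integrableOn hF.integrableOn]
  have e := integral_comp_neg_Ioi 0 (fun x => h |x| * F x)
  rw [neg_zero] at e
  have hneg : Integrable (fun x => h |-x| * F (-x)) := hF.comp_neg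
  rw [← e, add_comm, ← integral_add hF.integrableOn hneg.integrableOn]
  congr 1 with y
  rw [abs_neg]; ring

theorem integrable_density (hh : Antitone h) (h0 : ∀ x, 0 ≤ h x) {F : ℝ → ℝ}
    (hF : Integrable F (symMeasure h)) : Integrable (fun x => h |x| * F x) := by
  have hm : Measurable (fun x => ENNReal.ofReal (h |x|)) :=
    (hh.measurable.comp measurable_abs).ennreal_ofReal
  have := (integrable_withDensity_iff_integrable_smul' hm (by simp)).1 hF
  simpa [ENNReal.toReal_ofReal (h0 _)] using this

variable [IsFiniteMeasure (symMeasure h)]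

/-- Folding the state at zero symmetrizes the tent, and evenness removes the sign of `m`. This is
why payoffs depend on a message only through its modulus. -/
theorem integral_abs_mul_tent (hh : Antitone h) (h0 : ∀ x, 0 ≤ h x) (hε : 0 ≤ ε) {P : ℝ → ℝ}
    (hP : Measurable P) {B : ℝ} (hB : ∀ x, |P x| ≤ B) (m : ℝ) :
    ∫ z, P |z| * tent ε (m - z) ∂symMeasure h =
      ∫ y in Set.Ioi 0, P y * kern ε |m| y ∂symMeasure h := by
  have hi : Integrable (fun z => P |z| * tent ε (m - z)) (symMeasure h) := by
    refine integrable_of_bounded ((hP.comp measurable_abs).mul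
      ((continuous_tent ε).measurable.comp (measurable_const.sub measurable_id)))
      (C := B * (2 * ε)) fun z => ?_
    rw [abs_mul]
    refine mul_le_mul (hB _) ?_ (abs_nonneg _) ((abs_nonneg _).trans (hB 0))
    rw [abs_of_nonneg (tent_nonneg _ _)]; exact tent_le hε _
  rw [integral_symMeasure_fold hh h0 (integrable_density hh h0 hi)]
  refine setIntegral_congr_fun measurableSet_Ioi fun y hy => ?_
  simp only [abs_neg, abs_of_pos (Set.mem_Ioi.1 hy), sub_neg_eq_add, kern]
  rcases abs_choice m with e | e <;> rw [e]
  · ring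
  · rw [← tent_neg ε (-m - y), ← tent_neg ε (-m + y),
      show -(-m - y) = m + y by ring, show -(-m + y) = m - y by ring]
    ring

end Fold

/-! ### Signals as a density with respect to one common measure. -/

section Noise

variable {ε : ℝ}

/-- Lebesgue measure on an interval that contains all signals. -/
noncomputable def signalMeasure : Measure ℝ := volume.restrict (Set.Icc (-2) 2)

instance : IsFiniteMeasure signalMeasure := by
  unfold signalMeasure; infer_instance

theorem indicator_window_eq {M : Type*} [Zero M] (ω ε s : ℝ) (F : ℝ → M) :
    (if |s - ω| ≤ ε then F s else 0) = (Set.Icc (ω - ε) (ω + ε)).indicator F s := by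
  simp only [Set.indicator, Set.mem_Icc, abs_le]
  congr 1
  exact propext ⟨fun h => ⟨by linarith, by linarith⟩, fun h => ⟨by linarith, by linarith⟩⟩

theorem noise_eq (hε : 0 < ε) :
    noise ε = ENNReal.ofReal (1 / (2 * ε)) • volume.restrict (Set.Icc (-ε) ε) := by
  rw [noise, ProbabilityTheory.cond, Real.volume_Icc, ← ENNReal.ofReal_inv_of_pos (by linarith)]
  congr 2
  rw [one_div]; congr 1; ring

theorem isProbabilityMeasure_noise (hε : 0 < ε) : IsProbabilityMeasure (noise ε) :=
  cond_isProbabilityMeasure_of_finite (by simp [hε]) (by simp)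

theorem integral_window (hε : ε < 1) {ω : ℝ} (hω : ω ∈ Set.Icc (-1 : ℝ) 1) (F : ℝ → ℝ) :
    ∫ s, (if |s - ω| ≤ ε then F s else 0) ∂signalMeasure =
      ∫ s in Set.Icc (ω - ε) (ω + ε), F s := by
  simp only [indicator_window_eq]
  rw [integral_indicator measurableSet_Icc, signalMeasure, Measure.restrict_restrict
    measurableSet_Icc, Set.inter_eq_left.2]
  exact Set.Icc_subset_Icc (by linarith [hω.1]) (by linarith [hω.2])

/-- Translation by the state. Since `ε < 1`, every window lies in `[-2, 2]`, so a single reference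
measure for the signal serves all states. -/
theorem integral_noise (hε : ε ∈ Set.Ioo (0 : ℝ) 1) {ω : ℝ} (hω : ω ∈ Set.Icc (-1 : ℝ) 1)
    (F : ℝ → ℝ) : ∫ e, F (ω + e) ∂noise ε =
      1 / (2 * ε) * ∫ s, (if |s - ω| ≤ ε then F s else 0) ∂signalMeasure := by
  rw [integral_window hε.2 hω, noise_eq hε.1, integral_smul_measure, ENNReal.toReal_ofReal
    (by have := hε.1; positivity), smul_eq_mul]
  congr 1
  rw [← integral_indicator measurableSet_Icc, ← integral_indicator measurableSet_Icc,
    ← integral_add_left_eq_self ((Set.Icc (ω - ε) (ω + ε)).indicator F) ω]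
  congr 1 with e
  simp only [Set.indicator, Set.mem_Icc]
  congr 1
  exact propext ⟨fun h => ⟨by linarith, by linarith⟩, fun h => ⟨by linarith, by linarith⟩⟩

theorem lintegral_noise (hε : ε ∈ Set.Ioo (0 : ℝ) 1) {ω : ℝ} (hω : ω ∈ Set.Icc (-1 : ℝ) 1)
    (F : ℝ → ENNReal) : ∫⁻ e, F (ω + e) ∂noise ε =
      ENNReal.ofReal (1 / (2 * ε)) *
        ∫⁻ s, (if |s - ω| ≤ ε then F s else 0) ∂signalMeasure := by
  simp only [indicator_window_eq]
  rw [noise_eq hε.1, lintegral_smul_measure, smul_eq_mul, lintegral_indicator measurableSet_Icc,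
    signalMeasure, Measure.restrict_restrict measurableSet_Icc, Set.inter_eq_left.2
      (Set.Icc_subset_Icc (by linarith [hω.1, hε.2]) (by linarith [hω.2, hε.2]))]
  congr 1
  rw [← lintegral_indicator measurableSet_Icc, ← lintegral_indicator measurableSet_Icc,
    ← lintegral_add_left_eq_self ((Set.Icc (ω - ε) (ω + ε)).indicator F) ω]
  congr 1 with e
  simp only [Set.indicator, Set.mem_Icc]
  congr 1
  exact propext ⟨fun h => ⟨by linarith, by linarith⟩, fun h => ⟨by linarith, by linarith⟩⟩

theorem integral_two_windows (hε : ε < 1) {m : ℝ} (hm : m ∈ Set.Icc (-1 : ℝ) 1) (m' c : ℝ) :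
    ∫ s, (if |s - m| ≤ ε then if |s - m'| ≤ ε then c else 0 else 0) ∂signalMeasure =
      c * tent ε (m - m') := by
  rw [integral_window hε hm (fun s => if |s - m'| ≤ ε then c else 0)]
  simp only [indicator_window_eq m' ε _ (fun _ => c)]
  rw [integral_indicator measurableSet_Icc, Measure.restrict_restrict measurableSet_Icc,
    Set.Icc_inter_Icc, setIntegral_const, smul_eq_mul, Measure.real, Real.volume_Icc,
    ENNReal.toReal_ofReal', mul_comm, tent]
  congr 2
  simp only [min_def, max_def]
  rcases abs_cases (m - m') with h | h <;> split_ifs <;> linarith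

end Noise
-- The selection rule and the payoffs it induces.
/-- The probability of selecting the speaker whose message has modulus `x` when the other
feasible message has modulus `y`: the larger modulus concedes the share `τ` of the larger one. -/
noncomputable def share (τ : ℝ → ℝ) (x y : ℝ) : ℝ :=
  if x < y then τ y else if y < x then 1 - τ x else 1 / 2

theorem share_add_share (τ : ℝ → ℝ) (x y : ℝ) : share τ x y + share τ y x = 1 := by
  unfold share
  split_ifs <;> linarith

theorem share_mem {τ : ℝ → ℝ} (hτ : ∀ x, τ x ∈ Set.Icc (0 : ℝ) 1) (x y : ℝ) :
    share τ x y ∈ Set.Icc (0 : ℝ) 1 := by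
  unfold share
  split_ifs
  · exact hτ y
  · exact ⟨by linarith [(hτ x).2], by linarith [(hτ x).1]⟩
  · norm_num

theorem measurable_share {τ : ℝ → ℝ} (hτ : Measurable τ) :
    Measurable (Function.uncurry (share τ)) := by
  refine Measurable.ite (measurableSet_lt measurable_fst measurable_snd) (hτ.comp measurable_snd) ?_
  exact Measurable.ite (measurableSet_lt measurable_snd measurable_fst)
    (measurable_const.sub (hτ.comp measurable_fst)) measurable_const

/-- The probability of selecting a speaker who sends `m` when the other sends `m'`: a message at
distance more than `ε` from the signal loses against one that is not. -/
noncomputable def winProb (τ : ℝ → ℝ) (ε m m' s : ℝ) : ℝ :=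
  if |s - m| ≤ ε then (if |s - m'| ≤ ε then share τ |m| |m'| else 1)
  else (if |s - m'| ≤ ε then 0 else 1 / 2)

theorem winProb_add_winProb (τ : ℝ → ℝ) (ε m m' s : ℝ) :
    winProb τ ε m m' s + winProb τ ε m' m s = 1 := by
  have := share_add_share τ |m| |m'|
  unfold winProb
  split_ifs <;> linarith

theorem winProb_mem {τ : ℝ → ℝ} (hτ : ∀ x, τ x ∈ Set.Icc (0 : ℝ) 1) (ε m m' s : ℝ) :
    winProb τ ε m m' s ∈ Set.Icc (0 : ℝ) 1 := by
  unfold winProb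
  split_ifs
  · exact share_mem hτ _ _
  all_goals norm_num

theorem measurable_winProb {τ : ℝ → ℝ} (hτ : Measurable τ) (ε : ℝ) :
    Measurable (fun x : ℝ × ℝ × ℝ => winProb τ ε x.1 x.2.1 x.2.2) := by
  have h1 : MeasurableSet {x : ℝ × ℝ × ℝ | |x.2.2 - x.1| ≤ ε} :=
    measurableSet_le (by fun_prop) measurable_const
  have h2 : MeasurableSet {x : ℝ × ℝ × ℝ | |x.2.2 - x.2.1| ≤ ε} :=
    measurableSet_le (by fun_prop) measurable_const
  have h3 : Measurable (fun x : ℝ × ℝ × ℝ => share τ |x.1| |x.2.1|) :=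
    (measurable_share hτ).comp ((by fun_prop : Measurable fun x : ℝ × ℝ × ℝ => (|x.1|, |x.2.1|)))
  exact Measurable.ite h1 (Measurable.ite h2 h3 measurable_const)
    (Measurable.ite h2 measurable_const measurable_const)

/-- The selection rule with probabilities `winProb`. -/
noncomputable def shareRule {τ : ℝ → ℝ} (hτm : Measurable τ) (hτ : ∀ x, τ x ∈ Set.Icc (0 : ℝ) 1)
    (ε : ℝ) : SelectionRule where
  prob m m' s := winProb τ ε m m' s
  measurable_prob := (measurable_winProb hτm ε).comp
    (by fun_prop : Measurable fun x : Message × Message × ℝ => ((x.1 : ℝ), (x.2.1 : ℝ), x.2.2))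
  prob_mem m m' s := winProb_mem hτ ε m m' s

theorem shareRule_sel {τ : ℝ → ℝ} (hτm : Measurable τ) (hτ : ∀ x, τ x ∈ Set.Icc (0 : ℝ) 1)
    (ε : ℝ) (i : Fin 2) (m m' : Message) (s : ℝ) :
    (shareRule hτm hτ ε).sel i m m' s = winProb τ ε m m' s := by
  have := winProb_add_winProb τ ε m m' s
  unfold SelectionRule.sel shareRule
  split_ifs
  · rfl
  · simp only; linarith

theorem SelectionRule.measurable_sel (φ : SelectionRule) (i : Fin 2) :
    Measurable (fun x : Message × Message × ℝ => φ.sel i x.1 x.2.1 x.2.2) := by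
  unfold SelectionRule.sel
  split_ifs
  · exact φ.measurable_prob
  · exact measurable_const.sub (φ.measurable_prob.comp
      (by fun_prop : Measurable fun x : Message × Message × ℝ => (x.2.1, x.1, x.2.2)))

theorem SelectionRule.sel_mem (φ : SelectionRule) (i : Fin 2) (m m' : Message) (s : ℝ) :
    φ.sel i m m' s ∈ Set.Icc (0 : ℝ) 1 := by
  unfold SelectionRule.sel
  split_ifs
  · exact φ.prob_mem _ _ _
  · have := φ.prob_mem m' m s
    exact ⟨by linarith [this.2], by linarith [this.1]⟩

theorem SelectionRule.abs_sel_le (φ : SelectionRule) (i : Fin 2) (m m' : Message) (s : ℝ) :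
    |φ.sel i m m' s| ≤ 1 := by
  rw [abs_of_nonneg (φ.sel_mem i m m' s).1]; exact (φ.sel_mem i m m' s).2

theorem abs_integral_le_of_prob {α : Type*} [MeasurableSpace α] {μ : Measure α}
    [IsProbabilityMeasure μ] {F : α → ℝ} {C : ℝ} (hF : ∀ x, |F x| ≤ C) : |∫ x, F x ∂μ| ≤ C := by
  simpa using norm_integral_le_of_norm_le_const (μ := μ) (f := F) (Filter.Eventually.of_forall hF)

theorem expertPayoff_eq {ε : ℝ} (hε : 0 < ε) (FQ ν : Measure Message) [IsProbabilityMeasure FQ]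
    [IsProbabilityMeasure ν] (φ : SelectionRule) (i : Fin 2) (ω : State) :
    expertPayoff ε FQ φ i ω ν =
      ∫ m, ∫ m', ∫ e, φ.sel i m m' ((ω : ℝ) + e) ∂noise ε ∂FQ ∂ν := by
  have := isProbabilityMeasure_noise hε
  have hm : Measurable (fun x : Message × Message × ℝ => φ.sel i x.1 x.2.1 ((ω : ℝ) + x.2.2)) :=
    (φ.measurable_sel i).comp (by fun_prop :
      Measurable fun x : Message × Message × ℝ => (x.1, x.2.1, (ω : ℝ) + x.2.2))
  rw [expertPayoff, integral_prod _ (integrable_of_bounded hm fun x => φ.abs_sel_le i _ _ _)]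
  congr 1 with m
  have hm2 : Measurable (fun x : Message × ℝ => φ.sel i m x.1 ((ω : ℝ) + x.2)) :=
    hm.comp measurable_prodMk_left
  exact integral_prod _ (integrable_of_bounded hm2 fun x => φ.abs_sel_le i _ _ _)

theorem compProd_truthful (G : Measure State) [SFinite G] :
    G.compProd truthful = G.map (fun ω => (ω, ω)) :=
  Measure.compProd_deterministic measurable_id

theorem quackPayoff_eq {ε : ℝ} (hε : 0 < ε) (G : Measure State) [IsProbabilityMeasure G]
    (ν : Measure Message) [IsProbabilityMeasure ν] (φ : SelectionRule) (i : Fin 2) :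
    quackPayoff G ε truthful φ i ν =
      ∫ m, ∫ ω, ∫ e, φ.sel i m ω ((ω : ℝ) + e) ∂noise ε ∂G ∂ν := by
  have := isProbabilityMeasure_noise hε
  have hdm : Measurable (fun ω : State => (ω, ω)) := by fun_prop
  have hp : IsProbabilityMeasure (G.map (fun ω : State => (ω, ω))) :=
    Measure.isProbabilityMeasure_map hdm.aemeasurable
  have hm : Measurable (fun x : Message × (State × Message) × ℝ =>
      φ.sel i x.1 x.2.1.2 ((x.2.1.1 : ℝ) + x.2.2)) :=
    (φ.measurable_sel i).comp (by fun_prop : Measurable fun x : Message × (State × Message) × ℝ =>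
      (x.1, x.2.1.2, (x.2.1.1 : ℝ) + x.2.2))
  rw [quackPayoff, compProd_truthful,
    integral_prod _ (integrable_of_bounded hm fun x => φ.abs_sel_le i _ _ _)]
  congr 1 with m
  have hm2 : Measurable (fun x : (State × Message) × ℝ =>
      φ.sel i m x.1.2 ((x.1.1 : ℝ) + x.2)) := hm.comp measurable_prodMk_left
  rw [integral_prod _ (integrable_of_bounded hm2 fun x => φ.abs_sel_le i _ _ _),
    integral_map hdm.aemeasurable]
  exact hm2.stronglyMeasurable.integral_prod_right'.aestronglyMeasurable

section Rule

variable {h : ℝ → ℝ} {ε : ℝ} {G : Measure State}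

theorem integral_coe (hmap : G.map Subtype.val = symMeasure h) (F : ℝ → ℝ) :
    ∫ ω : State, F ω ∂G = ∫ x, F x ∂symMeasure h := by
  rw [← hmap, (MeasurableEmbedding.subtype_coe measurableSet_Icc).integral_map]

theorem integral_share_kern [IsFiniteMeasure (symMeasure h)] (hε : 0 ≤ ε) {τ : ℝ → ℝ}
    (hτm : Measurable τ) (hτ : ∀ x, τ x ∈ Set.Icc (0 : ℝ) 1) {x : ℝ} (hx : 0 ≤ x) :
    ∫ y in Set.Ioi 0, share τ x y * kern ε x y ∂symMeasure h =
      (1 - τ x) * lowerMass (symMeasure h) (kern ε) x x +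
        ∫ y in Set.Ioi x, τ y * kern ε x y ∂symMeasure h := by
  have hi : Integrable (fun y => share τ x y * kern ε x y) (symMeasure h) := by
    refine integrable_of_bounded (((measurable_share hτm).comp measurable_prodMk_left).mul
      ((measurable_kern ε).comp measurable_prodMk_left)) (C := 1 * (4 * ε)) fun y => ?_
    rw [abs_mul]
    refine mul_le_mul ?_ (abs_kern_le hε _ _) (abs_nonneg _) zero_le_one
    rw [abs_of_nonneg (share_mem hτ x y).1]; exact (share_mem hτ x y).2
  rw [← Set.Ioc_union_Ioi_eq_Ioi hx, setIntegral_union (Set.Ioc_disjoint_Ioi le_rfl)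
    measurableSet_Ioi hi.integrableOn hi.integrableOn]
  congr 1
  -- The tie `y = x`, where the share is `1/2`, is a null set and is dropped.
  · rw [lowerMass, ← integral_const_mul, integral_Ioc_eq_integral_Ioo, integral_Ioc_eq_integral_Ioo]
    refine setIntegral_congr_fun measurableSet_Ioo fun y hy => ?_
    simp only [share, if_neg (not_lt.2 hy.2.le), if_pos hy.2, kern_comm ε x y]
  · refine setIntegral_congr_fun measurableSet_Ioi fun y hy => ?_
    simp only [share, if_pos (Set.mem_Ioi.1 hy)]

theorem integral_share_tent [IsFiniteMeasure (symMeasure h)] (hh : Antitone h)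
    (h0 : ∀ x, 0 ≤ h x) (hmap : G.map Subtype.val = symMeasure h) (hε : 0 ≤ ε) {τ : ℝ → ℝ}
    (hτm : Measurable τ) (hτ : ∀ x, τ x ∈ Set.Icc (0 : ℝ) 1) (m : ℝ) :
    ∫ ω : State, share τ |m| |(ω : ℝ)| * tent ε (m - ω) ∂G =
      (1 - τ |m|) * lowerMass (symMeasure h) (kern ε) |m| |m| +
        ∫ y in Set.Ioi |m|, τ y * kern ε |m| y ∂symMeasure h := by
  rw [integral_coe hmap (fun x => share τ |m| |x| * tent ε (m - x)),
    integral_abs_mul_tent (P := share τ |m|) hh h0 hε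
      ((measurable_share hτm).comp measurable_prodMk_left)
      (B := 1) (fun y => ?_), integral_share_kern hε hτm hτ (abs_nonneg m)]
  rw [abs_of_nonneg (share_mem hτ _ y).1]; exact (share_mem hτ _ y).2

/-- A truthful message always fits the signal, so the quack can win only when his own message fits
as well. -/
theorem integral_noise_winProb_quack (hε : ε ∈ Set.Ioo (0 : ℝ) 1) (τ : ℝ → ℝ) (m ω : State) :
    ∫ e, winProb τ ε m ω ((ω : ℝ) + e) ∂noise ε =
      1 / (2 * ε) * (share τ |(m : ℝ)| |(ω : ℝ)| * tent ε (m - ω)) := by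
  rw [integral_noise hε ω.2 (fun s => winProb τ ε m ω s), ← integral_two_windows hε.2 m.2]
  congr 2 with s
  unfold winProb
  split_ifs <;> rfl

/-- The expected gain of an expert in state `ω` who sends `m` against the message `m'`. -/
theorem integral_noise_winProb_expert_le (hε : ε ∈ Set.Ioo (0 : ℝ) 1) {τ : ℝ → ℝ}
    (hτ : ∀ x, τ x ∈ Set.Icc (0 : ℝ) 1) (m m' ω : State) :
    ∫ e, winProb τ ε m m' ((ω : ℝ) + e) ∂noise ε ≤
      1 / (2 * ε) * (2 * ε - tent ε (ω - m') + share τ |(m : ℝ)| |(m' : ℝ)| * tent ε (m - m')) ∧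
    (m = ω → ∫ e, winProb τ ε m m' ((ω : ℝ) + e) ∂noise ε =
      1 / (2 * ε) *
        (2 * ε - tent ε (ω - m') + share τ |(m : ℝ)| |(m' : ℝ)| * tent ε (m - m'))) := by
  rw [integral_noise hε ω.2 (fun s => winProb τ ε m m' s)]
  have hwin : ∀ x : State, MeasurableSet {s : ℝ | |s - x| ≤ ε} := fun x =>
    measurableSet_le (by fun_prop) measurable_const
  have hi : ∀ (x y : State) (c : ℝ), Integrable
      (fun s : ℝ => if |s - x| ≤ ε then if |s - y| ≤ ε then c else 0 else 0) signalMeasure := by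
    intro x y c
    refine integrable_of_bounded (Measurable.ite (hwin x) (Measurable.ite (hwin y)
      measurable_const measurable_const) measurable_const) (C := |c|) fun s => ?_
    split_ifs <;> simp
  -- The majorant, pointwise in the signal: credit one when the signal is possible in state `ω` but
  -- does not fit `m'`, and the share whenever it fits both messages, even if it is impossible in
  -- state `ω`. At `m = ω` nothing is overcounted.
  have e1 : 2 * ε - tent ε (ω - m') + share τ |(m : ℝ)| |(m' : ℝ)| * tent ε (m - m') =
      ∫ s, ((if |s - ω| ≤ ε then if |s - ω| ≤ ε then (1 : ℝ) else 0 else 0) -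
        (if |s - ω| ≤ ε then if |s - m'| ≤ ε then (1 : ℝ) else 0 else 0) +
        (if |s - m| ≤ ε then if |s - m'| ≤ ε then share τ |(m : ℝ)| |(m' : ℝ)| else 0 else 0))
          ∂signalMeasure := by
    have e2 := integral_add ((hi ω ω 1).sub (hi ω m' 1))
      (hi m m' (share τ |(m : ℝ)| |(m' : ℝ)|))
    simp only [Pi.sub_apply] at e2
    rw [e2, integral_sub (hi ω ω 1) (hi ω m' 1), integral_two_windows hε.2 ω.2,
      integral_two_windows hε.2 ω.2, integral_two_windows hε.2 m.2]
    simp [tent, hε.1.le]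
  have hs := share_mem hτ |(m : ℝ)| |(m' : ℝ)|
  rw [e1]
  constructor
  · have hε' := hε.1
    refine mul_le_mul_of_nonneg_left (integral_mono_of_nonneg ?_ ?_ ?_) (by positivity)
    · refine Filter.Eventually.of_forall fun s => ?_
      have := (winProb_mem hτ ε m m' s).1
      simp only [Pi.zero_apply]
      split_ifs <;> simp [this]
    · exact ((hi ω ω 1).sub (hi ω m' 1)).add (hi m m' _)
    · refine Filter.Eventually.of_forall fun s => ?_
      simp only [winProb]
      split_ifs <;> linarith [hs.1, hs.2]
  · rintro rfl
    congr 2 with s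
    simp only [winProb]
    split_ifs <;> simp

end Rule
-- The truncated prior.
/-- The states of modulus at most `a`. -/
def centralStates (a : ℝ) : Set State := {ω | (ω : ℝ) ∈ Set.Icc (-a) a}

theorem measurableSet_centralStates (a : ℝ) : MeasurableSet (centralStates a) :=
  measurable_subtype_coe measurableSet_Icc

section Truncated

variable {h : ℝ → ℝ} {ε : ℝ} {G : Measure State}

theorem measureReal_preimage_coe (hmap : G.map Subtype.val = symMeasure h) {s : Set ℝ}
    (hs : MeasurableSet s) : G.real ((fun ω : State => (ω : ℝ)) ⁻¹' s) = (symMeasure h).real s := by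
  rw [Measure.real, Measure.real, ← hmap, Measure.map_apply measurable_subtype_coe hs]

theorem measureReal_centralStates [IsFiniteMeasure (symMeasure h)] (hh : Antitone h)
    (h0 : ∀ x, 0 ≤ h x) (hmap : G.map Subtype.val = symMeasure h) (a : ℝ) :
    G.real (centralStates a) = 2 * (symMeasure h).real (Set.Ioc 0 a) := by
  rw [centralStates, ← Set.preimage, measureReal_preimage_coe hmap measurableSet_Icc]
  set F : ℝ → ℝ := (Set.Icc (-a) a).indicator (fun _ => (1 : ℝ)) with hF
  have hFi : Integrable F (symMeasure h) := (integrable_const _).indicator measurableSet_Icc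
  have e1 : (symMeasure h).real (Set.Icc (-a) a) = ∫ x, F x ∂symMeasure h := by
    rw [hF, integral_indicator measurableSet_Icc]; simp
  rw [e1, integral_symMeasure_fold hh h0 (integrable_density hh h0 hFi)]
  have e2 : ∫ y in Set.Ioi 0, (F y + F (-y)) ∂symMeasure h =
      ∫ y in Set.Ioi 0, (Set.Iic a).indicator (fun _ => (2 : ℝ)) y ∂symMeasure h := by
    refine setIntegral_congr_fun measurableSet_Ioi fun y hy => ?_
    have hy' : 0 < y := hy
    simp only [hF, Set.indicator, Set.mem_Icc, Set.mem_Iic]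
    by_cases hya : y ≤ a
    · rw [if_pos ⟨by linarith, hya⟩, if_pos ⟨by linarith, by linarith⟩, if_pos hya]; norm_num
    · rw [if_neg fun hc => hya hc.2, if_neg fun hc => hya (by linarith [hc.1]), if_neg hya]
      norm_num
  rw [e2, integral_indicator measurableSet_Iic, Measure.restrict_restrict measurableSet_Iic,
    Set.inter_comm, Set.Ioi_inter_Iic, setIntegral_const, smul_eq_mul, mul_comm]

theorem truncatedPrior_eq (G : Measure State) (a : ℝ) :
    truncatedPrior G a = (G (centralStates a))⁻¹ • G.restrict (centralStates a) := rfl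

theorem integral_truncatedPrior (G : Measure State) (a : ℝ) (F : Message → ℝ) :
    ∫ m, F m ∂truncatedPrior G a =
      (G.real (centralStates a))⁻¹ * ∫ m in centralStates a, F m ∂G := by
  rw [truncatedPrior_eq, integral_smul_measure, smul_eq_mul, ENNReal.toReal_inv]
  rfl

theorem isProbabilityMeasure_truncatedPrior [IsFiniteMeasure G] {a : ℝ}
    (ha : 0 < G.real (centralStates a)) : IsProbabilityMeasure (truncatedPrior G a) :=
  cond_isProbabilityMeasure (ENNReal.toReal_pos_iff.1 ha).1.ne'

end Truncated

/-! ### Best responses of the quack and the expert. -/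

section Optimality

variable {ε b c : ℝ} {τ : ℝ → ℝ} {G : Measure State} [IsProbabilityMeasure G]

variable (ε τ G) in
/-- Up to a constant, the probability that a quack who sends `m` is selected. -/
noncomputable def quackValue (m : ℝ) : ℝ :=
  ∫ ω : State, share τ |m| |(ω : ℝ)| * tent ε (m - ω) ∂G

theorem abs_share_mul_tent_le (hε : 0 ≤ ε) (hτ : ∀ x, τ x ∈ Set.Icc (0 : ℝ) 1) (m x : ℝ) :
    |share τ |m| |x| * tent ε (m - x)| ≤ 1 * (2 * ε) := by
  rw [abs_mul, abs_of_nonneg (share_mem hτ _ _).1, abs_of_nonneg (tent_nonneg _ _)]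
  exact mul_le_mul (share_mem hτ _ _).2 (tent_le hε _) (tent_nonneg _ _) zero_le_one

theorem measurable_share_mul_tent (hτm : Measurable τ) :
    Measurable (fun p : ℝ × ℝ => share τ |p.1| |p.2| * tent ε (p.1 - p.2)) :=
  ((measurable_share hτm).comp (by fun_prop : Measurable fun p : ℝ × ℝ => (|p.1|, |p.2|))).mul
    ((continuous_tent ε).measurable.comp (measurable_fst.sub measurable_snd))

theorem integrable_share_mul_tent {μ : Measure State} [IsFiniteMeasure μ] (hε : 0 ≤ ε)
    (hτm : Measurable τ) (hτ : ∀ x, τ x ∈ Set.Icc (0 : ℝ) 1) (m : ℝ) :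
    Integrable (fun ω : State => share τ |m| |(ω : ℝ)| * tent ε (m - ω)) μ :=
  integrable_of_bounded ((measurable_share_mul_tent hτm).comp
    (by fun_prop : Measurable fun ω : State => (m, (ω : ℝ))))
    fun ω => abs_share_mul_tent_le hε hτ m ω

theorem quackPayoff_shareRule (hε : ε ∈ Set.Ioo (0 : ℝ) 1) (hτm : Measurable τ)
    (hτ : ∀ x, τ x ∈ Set.Icc (0 : ℝ) 1) (i : Fin 2) (ν : Measure Message)
    [IsProbabilityMeasure ν] :
    quackPayoff G ε truthful (shareRule hτm hτ ε) i ν =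
      ∫ m : Message, 1 / (2 * ε) * quackValue ε τ G m ∂ν := by
  rw [quackPayoff_eq hε.1]
  congr 1 with m
  simp only [shareRule_sel, integral_noise_winProb_quack hε]
  rw [integral_const_mul, quackValue]

theorem quackPayoff_shareRule_le (hε : ε ∈ Set.Ioo (0 : ℝ) 1) (hτm : Measurable τ)
    (hτ : ∀ x, τ x ∈ Set.Icc (0 : ℝ) 1) (hb : 0 < G.real (centralStates b))
    (hle : ∀ m : State, quackValue ε τ G m ≤ c)
    (heq : ∀ m ∈ centralStates b, quackValue ε τ G m = c) (i : Fin 2) (ν : Measure Message)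
    [IsProbabilityMeasure ν] :
    quackPayoff G ε truthful (shareRule hτm hτ ε) i ν ≤
      quackPayoff G ε truthful (shareRule hτm hτ ε) i (truncatedPrior G b) := by
  have := isProbabilityMeasure_truncatedPrior hb
  have hε0 : 0 ≤ 1 / (2 * ε) := by have := hε.1; positivity
  rw [quackPayoff_shareRule hε hτm hτ, quackPayoff_shareRule hε hτm hτ]
  have e1 : ∫ m : Message, 1 / (2 * ε) * quackValue ε τ G m ∂truncatedPrior G b =
      1 / (2 * ε) * c := by
    rw [integral_truncatedPrior]
    have : ∫ m in centralStates b, 1 / (2 * ε) * quackValue ε τ G m ∂G =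
        ∫ _ in centralStates b, 1 / (2 * ε) * c ∂G :=
      setIntegral_congr_fun (measurableSet_centralStates b) fun m hm => by
        simp only [heq m hm]
    rw [this, setIntegral_const, smul_eq_mul, inv_mul_cancel_left₀ hb.ne']
  rw [e1]
  have e2 : ∫ m : Message, 1 / (2 * ε) * quackValue ε τ G m ∂ν ≤
      ∫ _ : Message, 1 / (2 * ε) * c ∂ν := by
    refine integral_mono_of_nonneg (Filter.Eventually.of_forall fun m => mul_nonneg hε0
      (integral_nonneg fun ω => mul_nonneg (share_mem hτ _ _).1 (tent_nonneg _ _)))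
      (integrable_const _) (Filter.Eventually.of_forall fun m =>
        mul_le_mul_of_nonneg_left (hle m) hε0)
  simpa using e2

variable (ε b τ G) in
/-- The probability that an expert who sends `m` in state `ω` is selected. -/
noncomputable def expertValue (ω m : State) : ℝ :=
  ∫ m' : Message, ∫ e, winProb τ ε m m' ((ω : ℝ) + e) ∂noise ε ∂truncatedPrior G b

/-- For a state in `[-b, b]`, the majorant splits into a part `A` independent of the message and the
part `T` that a quack would earn from it. The quack's bound `c` is attained at `m = ω`, where the
majorant is exact. -/
theorem expertValue_le (hε : ε ∈ Set.Ioo (0 : ℝ) 1) (hτm : Measurable τ)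
    (hτ : ∀ x, τ x ∈ Set.Icc (0 : ℝ) 1) (hb : 0 < G.real (centralStates b))
    (hτb : ∀ x, b < x → τ x = 0)
    (hle : ∀ m : State, quackValue ε τ G m ≤ c)
    (heq : ∀ m ∈ centralStates b, quackValue ε τ G m = c) (ω m : State) :
    expertValue ε b τ G ω m ≤ expertValue ε b τ G ω ω := by
  have hpr := isProbabilityMeasure_truncatedPrior hb
  have hnp := isProbabilityMeasure_noise hε.1
  have hε0 : 0 ≤ 1 / (2 * ε) := by have := hε.1; positivity
  have habs : ∀ x : ℝ, x ∈ Set.Icc (-b) b ↔ |x| ≤ b := fun x => by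
    rw [Set.mem_Icc, abs_le]
  have hwin1 : ∀ (m m' : State), ∫ e, winProb τ ε m m' ((ω : ℝ) + e) ∂noise ε ≤ 1 :=
    fun m m' => (le_abs_self _).trans (abs_integral_le_of_prob fun e => by
      rw [abs_of_nonneg (winProb_mem hτ ..).1]; exact (winProb_mem hτ ..).2)
  have hwin0 : ∀ (m m' : State), 0 ≤ ∫ e, winProb τ ε m m' ((ω : ℝ) + e) ∂noise ε :=
    fun m m' => integral_nonneg fun e => (winProb_mem hτ ..).1
  by_cases hω : ω ∈ centralStates b
  swap
  -- A state outside `[-b, b]` has larger modulus than any message of the quack and concedes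
  -- nothing, so truth wins with certainty.
  · have hωb : b < |(ω : ℝ)| := not_le.1 fun hc => hω ((habs _).2 hc)
    have e1 : expertValue ε b τ G ω ω = 1 := by
      rw [expertValue, integral_truncatedPrior]
      have : ∫ m' in centralStates b, ∫ e, winProb τ ε ω m' ((ω : ℝ) + e) ∂noise ε ∂G =
          ∫ _ in centralStates b, (1 : ℝ) ∂G := by
        refine setIntegral_congr_fun (measurableSet_centralStates b) fun m' hm' => ?_
        have h1 : |(m' : ℝ)| ≤ b := (habs _).1 hm'
        rw [(integral_noise_winProb_expert_le hε hτ ω m' ω).2 rfl, share,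
          if_neg (not_lt.2 (h1.trans hωb.le)), if_pos (h1.trans_lt hωb), hτb _ hωb]
        have := hε.1
        field_simp
        ring
      rw [this, setIntegral_const, smul_eq_mul, inv_mul_cancel_left₀ hb.ne']
    rw [e1, expertValue]
    have := integral_mono_of_nonneg (μ := truncatedPrior G b)
      (Filter.Eventually.of_forall (hwin0 m)) (integrable_const (1 : ℝ))
      (Filter.Eventually.of_forall (hwin1 m))
    simpa using this
  set A : State → ℝ := fun m' => 1 / (2 * ε) * (2 * ε - tent ε (ω - m')) with hA
  set T : State → State → ℝ := fun m m' =>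
    1 / (2 * ε) * (share τ |(m : ℝ)| |(m' : ℝ)| * tent ε (m - m')) with hT
  have hTi : ∀ m (μ : Measure State) [IsFiniteMeasure μ], Integrable (T m) μ := fun m μ _ =>
    (integrable_share_mul_tent hε.1.le hτm hτ m).const_mul _
  have hAi : ∀ (μ : Measure State) [IsFiniteMeasure μ], Integrable A μ := fun μ _ => by
    refine integrable_of_bounded (measurable_const.mul (measurable_const.sub
      ((continuous_tent ε).measurable.comp (measurable_const.sub measurable_subtype_coe))))
      (C := 1 / (2 * ε) * (2 * ε)) fun m' => ?_
    have h1 := tent_nonneg ε ((ω : ℝ) - m')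
    have h2 := tent_le hε.1.le ((ω : ℝ) - m')
    rw [abs_of_nonneg (mul_nonneg hε0 (by linarith))]
    exact mul_le_mul_of_nonneg_left (by linarith) hε0
  have hTint : ∀ m, ∫ m', T m m' ∂truncatedPrior G b =
      (G.real (centralStates b))⁻¹ * ∫ m' in centralStates b, T m m' ∂G := fun m =>
    integral_truncatedPrior G b _
  have hT0 : ∀ m m', 0 ≤ T m m' := fun m m' =>
    mul_nonneg hε0 (mul_nonneg (share_mem hτ _ _).1 (tent_nonneg _ _))
  have hTq : ∀ m, ∫ m', T m m' ∂G = 1 / (2 * ε) * quackValue ε τ G m := fun m => by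
    rw [integral_const_mul, quackValue]
  have hTle : ∫ m', T m m' ∂truncatedPrior G b ≤ ∫ m', T ω m' ∂truncatedPrior G b := by
    rw [hTint, hTint]
    refine mul_le_mul_of_nonneg_left ?_ (inv_nonneg.2 measureReal_nonneg)
    have h1 : ∫ m' in centralStates b, T m m' ∂G ≤ ∫ m', T m m' ∂G :=
      setIntegral_le_integral (hTi m G) (Filter.Eventually.of_forall (hT0 m))
    -- Restricting to central opponents loses nothing at `ω`: an opponent of modulus above `b`
    -- concedes the share zero.
    have h2 : ∫ m' in centralStates b, T ω m' ∂G = ∫ m', T ω m' ∂G := by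
      refine setIntegral_eq_integral_of_forall_compl_eq_zero fun m' hm' => ?_
      have h3 : b < |(m' : ℝ)| := not_le.1 fun hc => hm' ((habs _).2 hc)
      have h4 : |(ω : ℝ)| ≤ b := (habs _).1 hω
      simp only [hT, share, if_pos (h4.trans_lt h3), hτb _ h3, zero_mul, mul_zero]
    rw [h2, hTq, heq ω hω]
    refine h1.trans ?_
    rw [hTq]
    exact mul_le_mul_of_nonneg_left (hle m) hε0
  have e1 : expertValue ε b τ G ω ω = ∫ m', (A m' + T ω m') ∂truncatedPrior G b := by
    rw [expertValue]
    congr 1 with m'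
    rw [(integral_noise_winProb_expert_le hε hτ ω m' ω).2 rfl, mul_add]
  have e2 : expertValue ε b τ G ω m ≤ ∫ m', (A m' + T m m') ∂truncatedPrior G b := by
    refine integral_mono_of_nonneg (Filter.Eventually.of_forall (hwin0 m))
      ((hAi _).add (hTi m _)) (Filter.Eventually.of_forall fun m' => ?_)
    have := (integral_noise_winProb_expert_le hε hτ m m' ω).1
    rwa [mul_add] at this
  rw [integral_add (hAi _) (hTi m _)] at e2
  rw [e1, integral_add (hAi _) (hTi ω _)]
  linarith

theorem expertPayoff_shareRule_le (hε : ε ∈ Set.Ioo (0 : ℝ) 1) (hτm : Measurable τ)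
    (hτ : ∀ x, τ x ∈ Set.Icc (0 : ℝ) 1) (hb : 0 < G.real (centralStates b))
    (hτb : ∀ x, b < x → τ x = 0)
    (hle : ∀ m : State, quackValue ε τ G m ≤ c)
    (heq : ∀ m ∈ centralStates b, quackValue ε τ G m = c) (i : Fin 2) (ω : State)
    (ν : Measure Message) [IsProbabilityMeasure ν] :
    expertPayoff ε (truncatedPrior G b) (shareRule hτm hτ ε) i ω ν ≤
      expertPayoff ε (truncatedPrior G b) (shareRule hτm hτ ε) i ω (truthful ω) := by
  have hpr := isProbabilityMeasure_truncatedPrior hb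
  have hnp := isProbabilityMeasure_noise hε.1
  have e : ∀ (ν : Measure Message) [IsProbabilityMeasure ν],
      expertPayoff ε (truncatedPrior G b) (shareRule hτm hτ ε) i ω ν =
        ∫ m, expertValue ε b τ G ω m ∂ν := fun ν _ => by
    rw [expertPayoff_eq hε.1]
    simp only [shareRule_sel]
    rfl
  have ht : truthful ω = Measure.dirac ω := Kernel.deterministic_apply measurable_id ω
  rw [ht, e, e, integral_dirac]
  have := integral_mono_of_nonneg (μ := ν)
    (Filter.Eventually.of_forall fun m => integral_nonneg fun m' => integral_nonneg fun e =>
      (winProb_mem hτ ..).1) (integrable_const (expertValue ε b τ G ω ω))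
    (Filter.Eventually.of_forall fun m => expertValue_le hε hτm hτ hb hτb hle heq ω m)
  simpa [expertValue] using this

end Optimality

/-! ### Densities of the observation and the judge's beliefs. -/

section Density

variable {ε a : ℝ} {G : Measure State}

/-- The product of the priors over both messages and the reference law of the signal. -/
noncomputable def referenceMeasure (G : Measure State) : Measure (Message × Message × ℝ) :=
  G.prod (G.prod signalMeasure)

instance [IsFiniteMeasure G] : IsFiniteMeasure (referenceMeasure G) := by
  unfold referenceMeasure; infer_instance

variable (G ε a) in
/-- The normalizing constant of the joint density of messages and signal. -/
noncomputable def densityConst : ℝ := 1 / (2 * ε) * (G.real (centralStates a))⁻¹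

open Classical in
variable (G ε a) in
/-- The density of messages and signal when the expert sends `m` and the quack sends `m'`. -/
noncomputable def obsDensity (m m' : Message) (s : ℝ) : ℝ :=
  if m' ∈ centralStates a ∧ |s - m| ≤ ε then densityConst ε a G else 0

theorem densityConst_nonneg (hε : 0 < ε) : 0 ≤ densityConst ε a G :=
  mul_nonneg (by positivity) (inv_nonneg.2 measureReal_nonneg)

theorem obsDensity_nonneg (hε : 0 < ε) (m m' : Message) (s : ℝ) : 0 ≤ obsDensity ε a G m m' s := by
  unfold obsDensity
  split_ifs
  · exact densityConst_nonneg hε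
  · exact le_rfl

theorem obsDensity_le (hε : 0 < ε) (m m' : Message) (s : ℝ) :
    obsDensity ε a G m m' s ≤ densityConst ε a G := by
  unfold obsDensity
  split_ifs
  · exact le_rfl
  · exact densityConst_nonneg hε

theorem measurable_obsDensity :
    Measurable (fun x : Message × Message × ℝ => obsDensity ε a G x.1 x.2.1 x.2.2) := by
  unfold obsDensity
  have h1 : MeasurableSet {x : Message × Message × ℝ | |x.2.2 - x.1| ≤ ε} :=
    measurableSet_le (by fun_prop) measurable_const
  exact Measurable.ite (((measurable_fst.comp measurable_snd)
    (measurableSet_centralStates a)).inter h1) measurable_const measurable_const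

theorem measurable_obsDensity_swap :
    Measurable (fun x : Message × Message × ℝ => obsDensity ε a G x.2.1 x.1 x.2.2) :=
  measurable_obsDensity.comp
    (by fun_prop : Measurable fun x : Message × Message × ℝ => (x.2.1, x.1, x.2.2))

variable [IsProbabilityMeasure G]

theorem lintegral_truncatedPrior (ha : 0 < G.real (centralStates a)) (F : Message → ENNReal) :
    ∫⁻ m, F m ∂truncatedPrior G a =
      ENNReal.ofReal (G.real (centralStates a))⁻¹ * ∫⁻ m in centralStates a, F m ∂G := by
  rw [truncatedPrior_eq, lintegral_smul_measure, smul_eq_mul, ENNReal.ofReal_inv_of_pos ha,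
    Measure.real, ENNReal.ofReal_toReal (measure_ne_top _ _)]

/-- Under truth-telling the state is the expert's message, of law `G`; the quack's message has a
density with respect to the same `G`. So the observation has a density with respect to
`referenceMeasure`, the same for both labellings up to a swap. -/
theorem lintegral_play (hε : ε ∈ Set.Ioo (0 : ℝ) 1) (ha : 0 < G.real (centralStates a))
    {H : Message → Message → ℝ → ENNReal}
    (hH : Measurable fun x : Message × Message × ℝ => H x.1 x.2.1 x.2.2) :
    ∫⁻ x, H x.1.2 x.2.1 ((x.1.1 : ℝ) + x.2.2) ∂playLaw G ε truthful (truncatedPrior G a) =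
      ∫⁻ x, ENNReal.ofReal (obsDensity ε a G x.1 x.2.1 x.2.2) * H x.1 x.2.1 x.2.2
        ∂referenceMeasure G := by
  have hpr := isProbabilityMeasure_truncatedPrior ha
  have hnp := isProbabilityMeasure_noise hε.1
  have hdm : Measurable (fun ω : State => (ω, ω)) := by fun_prop
  have hp : IsProbabilityMeasure (G.map (fun ω : State => (ω, ω))) :=
    Measure.isProbabilityMeasure_map hdm.aemeasurable
  have hm : Measurable (fun x : (State × Message) × Message × ℝ =>
      H x.1.2 x.2.1 ((x.1.1 : ℝ) + x.2.2)) :=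
    hH.comp (by fun_prop : Measurable fun x : (State × Message) × Message × ℝ =>
      (x.1.2, x.2.1, (x.1.1 : ℝ) + x.2.2))
  have hm3 : Measurable fun x : Message × Message × ℝ =>
      ENNReal.ofReal (obsDensity ε a G x.1 x.2.1 x.2.2) * H x.1 x.2.1 x.2.2 :=
    measurable_obsDensity.ennreal_ofReal.mul hH
  rw [playLaw, compProd_truthful, lintegral_prod _ hm.aemeasurable,
    lintegral_map hm.lintegral_prod_right' hdm, referenceMeasure,
    lintegral_prod _ hm3.aemeasurable]
  congr 1 with ω
  have hm2 : Measurable (fun x : Message × ℝ => H ω x.1 ((ω : ℝ) + x.2)) :=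
    hH.comp (by fun_prop : Measurable fun x : Message × ℝ => (ω, x.1, (ω : ℝ) + x.2))
  have hm4 : Measurable (fun x : Message × ℝ =>
      ENNReal.ofReal (obsDensity ε a G ω x.1 x.2) * H ω x.1 x.2) :=
    hm3.comp measurable_prodMk_left
  simp only
  rw [lintegral_prod _ hm2.aemeasurable, lintegral_prod _ hm4.aemeasurable,
    lintegral_truncatedPrior ha, ← lintegral_indicator (measurableSet_centralStates a),
    ← lintegral_const_mul' _ _ ENNReal.ofReal_ne_top]
  congr 1 with m
  have e : ∫⁻ y, H ω m ((ω : ℝ) + y) ∂noise ε = _ := lintegral_noise hε ω.2 (fun s => H ω m s)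
  by_cases hmS : m ∈ centralStates a
  · rw [Set.indicator_of_mem hmS]
    simp only [e]
    rw [← mul_assoc, ← ENNReal.ofReal_mul
      (inv_nonneg.2 measureReal_nonneg), mul_comm (G.real _)⁻¹,
      ← lintegral_const_mul' _ _ ENNReal.ofReal_ne_top]
    congr 1 with s
    by_cases hs : |s - ω| ≤ ε <;> simp [obsDensity, hmS, hs, densityConst]
  · rw [Set.indicator_of_notMem hmS]
    simp [obsDensity, hmS]

theorem observationLaw_zero (hε : ε ∈ Set.Ioo (0 : ℝ) 1) (ha : 0 < G.real (centralStates a)) :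
    observationLaw G ε truthful (truncatedPrior G a) 0 =
      (referenceMeasure G).withDensity
        (fun x => ENNReal.ofReal (obsDensity ε a G x.1 x.2.1 x.2.2)) := by
  refine Measure.ext_of_lintegral _ fun H hH => ?_
  have hm : Measurable (fun x : (State × Message) × Message × ℝ =>
      if (0 : Fin 2) = 0 then (x.1.2, x.2.1, (x.1.1 : ℝ) + x.2.2)
      else (x.2.1, x.1.2, (x.1.1 : ℝ) + x.2.2)) := by
    simp only [if_true]; fun_prop
  rw [observationLaw, lintegral_map hH hm,
    lintegral_withDensity_eq_lintegral_mul _ measurable_obsDensity.ennreal_ofReal hH]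
  exact lintegral_play hε ha (H := fun m m' s => H (m, m', s)) hH

theorem lintegral_referenceMeasure_swap {H : Message × Message × ℝ → ENNReal} (hH : Measurable H) :
    ∫⁻ x, H (x.2.1, x.1, x.2.2) ∂referenceMeasure G = ∫⁻ x, H x ∂referenceMeasure G := by
  have hH' : Measurable (fun x : Message × Message × ℝ => H (x.2.1, x.1, x.2.2)) :=
    hH.comp (by fun_prop : Measurable fun x : Message × Message × ℝ => (x.2.1, x.1, x.2.2))
  rw [referenceMeasure, lintegral_prod _ hH.aemeasurable, lintegral_prod _ hH'.aemeasurable]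
  have e1 : ∀ m : Message, ∫⁻ y : Message × ℝ, H (m, y) ∂G.prod signalMeasure =
      ∫⁻ m', ∫⁻ s, H (m, m', s) ∂signalMeasure ∂G := fun m =>
    lintegral_prod _ (hH.comp measurable_prodMk_left).aemeasurable
  have e2 : ∀ m : Message, ∫⁻ y : Message × ℝ, H (y.1, m, y.2) ∂G.prod signalMeasure =
      ∫⁻ m', ∫⁻ s, H (m', m, s) ∂signalMeasure ∂G := fun m =>
    lintegral_prod _ (hH'.comp (measurable_prodMk_left (x := m))).aemeasurable
  simp only [e1, e2]
  refine lintegral_lintegral_swap ?_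
  have : Measurable (fun p : (Message × Message) × ℝ => H (p.1.2, p.1.1, p.2)) :=
    hH.comp (by fun_prop : Measurable fun p : (Message × Message) × ℝ => (p.1.2, p.1.1, p.2))
  exact this.lintegral_prod_right'.aemeasurable

theorem observationLaw_one (hε : ε ∈ Set.Ioo (0 : ℝ) 1) (ha : 0 < G.real (centralStates a)) :
    observationLaw G ε truthful (truncatedPrior G a) 1 =
      (referenceMeasure G).withDensity
        (fun x => ENNReal.ofReal (obsDensity ε a G x.2.1 x.1 x.2.2)) := by
  refine Measure.ext_of_lintegral _ fun H hH => ?_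
  have hm : Measurable (fun x : (State × Message) × Message × ℝ =>
      if (1 : Fin 2) = 0 then (x.1.2, x.2.1, (x.1.1 : ℝ) + x.2.2)
      else (x.2.1, x.1.2, (x.1.1 : ℝ) + x.2.2)) := by
    simp only [one_ne_zero, if_false]; fun_prop
  have hH' : Measurable (fun x : Message × Message × ℝ => H (x.2.1, x.1, x.2.2)) :=
    hH.comp (by fun_prop : Measurable fun x : Message × Message × ℝ => (x.2.1, x.1, x.2.2))
  rw [observationLaw, lintegral_map hH hm,
    lintegral_withDensity_eq_lintegral_mul _ measurable_obsDensity_swap.ennreal_ofReal hH]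
  have h1 := lintegral_play (G := G) hε ha (H := fun m m' s => H (m', m, s)) hH'
  have h2 := lintegral_referenceMeasure_swap (G := G)
    (H := fun x => ENNReal.ofReal (obsDensity ε a G x.2.1 x.1 x.2.2) * H x)
    (measurable_obsDensity_swap.ennreal_ofReal.mul hH)
  exact h1.trans h2

open Classical in
variable (ε a) in
/-- The judge's belief that speaker `1` is the expert. -/
noncomputable def belief (x : Message × Message × ℝ) : ℝ :=
  if |x.2.2 - x.1| ≤ ε then
    if |x.2.2 - x.2.1| ≤ ε then
      if x.1 ∈ centralStates a then (if x.2.1 ∈ centralStates a then 1 / 2 else 0)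
      else (if x.2.1 ∈ centralStates a then 1 else 1 / 2)
    else 1
  else (if |x.2.2 - x.2.1| ≤ ε then 0 else 1 / 2)

theorem belief_mem (x : Message × Message × ℝ) : belief ε a x ∈ Set.Icc (0 : ℝ) 1 := by
  unfold belief
  split_ifs <;> norm_num

theorem measurable_belief : Measurable (belief ε a) := by
  have h1 : MeasurableSet {x : Message × Message × ℝ | |x.2.2 - x.1| ≤ ε} :=
    measurableSet_le (by fun_prop) measurable_const
  have h2 : MeasurableSet {x : Message × Message × ℝ | |x.2.2 - x.2.1| ≤ ε} :=
    measurableSet_le (by fun_prop) measurable_const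
  have h3 : MeasurableSet {x : Message × Message × ℝ | x.1 ∈ centralStates a} :=
    measurable_fst (measurableSet_centralStates a)
  have h4 : MeasurableSet {x : Message × Message × ℝ | x.2.1 ∈ centralStates a} :=
    (measurable_fst.comp measurable_snd) (measurableSet_centralStates a)
  exact Measurable.ite h1 (Measurable.ite h2
    (Measurable.ite h3 (Measurable.ite h4 measurable_const measurable_const)
      (Measurable.ite h4 measurable_const measurable_const)) measurable_const)
    (Measurable.ite h2 measurable_const measurable_const)

/-- Bayes' rule becomes the pointwise identity of the belief times the sum of the two densities with
the first density. Where both vanish the belief is free, and is chosen to suit the selection rule.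
-/
theorem bayesConsistent_belief (hε : ε ∈ Set.Ioo (0 : ℝ) 1) (ha : 0 < G.real (centralStates a)) :
    BayesConsistent G ε truthful (truncatedPrior G a) (belief ε a) := by
  refine ⟨measurable_belief, belief_mem, ?_⟩
  have hm0 := (measurable_obsDensity (ε := ε) (a := a) (G := G)).ennreal_ofReal
  have hm1 := (measurable_obsDensity_swap (ε := ε) (a := a) (G := G)).ennreal_ofReal
  rw [observationLaw_zero hε ha, observationLaw_one hε ha, ← withDensity_add_left hm0,
    ← withDensity_mul _ (hm0.add hm1) measurable_belief.ennreal_ofReal]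
  congr 1
  ext x
  simp only [Pi.mul_apply, Pi.add_apply]
  rw [← ENNReal.ofReal_add (obsDensity_nonneg hε.1 _ _ _) (obsDensity_nonneg hε.1 _ _ _),
    ← ENNReal.ofReal_mul (add_nonneg (obsDensity_nonneg hε.1 _ _ _)
      (obsDensity_nonneg hε.1 _ _ _))]
  congr 1
  unfold obsDensity belief
  by_cases h1 : |x.2.2 - x.1| ≤ ε <;> by_cases h2 : |x.2.2 - x.2.1| ≤ ε <;>
    by_cases h3 : x.1 ∈ centralStates a <;> by_cases h4 : x.2.1 ∈ centralStates a <;>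
    simp [h1, h2, h3, h4]
  ring

/-- Between two fitting central messages the belief is `1/2`, so any share is allowed. If exactly
one fitting message is central, the other must win; this is where `τ = 0` beyond `a` is used. -/
theorem shareRule_judge_optimal {τ : ℝ → ℝ} (hτm : Measurable τ)
    (hτ : ∀ x, τ x ∈ Set.Icc (0 : ℝ) 1) (hτb : ∀ x, a < x → τ x = 0) (m₁ m₂ : Message) (s : ℝ) :
    (1 / 2 < belief ε a (m₁, m₂, s) → (shareRule hτm hτ ε).prob m₁ m₂ s = 1) ∧
      (belief ε a (m₁, m₂, s) < 1 / 2 → (shareRule hτm hτ ε).prob m₁ m₂ s = 0) := by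
  have habs : ∀ x : State, x ∈ centralStates a ↔ |(x : ℝ)| ≤ a := fun x => by
    rw [centralStates, Set.mem_ofPred_eq, Set.mem_Icc, abs_le]
  simp only [belief, shareRule, winProb, habs]
  split_ifs with h1 h2 h3 h4 h4
  · norm_num
  · have : |(m₁ : ℝ)| < |(m₂ : ℝ)| := by linarith
    norm_num [share, this, hτb _ (not_le.1 h4)]
  · have : |(m₂ : ℝ)| < |(m₁ : ℝ)| := by linarith
    norm_num [share, this, this.not_gt, hτb _ (not_le.1 h3)]
  all_goals norm_num

end Density

/-! ### The secured payoff as an integral of the smaller density. -/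

section Secured

variable {ε a : ℝ} {G : Measure State}

theorem abs_obsDensity_le (hε : 0 < ε) (m m' : Message) (s : ℝ) :
    |obsDensity ε a G m m' s| ≤ densityConst ε a G := by
  rw [abs_of_nonneg (obsDensity_nonneg hε m m' s)]; exact obsDensity_le hε m m' s

variable (ε a G) in
/-- The pointwise minimum of the two densities of the judge's observation. -/
noncomputable def minDensity (x : Message × Message × ℝ) : ℝ :=
  min (obsDensity ε a G x.1 x.2.1 x.2.2) (obsDensity ε a G x.2.1 x.1 x.2.2)

theorem measurable_minDensity : Measurable (minDensity ε a G) :=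
  measurable_obsDensity.min measurable_obsDensity_swap

theorem abs_minDensity_le (hε : 0 < ε) (x : Message × Message × ℝ) :
    |minDensity ε a G x| ≤ densityConst ε a G := by
  rw [minDensity, abs_of_nonneg (le_min (obsDensity_nonneg hε _ _ _) (obsDensity_nonneg hε _ _ _))]
  exact (min_le_left _ _).trans (obsDensity_le hε _ _ _)

open Classical in
theorem minDensity_eq (hε : 0 < ε) (m m' : Message) (s : ℝ) : minDensity ε a G (m, m', s) =
    if m ∈ centralStates a then if m' ∈ centralStates a then
      if |s - m| ≤ ε then if |s - m'| ≤ ε then densityConst ε a G else 0 else 0 else 0 else 0 := by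
  have := densityConst_nonneg (a := a) (G := G) hε
  unfold minDensity obsDensity
  by_cases h1 : m ∈ centralStates a <;> by_cases h2 : m' ∈ centralStates a <;>
    by_cases h3 : |s - m| ≤ ε <;> by_cases h4 : |s - m'| ≤ ε <;> simp [h1, h2, h3, h4, this]

variable [IsProbabilityMeasure G]

theorem map_swap_referenceMeasure :
    (referenceMeasure G).map (fun x => (x.2.1, x.1, x.2.2)) = referenceMeasure G := by
  refine Measure.ext_of_lintegral _ fun H hH => ?_
  rw [lintegral_map hH (by fun_prop)]
  exact lintegral_referenceMeasure_swap hH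

theorem integral_referenceMeasure_swap {H : Message × Message × ℝ → ℝ} (hH : Measurable H) :
    ∫ x, H (x.2.1, x.1, x.2.2) ∂referenceMeasure G = ∫ x, H x ∂referenceMeasure G := by
  conv_rhs => rw [← map_swap_referenceMeasure]
  rw [integral_map (by fun_prop) hH.aestronglyMeasurable]

theorem integral_referenceMeasure {H : Message × Message × ℝ → ℝ} (hH : Measurable H) {C : ℝ}
    (hC : ∀ x, |H x| ≤ C) : ∫ x, H x ∂referenceMeasure G =
      ∫ m, ∫ m', ∫ s, H (m, m', s) ∂signalMeasure ∂G ∂G := by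
  rw [referenceMeasure, integral_prod _ (integrable_of_bounded hH hC)]
  congr 1 with m
  exact integral_prod _ (integrable_of_bounded (hH.comp measurable_prodMk_left) fun y => hC (m, y))

theorem integral_quack_play (hε : ε ∈ Set.Ioo (0 : ℝ) 1) {H : Message → Message → ℝ → ℝ}
    (hH : Measurable fun x : Message × Message × ℝ => H x.1 x.2.1 x.2.2)
    (h1 : ∀ m m' s, |H m m' s| ≤ 1) :
    ∫ m, ∫ ω : State, ∫ e, H m ω ((ω : ℝ) + e) ∂noise ε ∂G ∂truncatedPrior G a =
      ∫ x, obsDensity ε a G x.2.1 x.1 x.2.2 * H x.1 x.2.1 x.2.2 ∂referenceMeasure G := by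
  rw [integral_referenceMeasure
    (H := fun x => obsDensity ε a G x.2.1 x.1 x.2.2 * H x.1 x.2.1 x.2.2)
    (measurable_obsDensity_swap.mul hH)
    (C := densityConst ε a G * 1) fun x => ?_, integral_truncatedPrior,
    ← integral_indicator (measurableSet_centralStates a), ← integral_const_mul]
  · congr 1 with m
    by_cases hm : m ∈ centralStates a
    · rw [Set.indicator_of_mem hm, ← integral_const_mul]
      congr 1 with ω
      have e : ∫ y, H m ω ((ω : ℝ) + y) ∂noise ε = _ := integral_noise hε ω.2 (fun s => H m ω s)
      rw [e, ← mul_assoc, ← integral_const_mul]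
      congr 1 with s
      by_cases hs : |s - ω| ≤ ε <;> simp [obsDensity, hm, hs, densityConst, mul_comm]
    · rw [Set.indicator_of_notMem hm]
      simp [obsDensity, hm]
  · rw [abs_mul]
    exact mul_le_mul (abs_obsDensity_le hε.1 _ _ _) (h1 _ _ _) (abs_nonneg _)
      (densityConst_nonneg hε.1)

theorem quackPayoff_zero (hε : ε ∈ Set.Ioo (0 : ℝ) 1) (ha : 0 < G.real (centralStates a))
    (φ : SelectionRule) : quackPayoff G ε truthful φ 0 (truncatedPrior G a) =
      ∫ x, obsDensity ε a G x.2.1 x.1 x.2.2 * φ.prob x.1 x.2.1 x.2.2 ∂referenceMeasure G := by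
  have := isProbabilityMeasure_truncatedPrior ha
  rw [quackPayoff_eq hε.1, integral_quack_play hε (φ.measurable_sel 0) (φ.abs_sel_le 0)]
  simp [SelectionRule.sel]

theorem quackPayoff_one (hε : ε ∈ Set.Ioo (0 : ℝ) 1) (ha : 0 < G.real (centralStates a))
    (φ : SelectionRule) : quackPayoff G ε truthful φ 1 (truncatedPrior G a) =
      ∫ x, obsDensity ε a G x.1 x.2.1 x.2.2 * (1 - φ.prob x.1 x.2.1 x.2.2)
        ∂referenceMeasure G := by
  have := isProbabilityMeasure_truncatedPrior ha
  rw [quackPayoff_eq hε.1, integral_quack_play hε (φ.measurable_sel 1) (φ.abs_sel_le 1)]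
  rw [← integral_referenceMeasure_swap
    (H := fun x => obsDensity ε a G x.1 x.2.1 x.2.2 * (1 - φ.prob x.1 x.2.1 x.2.2))
    (measurable_obsDensity.mul (measurable_const.sub φ.measurable_prob))]
  simp [SelectionRule.sel]

open Classical in
variable (ε a G) in
/-- The rule that selects the speaker who is less likely to be the quack. -/
noncomputable def likelihoodRule : SelectionRule where
  prob m₁ m₂ s := if obsDensity ε a G m₂ m₁ s < obsDensity ε a G m₁ m₂ s then 1 else 0
  measurable_prob := Measurable.ite
    (measurableSet_lt measurable_obsDensity_swap measurable_obsDensity)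
    measurable_const measurable_const
  prob_mem m₁ m₂ s := by split_ifs <;> norm_num

/-- A selection rule gives the quack a pointwise convex combination of the two densities, which is
at least their minimum; the likelihood rule attains it everywhere. -/
theorem securedPayoff_eq_minDensity (hε : ε ∈ Set.Ioo (0 : ℝ) 1)
    (ha : 0 < G.real (centralStates a)) :
    securedPayoff G ε (truncatedPrior G a) =
      1 / 2 * ∫ x, minDensity ε a G x ∂referenceMeasure G := by
  have hprob : ∀ φ : SelectionRule, ∀ x : Message × Message × ℝ,
      |φ.prob x.1 x.2.1 x.2.2| ≤ 1 ∧ |1 - φ.prob x.1 x.2.1 x.2.2| ≤ 1 := fun φ x => by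
    have := φ.prob_mem x.1 x.2.1 x.2.2
    constructor <;> rw [abs_le] <;> constructor <;> linarith [this.1, this.2]
  have hi : ∀ φ : SelectionRule, Integrable (fun x : Message × Message × ℝ =>
      obsDensity ε a G x.2.1 x.1 x.2.2 * φ.prob x.1 x.2.1 x.2.2) (referenceMeasure G) := fun φ =>
    integrable_of_bounded (measurable_obsDensity_swap.mul φ.measurable_prob)
      (C := densityConst ε a G * 1) fun x => by
        rw [abs_mul]
        exact mul_le_mul (abs_obsDensity_le hε.1 _ _ _) (hprob φ x).1 (abs_nonneg _)
          (densityConst_nonneg hε.1)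
  have hi' : ∀ φ : SelectionRule, Integrable (fun x : Message × Message × ℝ =>
      obsDensity ε a G x.1 x.2.1 x.2.2 * (1 - φ.prob x.1 x.2.1 x.2.2)) (referenceMeasure G) :=
    fun φ => integrable_of_bounded
      (measurable_obsDensity.mul (measurable_const.sub φ.measurable_prob))
      (C := densityConst ε a G * 1) fun x => by
        rw [abs_mul]
        exact mul_le_mul (abs_obsDensity_le hε.1 _ _ _) (hprob φ x).2 (abs_nonneg _)
          (densityConst_nonneg hε.1)
  have hsum : ∀ φ : SelectionRule,
      (quackPayoff G ε truthful φ 0 (truncatedPrior G a) +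
        quackPayoff G ε truthful φ 1 (truncatedPrior G a)) / 2 =
      1 / 2 * ∫ x, (obsDensity ε a G x.2.1 x.1 x.2.2 * φ.prob x.1 x.2.1 x.2.2 +
        obsDensity ε a G x.1 x.2.1 x.2.2 * (1 - φ.prob x.1 x.2.1 x.2.2))
          ∂referenceMeasure G := fun φ => by
    rw [quackPayoff_zero hε ha, quackPayoff_one hε ha, integral_add (hi φ) (hi' φ)]
    ring
  have hlower : ∀ φ : SelectionRule, 1 / 2 * ∫ x, minDensity ε a G x ∂referenceMeasure G ≤
      (quackPayoff G ε truthful φ 0 (truncatedPrior G a) +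
        quackPayoff G ε truthful φ 1 (truncatedPrior G a)) / 2 := fun φ => by
    rw [hsum]
    refine mul_le_mul_of_nonneg_left (integral_mono
      (integrable_of_bounded measurable_minDensity (abs_minDensity_le hε.1))
      ((hi φ).add (hi' φ)) fun x => ?_) (by norm_num)
    have h1 := φ.prob_mem x.1 x.2.1 x.2.2
    have h2 : minDensity ε a G x ≤ obsDensity ε a G x.1 x.2.1 x.2.2 := min_le_left _ _
    have h3 : minDensity ε a G x ≤ obsDensity ε a G x.2.1 x.1 x.2.2 := min_le_right _ _
    have h4 := mul_le_mul_of_nonneg_right h3 h1.1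
    have h5 := mul_le_mul_of_nonneg_right h2 (sub_nonneg.2 h1.2)
    linarith
  have hattain : (quackPayoff G ε truthful (likelihoodRule ε a G) 0 (truncatedPrior G a) +
        quackPayoff G ε truthful (likelihoodRule ε a G) 1 (truncatedPrior G a)) / 2 =
      1 / 2 * ∫ x, minDensity ε a G x ∂referenceMeasure G := by
    rw [hsum]
    congr 2 with x
    simp only [likelihoodRule, minDensity]
    split_ifs with h
    · rw [min_eq_right h.le]; ring
    · rw [min_eq_left (not_lt.1 h)]; ring
  have : Nonempty SelectionRule := ⟨likelihoodRule ε a G⟩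
  refine le_antisymm ?_ (le_ciInf hlower)
  rw [← hattain]
  exact ciInf_le ⟨_, by rintro _ ⟨φ, rfl⟩; exact hlower φ⟩ (likelihoodRule ε a G)

/-- Integrating the signal out first leaves the overlap of two windows. -/
theorem integral_minDensity_tent (hε : ε ∈ Set.Ioo (0 : ℝ) 1) :
    ∫ x, minDensity ε a G x ∂referenceMeasure G =
      densityConst ε a G * ∫ m in centralStates a, ∫ m' in centralStates a,
        tent ε ((m : ℝ) - m') ∂G ∂G := by
  rw [integral_referenceMeasure measurable_minDensity (abs_minDensity_le hε.1),
    ← integral_indicator (measurableSet_centralStates a), ← integral_const_mul]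
  congr 1 with m
  by_cases hm : m ∈ centralStates a
  · rw [Set.indicator_of_mem hm, ← integral_indicator (measurableSet_centralStates a),
      ← integral_const_mul]
    congr 1 with m'
    by_cases hm' : m' ∈ centralStates a
    · simp only [minDensity_eq hε.1, hm, hm', if_true, Set.indicator_of_mem]
      exact integral_two_windows hε.2 m.2 _ _
    · simp [minDensity_eq hε.1, hm, hm']
  · simp [minDensity_eq hε.1, hm]

-- Integrating the messages out first: for a fixed signal they are independent and face the same
-- condition, hence the square.
open Classical in
theorem integral_minDensity_sq (hε : ε ∈ Set.Ioo (0 : ℝ) 1) :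
    ∫ x, minDensity ε a G x ∂referenceMeasure G = densityConst ε a G *
      ∫ s, (G.real (centralStates a ∩ {m : State | |s - m| ≤ ε})) ^ 2 ∂signalMeasure := by
  have hM : ∀ p : Message × Message × ℝ, |minDensity ε a G p| ≤ densityConst ε a G :=
    abs_minDensity_le hε.1
  rw [integral_referenceMeasure measurable_minDensity hM]
  have e1 : ∀ m : Message, ∫ m', ∫ s, minDensity ε a G (m, m', s) ∂signalMeasure ∂G =
      ∫ s, ∫ m', minDensity ε a G (m, m', s) ∂G ∂signalMeasure := fun m =>
    integral_integral_swap (f := fun m' s => minDensity ε a G (m, m', s))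
      (integrable_of_bounded (measurable_minDensity.comp measurable_prodMk_left)
        fun p => hM (m, p))
  simp only [e1]
  have hm : Measurable (fun p : (Message × ℝ) × Message =>
      minDensity ε a G (p.1.1, p.2, p.1.2)) :=
    measurable_minDensity.comp
      (by fun_prop : Measurable fun p : (Message × ℝ) × Message => (p.1.1, p.2, p.1.2))
  have e2 : ∫ m, ∫ s, ∫ m', minDensity ε a G (m, m', s) ∂G ∂signalMeasure ∂G =
      ∫ s, ∫ m, ∫ m', minDensity ε a G (m, m', s) ∂G ∂G ∂signalMeasure :=
    integral_integral_swap (f := fun m s => ∫ m', minDensity ε a G (m, m', s) ∂G)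
      (integrable_of_bounded hm.stronglyMeasurable.integral_prod_right'.measurable
        fun p => abs_integral_le_of_prob fun m' => hM (p.1, m', p.2))
  rw [e2, ← integral_const_mul]
  congr 1 with s
  set A : Set State := centralStates a ∩ {m : State | |s - m| ≤ ε} with hA
  have hAm : MeasurableSet A := (measurableSet_centralStates a).inter
    (measurableSet_le (by fun_prop) measurable_const)
  have e3 : ∀ m m' : Message, minDensity ε a G (m, m', s) =
      densityConst ε a G * (A.indicator 1 m * A.indicator 1 m') := fun m m' => by
    rw [minDensity_eq hε.1]
    have hmem : ∀ x : State, A.indicator (1 : State → ℝ) x =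
        if x ∈ centralStates a then if |s - x| ≤ ε then 1 else 0 else 0 := fun x => by
      simp only [hA, Set.indicator, Set.mem_inter_iff, Set.mem_ofPred_eq, Pi.one_apply]
      split_ifs <;> first | rfl | (exfalso; tauto)
    rw [hmem, hmem]
    split_ifs <;> simp
  simp only [e3, integral_const_mul, integral_mul_const, integral_indicator_one hAm]
  ring

end Secured

/-! ### The secured payoff as a running mean. -/

section Value

variable {h : ℝ → ℝ} {ε a : ℝ} {G : Measure State}

theorem integral_centralStates_abs (hmap : G.map Subtype.val = symMeasure h) (F : ℝ → ℝ) :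
    ∫ m in centralStates a, F (m : ℝ) ∂G =
      ∫ x, (Set.Iic a).indicator (fun _ => (1 : ℝ)) |x| * F x ∂symMeasure h := by
  rw [← integral_indicator (measurableSet_centralStates a), ← integral_coe hmap]
  congr 1 with m
  simp only [Set.indicator, centralStates, Set.mem_ofPred_eq, Set.mem_Icc, Set.mem_Iic, abs_le]
  split_ifs <;> simp

theorem setIntegral_Ioi_indicator (F : ℝ → ℝ) :
    ∫ y in Set.Ioi 0, (Set.Iic a).indicator (fun _ => (1 : ℝ)) y * F y ∂symMeasure h =
      ∫ y in Set.Ioc 0 a, F y ∂symMeasure h := by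
  have : ∀ y, (Set.Iic a).indicator (fun _ => (1 : ℝ)) y * F y = (Set.Iic a).indicator F y :=
    fun y => by by_cases hy : y ∈ Set.Iic a <;> simp [hy]
  simp only [this]
  rw [integral_indicator measurableSet_Iic, Measure.restrict_restrict measurableSet_Iic,
    Set.inter_comm, Set.Ioi_inter_Iic]

variable [IsFiniteMeasure (symMeasure h)]

/-- One factor `2` comes from folding the outer variable, the other from the two equal triangles of
the symmetric kernel on `(0, a]` squared. -/
theorem integral_tent_centralStates (hh : Antitone h) (h0 : ∀ x, 0 ≤ h x)
    (hmap : G.map Subtype.val = symMeasure h) (hε : 0 ≤ ε) (ha : 0 ≤ a) :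
    ∫ m in centralStates a, ∫ m' in centralStates a, tent ε ((m : ℝ) - m') ∂G ∂G =
      4 * ∫ z in Set.Ioc 0 a, lowerMass (symMeasure h) (kern ε) z z ∂symMeasure h := by
  set P : ℝ → ℝ := (Set.Iic a).indicator (fun _ => (1 : ℝ)) with hP
  have hPm : Measurable P := measurable_const.indicator measurableSet_Iic
  have hPB : ∀ x, |P x| ≤ 1 := fun x => by
    by_cases hx : x ∈ Set.Iic a <;> simp [hP, hx]
  set Q : ℝ → ℝ := fun x => ∫ y in Set.Ioc 0 a, kern ε x y ∂symMeasure h with hQ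
  have hQm : Measurable Q :=
    measurable_setIntegral_Ioc (measurable_kern ε) measurable_const measurable_const
  have hQB : ∀ x, |Q x| ≤ 4 * ε * (symMeasure h).real Set.univ := fun x =>
    abs_setIntegral_le fun y => abs_kern_le hε x y
  have e1 : ∀ m : State, ∫ m' in centralStates a, tent ε ((m : ℝ) - m') ∂G = Q |(m : ℝ)| :=
    fun m => by
      rw [integral_centralStates_abs hmap (fun x => tent ε (m - x)),
        integral_abs_mul_tent hh h0 hε hPm hPB, setIntegral_Ioi_indicator]
  simp only [e1]
  rw [integral_centralStates_abs hmap (fun x => Q |x|)]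
  have hi : Integrable (fun x => P |x| * Q |x|) (symMeasure h) :=
    integrable_of_bounded ((hPm.comp measurable_abs).mul (hQm.comp measurable_abs))
      (C := 1 * (4 * ε * (symMeasure h).real Set.univ)) fun x => by
        rw [abs_mul]
        exact mul_le_mul (hPB _) (hQB _) (abs_nonneg _) zero_le_one
  have e2 : ∫ y in Set.Ioi 0, (P |y| * Q |y| + P |-y| * Q |-y|) ∂symMeasure h =
      ∫ y in Set.Ioi 0, P y * (2 * Q y) ∂symMeasure h := by
    refine setIntegral_congr_fun measurableSet_Ioi fun y hy => ?_
    simp only [abs_neg, abs_of_pos (Set.mem_Ioi.1 hy)]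
    ring
  rw [integral_symMeasure_fold hh h0 (integrable_density hh h0 hi), e2, hP,
    setIntegral_Ioi_indicator, integral_const_mul]
  have hkC : ∀ x y, |kern ε x y| ≤ 4 * ε := fun x y => abs_kern_le hε x y
  have sw := triangle_swap (μ := symMeasure h) (measurable_kern ε) hkC
    (measurable_const (a := (1 : ℝ))) (B := 1) (by simp) ha le_rfl
  simp only [mul_one, one_mul, Set.Ioc_self, Measure.restrict_empty, integral_zero_measure,
    add_zero] at sw
  have hWi : Integrable (fun x => lowerMass (symMeasure h) (kern ε) x x) (symMeasure h) :=
    integrable_of_bounded (measurable_diag (measurable_kern ε)) fun x => abs_lowerMass_le hkC x x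
  have hUi : Integrable (fun z => ∫ y in Set.Ioc z a, kern ε z y ∂symMeasure h) (symMeasure h) :=
    integrable_of_bounded
      (measurable_setIntegral_Ioc (measurable_kern ε) measurable_id measurable_const)
      fun x => abs_setIntegral_le fun y => hkC x y
  have e3 : ∫ z in Set.Ioc 0 a, Q z ∂symMeasure h =
      ∫ z in Set.Ioc 0 a, (lowerMass (symMeasure h) (kern ε) z z +
        ∫ y in Set.Ioc z a, kern ε z y ∂symMeasure h) ∂symMeasure h := by
    refine setIntegral_congr_fun measurableSet_Ioc fun z hz => ?_
    simp only [hQ]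
    have hki : Integrable (fun y => kern ε z y) (symMeasure h) :=
      integrable_of_bounded ((measurable_kern ε).comp measurable_prodMk_left) (hkC z)
    rw [setIntegral_Ioc_split hki hz.1.le hz.2, lowerMass]
    simp only [kern_comm ε _ z]
  rw [e3, integral_add hWi.integrableOn hUi.integrableOn, sw]
  ring

theorem securedPayoff_eq_average [IsProbabilityMeasure G] (hh : Antitone h) (h0 : ∀ x, 0 ≤ h x)
    (hmap : G.map Subtype.val = symMeasure h) (hε : ε ∈ Set.Ioo (0 : ℝ) 1) (ha0 : 0 ≤ a)
    (ha : 0 < G.real (centralStates a)) :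
    securedPayoff G ε (truncatedPrior G a) = 1 / (2 * ε) * average (symMeasure h) (kern ε) a := by
  rw [securedPayoff_eq_minDensity hε ha, integral_minDensity_tent hε,
    integral_tent_centralStates hh h0 hmap hε.1.le ha0, densityConst,
    measureReal_centralStates hh h0 hmap, average]
  rw [measureReal_centralStates hh h0 hmap] at ha
  have hn : (symMeasure h).real (Set.Ioc 0 a) ≠ 0 := by
    intro hc; rw [hc] at ha; simp at ha
  have := hε.1.ne'
  field_simp
  ring

end Value

/-! ### Distribution functions and the closed form. -/

section DistFun

variable {h : ℝ → ℝ} {ε a : ℝ} {G : Measure State}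

theorem distFun_eq (hmap : G.map Subtype.val = symMeasure h) (x : ℝ) :
    distFun G x = (symMeasure h).real (Set.Iic x) :=
  measureReal_preimage_coe hmap measurableSet_Iic

variable [IsProbabilityMeasure G]

theorem measureReal_between (hmap : G.map Subtype.val = symMeasure h) {p q : ℝ} (hpq : p ≤ q) :
    G.real {ω : State | (ω : ℝ) ∈ Set.Icc p q} = distFun G q - distFun G p := by
  have hfin : IsFiniteMeasure (symMeasure h) := by
    rw [← hmap]; infer_instance
  rw [distFun_eq hmap, distFun_eq hmap]
  have e1 : G.real {ω : State | (ω : ℝ) ∈ Set.Icc p q} = (symMeasure h).real (Set.Icc p q) :=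
    measureReal_preimage_coe hmap measurableSet_Icc
  have e2 : (symMeasure h).real (Set.Icc p q) = (symMeasure h).real (Set.Ioc p q) :=
    (measureReal_congr Ioc_ae_eq_Icc).symm
  rw [e1, e2, ← Set.Iic_union_Ioc_eq_Iic hpq,
    measureReal_union (Set.Iic_disjoint_Ioc le_rfl) measurableSet_Ioc]
  ring

theorem distFun_add_distFun_neg (hh : Antitone h) (h0 : ∀ x, 0 ≤ h x)
    (hmap : G.map Subtype.val = symMeasure h) (x : ℝ) :
    distFun G x + distFun G (-x) = 1 := by
  have hprob : IsProbabilityMeasure (symMeasure h) := by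
    rw [← hmap]; exact Measure.isProbabilityMeasure_map measurable_subtype_coe.aemeasurable
  have hint : ∀ y, (symMeasure h).real (Set.Iic y) =
      ∫ u, (Set.Iic y).indicator (fun _ => (1 : ℝ)) u ∂symMeasure h := fun y => by
    rw [integral_indicator measurableSet_Iic]; simp
  have hm : ∀ y, Integrable ((Set.Iic y).indicator (fun _ => (1 : ℝ))) (symMeasure h) := fun y =>
    (integrable_const _).indicator measurableSet_Iic
  rw [distFun_eq hmap, distFun_eq hmap, hint, hint, ← integral_add (hm _) (hm _),
    integral_symMeasure hh h0]
  have e1 : ∫ u, h |u| * ((Set.Iic x).indicator (fun _ => (1 : ℝ)) u +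
      (Set.Iic (-x)).indicator (fun _ => (1 : ℝ)) u) =
      ∫ u, h |u| * ((Set.Iic x).indicator (fun _ => (1 : ℝ)) u +
        (Set.Ici x).indicator (fun _ => (1 : ℝ)) u) := by
    have i1 := integrable_density hh h0 (hm x)
    have i2 := integrable_density hh h0 (hm (-x))
    have i3 : Integrable (fun u => h |u| * (Set.Ici x).indicator (fun _ => (1 : ℝ)) u) :=
      integrable_density hh h0 ((integrable_const _).indicator measurableSet_Ici)
    simp only [mul_add]
    rw [integral_add i1 i2, integral_add i1 i3]
    congr 1
    rw [← integral_neg_eq_self]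
    congr 1 with u
    simp only [abs_neg, Set.indicator, Set.mem_Iic, Set.mem_Ici, neg_le_neg_iff]
  have e2 : ∫ u, h |u| * ((Set.Iic x).indicator (fun _ => (1 : ℝ)) u +
        (Set.Ici x).indicator (fun _ => (1 : ℝ)) u) = ∫ u, h |u| * 1 := by
    refine integral_congr_ae ?_
    have hne : ∀ᵐ u : ℝ, u ≠ x := by simp [ae_iff]
    filter_upwards [hne] with u hu
    rcases lt_or_gt_of_ne hu with hlt | hlt
    · simp [hlt.le, hlt]
    · simp [hlt.le, hlt]
  rw [e1, e2, ← integral_symMeasure hh h0 (fun _ => 1)]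
  simp

theorem measureReal_centralStates_eq (hh : Antitone h) (h0 : ∀ x, 0 ≤ h x)
    (hmap : G.map Subtype.val = symMeasure h) (ha : 0 ≤ a) :
    G.real (centralStates a) = 2 * distFun G a - 1 := by
  rw [centralStates, measureReal_between hmap (by linarith : -a ≤ a)]
  linarith [distFun_add_distFun_neg hh h0 hmap a]

theorem distFun_truncatedPrior (hmap : G.map Subtype.val = symMeasure h) (ha0 : 0 ≤ a)
    (ha : 0 < G.real (centralStates a)) (m : ℝ) :
    distFun (truncatedPrior G a) m =
      if m ≤ -a then 0
      else if m ≤ a then (distFun G m - distFun G (-a)) / (distFun G a - distFun G (-a)) else 1 := by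
  have e : distFun (truncatedPrior G a) m =
      G.real (centralStates a ∩ {ω | (ω : ℝ) ≤ m}) / G.real (centralStates a) := by
    rw [distFun, truncatedPrior]
    change (ProbabilityTheory.cond G (centralStates a) _).toReal = _
    rw [cond_apply (measurableSet_centralStates a),
      ENNReal.toReal_mul, ENNReal.toReal_inv, inv_mul_eq_div]
    rfl
  have hI : centralStates a ∩ {ω : State | (ω : ℝ) ≤ m} =
      {ω : State | (ω : ℝ) ∈ Set.Icc (-a) (min a m)} := by
    ext ω
    simp only [centralStates, Set.mem_inter_iff, Set.mem_ofPred_eq, Set.mem_Icc, le_min_iff]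
    tauto
  have hN : G.real (centralStates a) = distFun G a - distFun G (-a) := by
    rw [centralStates, measureReal_between hmap (by linarith : -a ≤ a)]
  rw [e, hI]
  split_ifs with h1 h2
  · have : G.real {ω : State | (ω : ℝ) ∈ Set.Icc (-a) (min a m)} = 0 := by
      have hsub : {ω : State | (ω : ℝ) ∈ Set.Icc (-a) (min a m)} ⊆
          {ω : State | (ω : ℝ) ∈ Set.Icc (-a) (-a)} := fun ω hω =>
        ⟨hω.1, hω.2.trans ((min_le_right _ _).trans h1)⟩
      refine le_antisymm ((measureReal_mono hsub).trans_eq ?_) measureReal_nonneg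
      rw [measureReal_between hmap le_rfl, sub_self]
    rw [this, zero_div]
  · rw [min_eq_right h2, measureReal_between hmap (not_le.1 h1).le, hN]
  · rw [min_eq_left (not_le.1 h2).le]
    exact div_self ha.ne'

theorem securedPayoff_eq_integral (hh : Antitone h) (h0 : ∀ x, 0 ≤ h x)
    (hmap : G.map Subtype.val = symMeasure h) (hε : ε ∈ Set.Ioo (0 : ℝ) 1)
    (ha : a ∈ Set.Ioc (0 : ℝ) 1) (hpos : 0 < G.real (centralStates a)) :
    securedPayoff G ε (truncatedPrior G a) =
      1 / (4 * (2 * distFun G a - 1) * ε) * ∫ s in (-a - ε)..(a + ε),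
        (distFun G (min (s + ε) a) - distFun G (max (s - ε) (-a))) ^ 2 := by
  have hε0 := hε.1
  have hε1 := hε.2
  have ha0 := ha.1
  have ha1 := ha.2
  rw [securedPayoff_eq_minDensity hε hpos, integral_minDensity_sq hε, ← mul_assoc]
  congr 1
  · rw [densityConst, ← measureReal_centralStates_eq hh h0 hmap ha0.le]
    field_simp
    norm_num
  · have hset : ∀ s : ℝ, centralStates a ∩ {m : State | |s - (m : ℝ)| ≤ ε} =
        {m : State | (m : ℝ) ∈ Set.Icc (max (s - ε) (-a)) (min (s + ε) a)} := fun s => by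
      ext m
      simp only [centralStates, Set.mem_inter_iff, Set.mem_ofPred_eq, Set.mem_Icc, abs_le,
        le_min_iff, max_le_iff]
      constructor
      · rintro ⟨⟨h1, h2⟩, h3, h4⟩; exact ⟨⟨by linarith, h1⟩, by linarith, h2⟩
      · rintro ⟨⟨h1, h2⟩, h3, h4⟩; exact ⟨⟨h2, h4⟩, by linarith, by linarith⟩
    -- Both `a ≤ 1` and `ε < 1` enter here. Signals in `[-2, 2]` outside the smaller interval fit no
    -- central message and contribute zero.
    have hcov : Set.Icc (-a - ε) (a + ε) ⊆ Set.Icc (-2 : ℝ) 2 :=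
      Set.Icc_subset_Icc (by linarith) (by linarith)
    rw [signalMeasure, intervalIntegral.integral_of_le (by linarith),
      ← integral_Icc_eq_integral_Ioc]
    have hzero : ∀ s ∈ Set.Icc (-2 : ℝ) 2 \ Set.Icc (-a - ε) (a + ε),
        G.real (centralStates a ∩ {m : State | |s - m| ≤ ε}) ^ 2 = 0 := fun s hs => by
      have : {m : State | (m : ℝ) ∈ Set.Icc (max (s - ε) (-a)) (min (s + ε) a)} = ∅ := by
        ext m
        simp only [Set.mem_ofPred_eq, Set.mem_Icc, le_min_iff, max_le_iff,
          Set.mem_empty_iff_false, iff_false]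
        rintro ⟨⟨h1, h2⟩, h3, h4⟩
        exact hs.2 ⟨by linarith, by linarith⟩
      rw [hset, this]
      simp
    rw [setIntegral_eq_of_subset_of_forall_sdiff_eq_zero measurableSet_Icc hcov hzero]
    refine setIntegral_congr_fun measurableSet_Icc fun s hs => ?_
    rw [hset, measureReal_between hmap]
    exact max_le (le_min (by linarith) (by linarith [hs.2])) (le_min (by linarith [hs.1])
      (by linarith))

end DistFun

/-- Extending the shares by zero beyond `b` truncates the tail integral at `b`, so the balance
equation gives indifference on `[-b, b]`. Beyond `b` only the diagonal `lowerMass` remains, which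
`hout` bounds. -/
theorem exists_quackValue_bound {G : Measure State} [IsProbabilityMeasure G]
    {h : ℝ → ℝ} (hh : Antitone h) (h0 : ∀ x, 0 ≤ h x) (hmap : G.map Subtype.val = symMeasure h)
    {ε b c : ℝ} (hε : 0 ≤ ε)
    (hout : ∀ x ∈ Set.Ioc b 1, lowerMass (symMeasure h) (kern ε) x x ≤ c)
    {θ : ℝ → ℝ} (hθm : Measurable θ) (hθ : ∀ x, θ x ∈ Set.Icc (0 : ℝ) (1 / 2))
    (hbal : ∀ x ∈ Set.Icc 0 b, (1 - θ x) * lowerMass (symMeasure h) (kern ε) x x +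
      ∫ y in Set.Ioc x b, kern ε x y * θ y ∂symMeasure h = c) :
    ∃ τ : ℝ → ℝ, Measurable τ ∧ (∀ x, τ x ∈ Set.Icc (0 : ℝ) 1) ∧ (∀ x, b < x → τ x = 0) ∧
      (∀ m : State, quackValue ε τ G m ≤ c) ∧
      ∀ m ∈ centralStates b, quackValue ε τ G m = c := by
  have hfin : IsFiniteMeasure (symMeasure h) := by
    rw [← hmap]; infer_instance
  set τ : ℝ → ℝ := (Set.Iic b).indicator θ with hτdef
  have hτm : Measurable τ := hθm.indicator measurableSet_Iic
  have hτ : ∀ x, τ x ∈ Set.Icc (0 : ℝ) 1 := fun x => by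
    by_cases hx : x ∈ Set.Iic b
    · rw [hτdef, Set.indicator_of_mem hx]
      exact ⟨(hθ x).1, (hθ x).2.trans (by norm_num)⟩
    · rw [hτdef, Set.indicator_of_notMem hx]; norm_num
  have hτb : ∀ x, b < x → τ x = 0 := fun x hx => by
    rw [hτdef, Set.indicator_of_notMem]
    exact not_le.2 hx
  have hin : ∀ m : State, |(m : ℝ)| ≤ b → quackValue ε τ G m = c := fun m hm => by
    rw [quackValue, integral_share_tent hh h0 hmap hε hτm hτ, ← hbal _ ⟨abs_nonneg _, hm⟩,
      hτdef, Set.indicator_of_mem (show |(m : ℝ)| ∈ Set.Iic b from hm)]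
    congr 1
    have e : ∀ y, (Set.Iic b).indicator θ y * kern ε |(m : ℝ)| y =
        (Set.Iic b).indicator (fun y => kern ε |(m : ℝ)| y * θ y) y := fun y => by
      by_cases hy : y ∈ Set.Iic b <;> simp [hy, mul_comm]
    simp only [e]
    rw [integral_indicator measurableSet_Iic, Measure.restrict_restrict measurableSet_Iic,
      Set.inter_comm, Set.Ioi_inter_Iic]
  refine ⟨τ, hτm, hτ, hτb, fun m => ?_, fun m hm => hin m (abs_le.2 hm)⟩
  rcases le_or_gt |(m : ℝ)| b with hm | hm
  · exact (hin m hm).le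
  · rw [quackValue, integral_share_tent hh h0 hmap hε hτm hτ, hτb _ hm]
    have e : ∫ y in Set.Ioi |(m : ℝ)|, τ y * kern ε |(m : ℝ)| y ∂symMeasure h = 0 := by
      rw [setIntegral_congr_fun (g := fun _ => (0 : ℝ)) measurableSet_Ioi fun y hy => ?_]
      · simp
      · simp only [hτb y (hm.trans hy), zero_mul]
    rw [e, sub_zero, one_mul, add_zero]
    exact hout _ ⟨hm, abs_le.2 m.2⟩

end ExpertQuack

open ExpertQuack

theorem mainTheorem8 (G : Measure ExpertQuack.State) [IsProbabilityMeasure G]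
    (hG : ExpertQuack.SymmetricStrictlyUnimodal G) (ε : ℝ) (hε : ε ∈ Set.Ioo (0 : ℝ) 1) :
    ∃ mbar ∈ Set.Ioc (0 : ℝ) 1,
      -- truth-telling and the truncated prior form an equilibrium with some selection rule
      (∃ φ : ExpertQuack.SelectionRule,
        ExpertQuack.IsPBE G ε ExpertQuack.truthful (ExpertQuack.truncatedPrior G mbar) φ) ∧
      -- the distribution function of the quack's message
      (∀ m : ℝ, ExpertQuack.distFun (ExpertQuack.truncatedPrior G mbar) m =
        if m ≤ -mbar then 0
        else if m ≤ mbar then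
          (ExpertQuack.distFun G m - ExpertQuack.distFun G (-mbar)) /
            (ExpertQuack.distFun G mbar - ExpertQuack.distFun G (-mbar))
        else 1) ∧
      -- the threshold is the unique maximizer of the securable payoff
      (∀ a ∈ Set.Ioc (0 : ℝ) 1, a ≠ mbar →
        ExpertQuack.securedPayoff G ε (ExpertQuack.truncatedPrior G a) <
          ExpertQuack.securedPayoff G ε (ExpertQuack.truncatedPrior G mbar)) ∧
      -- the securable payoff in closed form
      (∀ a ∈ Set.Ioc (0 : ℝ) 1,
        ExpertQuack.securedPayoff G ε (ExpertQuack.truncatedPrior G a) =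
          1 / (4 * (2 * ExpertQuack.distFun G a - 1) * ε) *
            ∫ s in (-a - ε)..(a + ε),
              (ExpertQuack.distFun G (min (s + ε) a) -
                ExpertQuack.distFun G (max (s - ε) (-a))) ^ 2) := by
  obtain ⟨h, hh, h0, hs, hmap⟩ := hG.exists_density
  have hfin : IsFiniteMeasure (symMeasure h) := by
    rw [← hmap]; infer_instance
  have hpos : ∀ a ∈ Set.Ioc (0 : ℝ) 1, 0 < G.real (centralStates a) := fun a ha => by
    rw [measureReal_centralStates hh h0 hmap]
    have := measureReal_Ioc_pos hh h0 hs le_rfl ha.1 ha.2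
    linarith
  obtain ⟨b, hb, huniq, hout, θ, hθm, hθ, hbal⟩ := exists_share hh h0 hs hε
  obtain ⟨τ, hτm, hτ, hτb, hle, heq⟩ := exists_quackValue_bound hh h0 hmap hε.1.le hout hθm hθ hbal
  have hval : ∀ a ∈ Set.Ioc (0 : ℝ) 1, securedPayoff G ε (truncatedPrior G a) =
      1 / (2 * ε) * average (symMeasure h) (kern ε) a := fun a ha =>
    securedPayoff_eq_average hh h0 hmap hε ha.1.le (hpos a ha)
  refine ⟨b, hb, ⟨shareRule hτm hτ ε, ?_⟩, distFun_truncatedPrior hmap hb.1.le (hpos b hb),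
    fun a ha hab => ?_, fun a ha => securedPayoff_eq_integral hh h0 hmap hε ha (hpos a ha)⟩
  · exact {
      expert_strategy := by unfold truthful; infer_instance
      quack_strategy := isProbabilityMeasure_truncatedPrior (hpos b hb)
      expert_optimal := fun i ω ν _ =>
        expertPayoff_shareRule_le hε hτm hτ (hpos b hb) hτb hle heq i ω ν
      quack_optimal := fun i ν _ => quackPayoff_shareRule_le hε hτm hτ (hpos b hb) hle heq i ν
      judge_optimal := ⟨belief ε b, bayesConsistent_belief hε (hpos b hb),
        shareRule_judge_optimal hτm hτ hτb⟩ }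
  · rw [hval a ha, hval b hb]
    have := hε.1
    exact mul_lt_mul_of_pos_left (huniq a ha hab) (by positivity)
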